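/- Let $K$ be a field extension of $\mathbb{C}$ (for instance $K=\mathbb{C}$, or a field containing indeterminates), let $d\ge 1$, and let $x=(x_m)_{m\in\mathbb{Z}/d\mathbb{Z}}$ in $K$, with $x_0=1$, be a solution of the E-system $$\sum_{s\in\mathbb{Z}/d} x_{m+s}x_{-s}=x_m\sum_{s\in\mathbb{Z}/d}x_sx_{-s}\qquad(m\ne 0);$$ such solutions are parametrized by the non-empty subsets $S\subseteq\mathbb{Z}/d\mathbb{Z}$. Put $E=\frac1d\sum_{s}x_sx_{-s}$. Let $q,\zeta,u,z\in K\setminus\{0\}$ be such that $$\lambda_{H}=\frac{\zeta+1-q}{q\zeta}\quad\text{and}\quad \lambda_{Y}=\frac{z+(1-u)E}{uz}$$ are non-zero. Let $B_n$ be the braid group on $n\geq 1$ strands, with generators $\sigma_1,\dots,\sigma_{n-1}$, and let $\epsilon(\alpha)$ be the exponent sum of $\alpha\in B_n$. Let $H_n(q)$ be the Iwahori-Hecke $K$-algebra with generators $G_1,\dots,G_{n-1}$ subject to the braid relations and $G_i^2=(q-1)G_i+q$. Let $\pi(\sigma_i)=G_i$, and let $\tau$ be the Ocneanu trace, i.e.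 the unique linear trace on the tower $(H_n(q))_{n\ge0}$ with $\tau(hh')=\tau(h'h)$, $\tau(1)=1$ and $\tau(hG_n)=\zeta\,\tau(h)$ for $h,h'\in H_n(q)$. Let $Y_{d,n}(u)$ be the Yokonuma-Hecke $K$-algebra with generators $g_1,\dots,g_{n-1},t_1,\dots,t_n$, where the $g_i$ satisfy the braid relations, $t_it_j=t_jt_i$, $t_jg_i=g_it_{s_i(j)}$ with $s_i=(i,i+1)$, $t_j^d=1$, and $g_i^2=1+(u-1)e_i+(u-1)e_ig_i$ with $e_i=\frac1d\sum_{s=0}^{d-1}t_i^st_{i+1}^{-s}$. Let $\delta(\sigma_i)=g_i$, and let $\mathrm{tr}_S$ be the specialized Juyumaya trace, i.e. the unique linear trace on the tower $(Y_{d,n}(u))_{n\ge0}$ with $\mathrm{tr}_S(ab)=\mathrm{tr}_S(ba)$, $\mathrm{tr}_S(1)=1$, $\mathrm{tr}_S(ag_n)=z\,\mathrm{tr}_S(a)$ and $\mathrm{tr}_S(at_{n+1}^m)=x_m\,\mathrm{tr}_S(a)$ for $a,b\in Y_{d,n}(u)$ and $1\le m\le d-1$. For square roots $\sqrt{\lambda_H},\sqrt{\lambda_Y}\in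 K$ put $D_H=\frac{1}{\zeta\sqrt{\lambda_H}}$, $D_Y=\frac{1}{z\sqrt{\lambda_Y}}$ and, for $\alpha\in B_n$ with closure $\widehat\alpha$, $$P(\widehat\alpha)=D_H^{\,n-1}(\sqrt{\lambda_H})^{\epsilon(\alpha)}\,\tau(\pi(\alpha)),\qquad \Delta_S(\widehat\alpha)=D_Y^{\,n-1}(\sqrt{\lambda_Y})^{\epsilon(\alpha)}\,\mathrm{tr}_S(\delta(\alpha)).$$ Write $P=\Delta_S$ if $P(\widehat\alpha)=\Delta_S(\widehat\alpha)$ for all $n\ge1$ and all $\alpha\in B_n$. Fix a square root $\sqrt{\lambda_H}\in K$. **Theorem.** (a) For every square root $\sqrt{\lambda_Y}\in K$ of $\lambda_Y$: there are $(c_n)_{n\ge1}$ in $\mathbb{C}(q,\zeta,u,z,E)\subseteq K$ such that $P(\widehat\alpha)=c_n\,\Delta_S(\widehat\alpha)$ for all $n\ge1$ and all $\alpha\in B_n$ if and only if $P=\Delta_S$. Moreover, any such $(c_n)$ satisfies $c_n=1$ for all $n\ge1$, and then $D_H=D_Y$. (b) $P=\Delta_S$ holds for some choice of the square root $\sqrt{\lambda_Y}\in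 K$ if and only if one of the following 14 cases holds: 1. $q=1,\ \zeta=z,\ u=1$; 2. $q=1,\ \zeta=-z,\ u=1$; 3. $\zeta=q,\ u=1,\ z=1$; 4. $\zeta=q,\ u=1,\ z=-1$; 5. $\zeta=-1,\ u=1,\ z=1$; 6. $\zeta=-1,\ u=1,\ z=-1$; 7. $q=1,\ \zeta=E,\ z=-E$; 8. $q=1,\ \zeta=-E,\ z=-E$; 9. $\zeta=q,\ z=-1,\ E=1$; 10. $\zeta=q,\ z=u,\ E=1$; 11. $\zeta=-1,\ z=-1,\ E=1$; 12. $\zeta=-1,\ z=u,\ E=1$; 13. $q=u,\ \zeta=z,\ E=1$; 14. $q=1/u,\ \zeta=-z/u,\ E=1$. -/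

import Mathlib

open Finset

/-! ### Braid groups

Throughout, objects "on `n` strands" have braiding generators `1, …, n - 1` (indexed by
`Fin (n - 1)`, so the index `i` stands for the generator number `i + 1`) and framing generators
`1, …, n` (indexed by `Fin n`). -/

/-- The left strand of the `i`-th crossing. -/
def strandL {n : ℕ} (i : Fin (n - 1)) : Fin n := ⟨i, by omega⟩

/-- The right strand of the `i`-th crossing. -/
def strandR {n : ℕ} (i : Fin (n - 1)) : Fin n := ⟨i + 1, by omega⟩

/-- The inclusion of the set of crossings of `n` strands in that of `n + 1` strands. -/
def crossSucc {n : ℕ} (i : Fin (n - 1)) : Fin (n + 1 - 1) := ⟨i, by omega⟩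

/-- The last crossing on `n + 2` strands, i.e. the generator number `n + 1`. -/
def crossLast (n : ℕ) : Fin (n + 2 - 1) := ⟨n, by omega⟩

/-- The relators of Artin's presentation of the braid group on `n` strands. -/
inductive BraidRel (n : ℕ) : FreeGroup (Fin (n - 1)) → Prop
  | far (i j : Fin (n - 1)) (h : (i : ℕ) + 1 < j) :
      BraidRel n (.of i * .of j * (.of j * .of i)⁻¹)
  | near (i j : Fin (n - 1)) (h : (i : ℕ) + 1 = j) :
      BraidRel n (.of i * .of j * .of i * (.of j * .of i * .of j)⁻¹)

/-- The classical braid group `B_n` on `n` strands. -/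
abbrev BraidGroup (n : ℕ) : Type := PresentedGroup {r | BraidRel n r}

/-- A group homomorphism out of the braid group, from elements that satisfy the braid relations. -/
def braidLift {G : Type*} [Group G] {n : ℕ} (f : Fin (n - 1) → G)
    (far : ∀ i j : Fin (n - 1), (i : ℕ) + 1 < j → f i * f j = f j * f i)
    (near : ∀ i j : Fin (n - 1), (i : ℕ) + 1 = j → f i * f j * f i = f j * f i * f j) :
    BraidGroup n →* G :=
  PresentedGroup.toGroup (f := f) (by
    rintro _ (⟨i, j, h⟩ | ⟨i, j, h⟩)
    · simp only [map_mul, map_inv, FreeGroup.lift_apply_of]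
      rw [far i j h, mul_inv_cancel]
    · simp only [map_mul, map_inv, FreeGroup.lift_apply_of]
      rw [near i j h, mul_inv_cancel])

/-- The sum `ε(α)` of the exponents of the braid generators in `α`. -/
def expSum {n : ℕ} (α : BraidGroup n) : ℤ :=
  Multiplicative.toAdd (braidLift (fun _ : Fin (n - 1) => Multiplicative.ofAdd (1 : ℤ))
    (fun _ _ _ => rfl) (fun _ _ _ => rfl) α)

/-! ### The Iwahori-Hecke algebra and the Ocneanu trace -/

section Hecke

variable {K : Type*} [Field K]

/-- The defining relations of the Iwahori-Hecke algebra of type `A`. -/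
inductive HeckeRel (q : K) (n : ℕ) :
    FreeAlgebra K (Fin (n - 1)) → FreeAlgebra K (Fin (n - 1)) → Prop
  | far (i j : Fin (n - 1)) (h : (i : ℕ) + 1 < j) :
      HeckeRel q n (.ι K i * .ι K j) (.ι K j * .ι K i)
  | near (i j : Fin (n - 1)) (h : (i : ℕ) + 1 = j) :
      HeckeRel q n (.ι K i * .ι K j * .ι K i) (.ι K j * .ι K i * .ι K j)
  | quad (i : Fin (n - 1)) :
      HeckeRel q n (.ι K i ^ 2) ((q - 1) • .ι K i + q • 1)

/-- The Iwahori-Hecke algebra `H_n(q)`. -/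
abbrev HeckeAlg (q : K) (n : ℕ) := RingQuot (HeckeRel q n)

/-- The generator `G_i` of `H_n(q)`. -/
noncomputable def heckeG (q : K) {n : ℕ} (i : Fin (n - 1)) : HeckeAlg q n :=
  RingQuot.mkAlgHom K (HeckeRel q n) (.ι K i)

theorem heckeG_far (q : K) {n : ℕ} (i j : Fin (n - 1)) (h : (i : ℕ) + 1 < j) :
    heckeG q i * heckeG q j = heckeG q j * heckeG q i := by
  simpa [heckeG] using RingQuot.mkAlgHom_rel K (HeckeRel.far (q := q) i j h)

theorem heckeG_near (q : K) {n : ℕ} (i j : Fin (n - 1)) (h : (i : ℕ) + 1 = j) :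
    heckeG q i * heckeG q j * heckeG q i = heckeG q j * heckeG q i * heckeG q j := by
  simpa [heckeG] using RingQuot.mkAlgHom_rel K (HeckeRel.near (q := q) i j h)

theorem heckeG_sq (q : K) {n : ℕ} (i : Fin (n - 1)) :
    heckeG q i ^ 2 = (q - 1) • heckeG q i + q • 1 := by
  simpa [heckeG] using RingQuot.mkAlgHom_rel K (HeckeRel.quad (q := q) i)

/-- The natural algebra map `H_n(q) → H_{n+1}(q)`. -/
noncomputable def heckeIncl (q : K) (n : ℕ) : HeckeAlg q n →ₐ[K] HeckeAlg q (n + 1) :=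
  RingQuot.liftAlgHom K ⟨FreeAlgebra.lift K (fun i => heckeG q (crossSucc i)), by
    rintro _ _ (⟨i, j, h⟩ | ⟨i, j, h⟩ | i)
    · simpa using heckeG_far q (crossSucc i) (crossSucc j) h
    · simpa using heckeG_near q (crossSucc i) (crossSucc j) h
    · simpa using heckeG_sq q (crossSucc i)⟩

/-- The generators of `H_n(q)` are invertible. -/
noncomputable def heckeUnit {q : K} (hq : q ≠ 0) {n : ℕ} (i : Fin (n - 1)) : (HeckeAlg q n)ˣ where
  val := heckeG q i
  inv := q⁻¹ • heckeG q i + (q⁻¹ - 1) • 1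
  val_inv := by
    have h := heckeG_sq q i
    rw [pow_two] at h
    rw [mul_add, mul_smul_comm, mul_smul_comm, h, mul_one]
    match_scalars <;> field_simp
    ring
  inv_val := by
    have h := heckeG_sq q i
    rw [pow_two] at h
    rw [add_mul, smul_mul_assoc, smul_mul_assoc, h, one_mul]
    match_scalars <;> field_simp
    ring

/-- The natural map `π` from the braid group to the Hecke algebra, `σ_i ↦ G_i`. -/
noncomputable def heckeRep {q : K} (hq : q ≠ 0) (n : ℕ) : BraidGroup n →* (HeckeAlg q n)ˣ :=
  braidLift (fun i => heckeUnit hq i)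
    (fun i j h => Units.ext (heckeG_far q i j h))
    (fun i j h => Units.ext (heckeG_near q i j h))

/-- The rules of a linear Markov trace with parameter `ζ` on the tower of the Hecke algebras
(a linear map on the union of the tower is given by its restrictions to the members). -/
structure IsOcneanuTrace (q ζ : K) (τ : ∀ n, HeckeAlg q n →ₗ[K] K) : Prop where
  incl : ∀ n (h : HeckeAlg q n), τ (n + 1) (heckeIncl q n h) = τ n h
  comm : ∀ n (h h' : HeckeAlg q n), τ n (h * h') = τ n (h' * h)
  one : ∀ n, τ n 1 = 1
  markov : ∀ n (h : HeckeAlg q (n + 1)),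
    τ (n + 2) (heckeIncl q (n + 1) h * heckeG q (crossLast n)) = ζ * τ (n + 1) h

open Classical in
/-- The Ocneanu trace `τ` with parameter `ζ`: the unique family that satisfies the rules above.
(By Ocneanu's theorem it always exists; the value `0` is never used.) -/
noncomputable def ocneanuTrace (q ζ : K) : ∀ n, HeckeAlg q n →ₗ[K] K :=
  if h : ∃ τ, IsOcneanuTrace q ζ τ then h.choose else 0

/-- `λ_H = (ζ + (1 - q)) / (q ζ)`. -/
def lambdaH (q ζ : K) : K := (ζ + (1 - q)) / (q * ζ)

/-- `D_H = 1 / (ζ √λ_H)`, where `r` is the square root of `λ_H` that is used. -/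
def DH (ζ r : K) : K := 1 / (ζ * r)

/-- The value `P(α̂) = D_H ^ (n - 1) (√λ_H) ^ ε(α) τ(π(α))` of the HOMFLYPT polynomial at the
closure of the braid `α` on `n ≥ 1` strands; `r` is the square root of `λ_H` that is used. -/
noncomputable def homflypt {q : K} (hq : q ≠ 0) (ζ r : K) {n : ℕ} (α : BraidGroup n) : K :=
  DH ζ r ^ (n - 1) * r ^ expSum α * ocneanuTrace q ζ n (heckeRep hq n α : HeckeAlg q n)

end Hecke

/-! ### The Yokonuma-Hecke algebra and the specialized Juyumaya trace -/

section Yokonuma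

variable {K : Type*} [Field K]

/-- The generators `g_1, …, g_{n-1}` and `t_1, …, t_n`. -/
inductive YokoGen (n : ℕ)
  | g (i : Fin (n - 1))
  | t (j : Fin n)

/-- The element `e_i = (1/d) ∑_{s=0}^{d-1} t_i ^ s t_{i+1} ^ (-s)`, where `t_{i+1} ^ (-s)` is
written as `t_{i+1} ^ (d - s)`; here `a = t_i` and `b = t_{i+1}`. -/
noncomputable def yokoIdem (K : Type*) [Field K] (d : ℕ) {A : Type*} [Ring A] [Algebra K A]
    (a b : A) : A :=
  (d : K)⁻¹ • ∑ s ∈ range d, a ^ s * b ^ (d - s)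

/-- The defining relations of the Yokonuma-Hecke algebra. -/
inductive YokoRel (d : ℕ) (u : K) (n : ℕ) :
    FreeAlgebra K (YokoGen n) → FreeAlgebra K (YokoGen n) → Prop
  | far (i j : Fin (n - 1)) (h : (i : ℕ) + 1 < j) :
      YokoRel d u n (.ι K (.g i) * .ι K (.g j)) (.ι K (.g j) * .ι K (.g i))
  | near (i j : Fin (n - 1)) (h : (i : ℕ) + 1 = j) :
      YokoRel d u n (.ι K (.g i) * .ι K (.g j) * .ι K (.g i))
        (.ι K (.g j) * .ι K (.g i) * .ι K (.g j))
  | tt (i j : Fin n) :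
      YokoRel d u n (.ι K (.t i) * .ι K (.t j)) (.ι K (.t j) * .ι K (.t i))
  | tg (i : Fin (n - 1)) (j : Fin n) :
      YokoRel d u n (.ι K (.t j) * .ι K (.g i))
        (.ι K (.g i) * .ι K (.t (Equiv.swap (strandL i) (strandR i) j)))
  | tpow (j : Fin n) : YokoRel d u n (.ι K (.t j) ^ d) 1
  | quad (i : Fin (n - 1)) :
      YokoRel d u n (.ι K (.g i) ^ 2)
        (1 + (u - 1) • yokoIdem K d (.ι K (.t (strandL i))) (.ι K (.t (strandR i)))
          + (u - 1) • (yokoIdem K d (.ι K (.t (strandL i))) (.ι K (.t (strandR i)))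
              * .ι K (.g i)))

/-- The Yokonuma-Hecke algebra `Y_{d,n}(u)`. -/
abbrev YokoAlg (d : ℕ) (u : K) (n : ℕ) := RingQuot (YokoRel d u n)

/-- The generator `g_i` of `Y_{d,n}(u)`. -/
noncomputable def yokoG (d : ℕ) (u : K) {n : ℕ} (i : Fin (n - 1)) : YokoAlg d u n :=
  RingQuot.mkAlgHom K (YokoRel d u n) (.ι K (.g i))

/-- The generator `t_j` of `Y_{d,n}(u)`. -/
noncomputable def yokoT (d : ℕ) (u : K) {n : ℕ} (j : Fin n) : YokoAlg d u n :=
  RingQuot.mkAlgHom K (YokoRel d u n) (.ι K (.t j))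

/-- The element `e_i` of `Y_{d,n}(u)`. -/
noncomputable def yokoE (d : ℕ) (u : K) {n : ℕ} (i : Fin (n - 1)) : YokoAlg d u n :=
  yokoIdem K d (yokoT d u (strandL i)) (yokoT d u (strandR i))

theorem map_yokoIdem {d : ℕ} {A B : Type*} [Ring A] [Algebra K A] [Ring B] [Algebra K B]
    (f : A →ₐ[K] B) (a b : A) : f (yokoIdem K d a b) = yokoIdem K d (f a) (f b) := by
  simp [yokoIdem, map_sum]

theorem yokoG_far (d : ℕ) (u : K) {n : ℕ} (i j : Fin (n - 1)) (h : (i : ℕ) + 1 < j) :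
    yokoG d u i * yokoG d u j = yokoG d u j * yokoG d u i := by
  simpa [yokoG] using RingQuot.mkAlgHom_rel K (YokoRel.far (d := d) (u := u) i j h)

theorem yokoG_near (d : ℕ) (u : K) {n : ℕ} (i j : Fin (n - 1)) (h : (i : ℕ) + 1 = j) :
    yokoG d u i * yokoG d u j * yokoG d u i = yokoG d u j * yokoG d u i * yokoG d u j := by
  simpa [yokoG] using RingQuot.mkAlgHom_rel K (YokoRel.near (d := d) (u := u) i j h)

theorem yokoT_comm (d : ℕ) (u : K) {n : ℕ} (i j : Fin n) :
    yokoT d u i * yokoT d u j = yokoT d u j * yokoT d u i := by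
  simpa [yokoT] using RingQuot.mkAlgHom_rel K (YokoRel.tt (d := d) (u := u) i j)

theorem yokoT_mul_yokoG (d : ℕ) (u : K) {n : ℕ} (i : Fin (n - 1)) (j : Fin n) :
    yokoT d u j * yokoG d u i
      = yokoG d u i * yokoT d u (Equiv.swap (strandL i) (strandR i) j) := by
  simpa [yokoT, yokoG] using RingQuot.mkAlgHom_rel K (YokoRel.tg (d := d) (u := u) i j)

theorem yokoT_pow (d : ℕ) (u : K) {n : ℕ} (j : Fin n) : yokoT d u j ^ d = 1 := by
  simpa [yokoT] using RingQuot.mkAlgHom_rel K (YokoRel.tpow (d := d) (u := u) j)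

theorem yokoG_sq (d : ℕ) (u : K) {n : ℕ} (i : Fin (n - 1)) :
    yokoG d u i ^ 2 = 1 + (u - 1) • yokoE d u i + (u - 1) • (yokoE d u i * yokoG d u i) := by
  simpa [yokoT, yokoG, yokoE, map_yokoIdem] using
    RingQuot.mkAlgHom_rel K (YokoRel.quad (d := d) (u := u) i)

/-- The natural algebra map `Y_{d,n}(u) → Y_{d,n+1}(u)`. -/
noncomputable def yokoIncl (d : ℕ) (u : K) (n : ℕ) : YokoAlg d u n →ₐ[K] YokoAlg d u (n + 1) :=
  RingQuot.liftAlgHom K ⟨FreeAlgebra.lift K (fun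
      | .g i => yokoG d u (crossSucc i)
      | .t j => yokoT d u j.castSucc), by
    rintro _ _ (⟨i, j, h⟩ | ⟨i, j, h⟩ | ⟨i, j⟩ | ⟨i, j⟩ | j | i)
    · simpa using yokoG_far d u (crossSucc i) (crossSucc j) h
    · simpa using yokoG_near d u (crossSucc i) (crossSucc j) h
    · simpa using yokoT_comm d u i.castSucc j.castSucc
    · have h := yokoT_mul_yokoG d u (crossSucc i) j.castSucc
      have hL : strandL (crossSucc i) = (strandL i).castSucc := rfl
      have hR : strandR (crossSucc i) = (strandR i).castSucc := rfl
      rw [hL, hR, ← (Fin.castSucc_injective n).map_swap] at h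
      simpa using h
    · simpa using yokoT_pow d u j.castSucc
    · have h := yokoG_sq d u (crossSucc i)
      have hL : strandL (crossSucc i) = (strandL i).castSucc := rfl
      have hR : strandR (crossSucc i) = (strandR i).castSucc := rfl
      rw [yokoE, hL, hR] at h
      simpa [map_yokoIdem] using h⟩

theorem yokoIdem_comm {d : ℕ} {A : Type*} [Ring A] [Algebra K A] {a b : A}
    (hab : a * b = b * a) (ha : a ^ d = 1) (hb : b ^ d = 1) :
    yokoIdem K d a b = yokoIdem K d b a := by
  have hc : Commute a b := hab
  unfold yokoIdem
  congr 1
  rcases Nat.eq_zero_or_pos d with rfl | hd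
  · simp
  obtain ⟨m, rfl⟩ : ∃ m, d = m + 1 := ⟨d - 1, by omega⟩
  rw [sum_range_succ', sum_range_succ', ← sum_range_reflect]
  congr 1
  · refine sum_congr rfl fun s hs => ?_
    have hs := mem_range.1 hs
    rw [show m - 1 - s + 1 = m + 1 - (s + 1) by omega,
      show m + 1 - (m + 1 - (s + 1)) = s + 1 by omega]
    exact (hc.pow_pow _ _).eq
  · simp [ha, hb]

theorem mul_yokoIdem {d : ℕ} {A : Type*} [Ring A] [Algebra K A] {a b : A}
    (hab : a * b = b * a) (ha : a ^ d = 1) (hb : b ^ d = 1) :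
    a * yokoIdem K d a b = b * yokoIdem K d a b := by
  have hc : Commute a b := hab
  unfold yokoIdem
  rw [mul_smul_comm, mul_smul_comm]
  congr 1
  rcases Nat.eq_zero_or_pos d with rfl | hd
  · simp
  obtain ⟨m, rfl⟩ : ∃ m, d = m + 1 := ⟨d - 1, by omega⟩
  rw [mul_sum, mul_sum, sum_range_succ, sum_range_succ']
  congr 1
  · refine sum_congr rfl fun s hs => ?_
    have hs := mem_range.1 hs
    rw [← mul_assoc, ← pow_succ', ← mul_assoc, ((hc.symm.pow_right (s + 1))).eq, mul_assoc,
      ← pow_succ', show m + 1 - (s + 1) + 1 = m + 1 - s by omega]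
  · rw [← mul_assoc, ← pow_succ', ha, one_mul, show m + 1 - m = 1 by omega]
    simp [hb]

theorem yokoIdem_sq [CharZero K] {d : ℕ} {A : Type*} [Ring A] [Algebra K A] {a b : A}
    (hab : a * b = b * a) (ha : a ^ d = 1) (hb : b ^ d = 1) :
    yokoIdem K d a b * yokoIdem K d a b = yokoIdem K d a b := by
  rcases Nat.eq_zero_or_pos d with rfl | hd
  · simp [yokoIdem]
  have hc : Commute a b := hab
  have key : ∀ k, b ^ k * yokoIdem K d a b = a ^ k * yokoIdem K d a b := by
    intro k
    induction k with
    | zero => simp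
    | succ k ih =>
      rw [pow_succ, mul_assoc, ← mul_yokoIdem hab ha hb, ← mul_assoc,
        (hc.symm.pow_left k).eq, mul_assoc, ih, ← mul_assoc, ← pow_succ']
  conv_lhs => enter [1]; unfold yokoIdem
  rw [smul_mul_assoc, sum_mul]
  rw [sum_congr rfl (g := fun _ => yokoIdem K d a b) (fun s hs => by
    have hs := mem_range.1 hs
    rw [mul_assoc, key, ← mul_assoc, ← pow_add, show s + (d - s) = d by omega, ha, one_mul])]
  rw [sum_const, card_range, ← Nat.cast_smul_eq_nsmul K, smul_smul,
    inv_mul_cancel₀ (by exact_mod_cast hd.ne'), one_smul]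

theorem yokoE_sq [CharZero K] (d : ℕ) (u : K) {n : ℕ} (i : Fin (n - 1)) :
    yokoE d u i * yokoE d u i = yokoE d u i :=
  yokoIdem_sq (yokoT_comm d u _ _) (yokoT_pow d u _) (yokoT_pow d u _)

theorem yokoE_mul_yokoG (d : ℕ) (u : K) {n : ℕ} (i : Fin (n - 1)) :
    yokoE d u i * yokoG d u i = yokoG d u i * yokoE d u i := by
  have hL := yokoT_mul_yokoG d u i (strandL i)
  have hR := yokoT_mul_yokoG d u i (strandR i)
  rw [Equiv.swap_apply_left] at hL
  rw [Equiv.swap_apply_right] at hR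
  have hLs : ∀ k, yokoT d u (strandL i) ^ k * yokoG d u i
      = yokoG d u i * yokoT d u (strandR i) ^ k := fun k =>
    ((show SemiconjBy (yokoG d u i) (yokoT d u (strandR i)) (yokoT d u (strandL i)) from
      hL.symm).pow_right k).eq.symm
  have hRs : ∀ k, yokoT d u (strandR i) ^ k * yokoG d u i
      = yokoG d u i * yokoT d u (strandL i) ^ k := fun k =>
    ((show SemiconjBy (yokoG d u i) (yokoT d u (strandL i)) (yokoT d u (strandR i)) from
      hR.symm).pow_right k).eq.symm
  have h : yokoE d u i = yokoIdem K d (yokoT d u (strandR i)) (yokoT d u (strandL i)) :=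
    yokoIdem_comm (yokoT_comm d u _ _) (yokoT_pow d u _) (yokoT_pow d u _)
  conv_rhs => rw [h]
  unfold yokoE yokoIdem
  rw [smul_mul_assoc, mul_smul_comm, sum_mul, mul_sum]
  congr 1
  refine sum_congr rfl fun s _ => ?_
  rw [mul_assoc, hRs, ← mul_assoc, hLs, mul_assoc]

/-- The generators `g_i` of `Y_{d,n}(u)` are invertible. -/
noncomputable def yokoUnit [CharZero K] (d : ℕ) {u : K} (hu : u ≠ 0) {n : ℕ} (i : Fin (n - 1)) :
    (YokoAlg d u n)ˣ where
  val := yokoG d u i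
  inv := yokoG d u i + (u⁻¹ - 1) • yokoE d u i + (u⁻¹ - 1) • (yokoE d u i * yokoG d u i)
  val_inv := by
    have h := yokoG_sq d u i
    have he := yokoE_sq d u i
    have hc := yokoE_mul_yokoG d u i
    rw [pow_two] at h
    generalize yokoG d u i = g at *
    generalize yokoE d u i = e at *
    rw [mul_add, mul_add, mul_smul_comm, mul_smul_comm, ← hc, ← mul_assoc g e g, ← hc,
      mul_assoc e g g, h, mul_add, mul_add, mul_smul_comm, mul_smul_comm, ← mul_assoc e e g, he,
      mul_one]
    match_scalars <;> field_simp <;> ring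
  inv_val := by
    have h := yokoG_sq d u i
    have he := yokoE_sq d u i
    rw [pow_two] at h
    generalize yokoG d u i = g at *
    generalize yokoE d u i = e at *
    rw [add_mul, add_mul, smul_mul_assoc, smul_mul_assoc,
      mul_assoc e g g, h, mul_add, mul_add, mul_smul_comm, mul_smul_comm, ← mul_assoc e e g, he,
      mul_one]
    match_scalars <;> field_simp <;> ring

/-- The natural map `δ` from the braid group to the Yokonuma-Hecke algebra, `σ_i ↦ g_i`. -/
noncomputable def yokoRep [CharZero K] (d : ℕ) {u : K} (hu : u ≠ 0) (n : ℕ) :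
    BraidGroup n →* (YokoAlg d u n)ˣ :=
  braidLift (fun i => yokoUnit d hu i)
    (fun i j h => Units.ext (yokoG_far d u i j h))
    (fun i j h => Units.ext (yokoG_near d u i j h))

/-- The rules of a linear Markov trace with parameters `z, x_1, …, x_{d-1}` on the tower of the
Yokonuma-Hecke algebras (the index of `x` is read modulo `d`). -/
structure IsJuyumayaTrace (d : ℕ) (u z : K) (x : ZMod d → K)
    (tr : ∀ n, YokoAlg d u n →ₗ[K] K) : Prop where
  incl : ∀ n (a : YokoAlg d u n), tr (n + 1) (yokoIncl d u n a) = tr n a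
  comm : ∀ n (a b : YokoAlg d u n), tr n (a * b) = tr n (b * a)
  one : ∀ n, tr n 1 = 1
  markov : ∀ n (a : YokoAlg d u (n + 1)),
    tr (n + 2) (yokoIncl d u (n + 1) a * yokoG d u (crossLast n)) = z * tr (n + 1) a
  framing : ∀ n (a : YokoAlg d u n) (m : ℕ), 1 ≤ m → m < d →
    tr (n + 1) (yokoIncl d u n a * yokoT d u (Fin.last n) ^ m) = x (m : ZMod d) * tr n a

open Classical in
/-- The (specialized) Juyumaya trace with parameters `z, x_1, …, x_{d-1}`: the unique family that
satisfies the rules above. (By Juyumaya's theorem it always exists for `d ≥ 1` and `u ≠ 0` in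
characteristic zero; the value `0` is never used.) -/
noncomputable def juyumayaTrace (d : ℕ) (u z : K) (x : ZMod d → K) :
    ∀ n, YokoAlg d u n →ₗ[K] K :=
  if h : ∃ tr, IsJuyumayaTrace d u z x tr then h.choose else 0

/-- The E-system for `x_1, …, x_{d-1}`, with `x_0 = 1` and the indices read modulo `d`. -/
def IsESolution {d : ℕ} [NeZero d] (x : ZMod d → K) : Prop :=
  x 0 = 1 ∧ ∀ m : ZMod d, m ≠ 0 →
    ∑ s : ZMod d, x (m + s) * x (-s) = x m * ∑ s : ZMod d, x s * x (-s)

/-- `E = (1/d) ∑_s x_s x_{d-s}`, the trace of the elements `e_i`. -/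
def paramE {d : ℕ} [NeZero d] (x : ZMod d → K) : K := (d : K)⁻¹ * ∑ s : ZMod d, x s * x (-s)

/-- `λ_Y = (z + (1 - u) E) / (u z)`. -/
def lambdaY (u z E : K) : K := (z + (1 - u) * E) / (u * z)

/-- `D_Y = 1 / (z √λ_Y)`, where `r` is the square root of `λ_Y` that is used. -/
def DY (z r : K) : K := 1 / (z * r)

/-- The value `Δ_S(α̂) = D_Y ^ (n - 1) (√λ_Y) ^ ε(α) tr_S(δ(α))` at the closure of the braid `α`
on `n ≥ 1` strands of the invariant given by the solution `x` of the E-system; `r` is the square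
root of `λ_Y` that is used. -/
noncomputable def deltaInv [CharZero K] {d : ℕ} (x : ZMod d → K) {u : K} (hu : u ≠ 0) (z r : K)
    {n : ℕ} (α : BraidGroup n) : K :=
  DY z r ^ (n - 1) * r ^ expSum α * juyumayaTrace d u z x n (yokoRep d hu n α : YokoAlg d u n)

end Yokonuma

/-- The 14 cases (rows 1 to 14) of the table, for nonzero parameters `q, ζ, u, z`. -/
def InTable {K : Type*} [Field K] (q ζ u z E : K) : Prop :=
  (q = 1 ∧ ζ = z ∧ u = 1) ∨
  (q = 1 ∧ ζ = -z ∧ u = 1) ∨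
  (ζ = q ∧ u = 1 ∧ z = 1) ∨
  (ζ = q ∧ u = 1 ∧ z = -1) ∨
  (ζ = -1 ∧ u = 1 ∧ z = 1) ∨
  (ζ = -1 ∧ u = 1 ∧ z = -1) ∨
  (q = 1 ∧ ζ = E ∧ z = -E) ∨
  (q = 1 ∧ ζ = -E ∧ z = -E) ∨
  (ζ = q ∧ z = -1 ∧ E = 1) ∨
  (ζ = q ∧ z = u ∧ E = 1) ∨
  (ζ = -1 ∧ z = -1 ∧ E = 1) ∨
  (ζ = -1 ∧ z = u ∧ E = 1) ∨
  (q = u ∧ ζ = z ∧ E = 1) ∨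
  (q = 1 / u ∧ ζ = -z / u ∧ E = 1)

/-!
The proof compares the two Markov traces through a quotient.

The Juyumaya trace is built here together with its defining rules. The algebra `Y_{n+1}` is
spanned by the elements `a t_{n+1}^s` and `a g_n b` with `a`, `b` in `Y_n`
(`yoko_span_induction`), so the rules determine the trace on `Y_{n+1}` from the one on `Y_n`.
Existence follows from a representation of `Y_{n+1}` by matrices over `Y_n[t] / (t^d - 1)` on
cosets (`cosetFamily`, `cosetRep`), whose entries give the extended linear form; its trace
property reduces to the symmetry of the form `(a, b) ↦ T (a g b g)` on `Y_n`
(`MarkovStep.beta_symm`). The Ocneanu trace is the case `d = 1` (`isOcneanuTrace_ocneanuTrace`).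

For the "if" part of the table, the point is that the `g_i` often satisfy the quadratic relation
of some Hecke algebra `H_n(p)` modulo the radical of the Juyumaya trace; the trace on braids is
then the Ocneanu trace for `(p, z)`, by uniqueness (`IsJuyumayaTrace.eq_ocneanuTrace`). This holds
with `p = 1` when `u = 1`, with `p = 1` when `z = -E`, since then the elements `e_i (1 + g_i)` are
in the radical (`IsJuyumayaTrace.mul_lastH_eq_zero`), and with `p = u` when `E = 1`, since then
`x` is a character of `ℤ/d` and every `t_j` acts on the trace by the scalar `x_1`
(`IsJuyumayaTrace.mul_lastE_eq`). What remains is to compare two HOMFLYPT polynomials: either the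
parameters coincide, or they are related by `q ↦ q⁻¹`, `ζ ↦ -ζ / q` (`homflypt_symm`), or both
traces are one-dimensional characters (`homflypt_of_sq_eq`).

For the "only if" part and for the constants `c_n`, it is enough to evaluate the invariants at the
trivial braids and at `σ_1`, `σ_1²`, `σ_1³` and the figure-eight braid `σ_1 σ_2⁻¹ σ_1 σ_2⁻¹`. The
trivial braids and `σ_1` give `c_n = 1` and `D_H = D_Y`. In terms of the eigenvalues `u`, `1`,
`-1` of `g`, the powers of `σ_1` say that `(ρ g - q) (ρ g + 1)` with `ρ = ζ / z` pairs to zero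
with each spectral projection of `g`. This leaves the table and two extra families, which the
figure-eight braid excludes because `E ≠ -1` (`inTable_of_equations`); indeed `E` is `0` or the
inverse of the rank of an idempotent circulant matrix (`IsESolution.exists_idempotent`).
-/

section InvariantComparison

variable {K : Type*} [Field K]

/-! ### Relations of Yokonuma-Hecke type -/

/-- Families `g`, `t` indexed by `ℕ` in an algebra whose members `g i` with `i + 1 < n` and `t j`
with `j < n` satisfy the defining relations of `Y_{d,n}(u)`; nothing is required of the others. -/
structure YokoFamily (d : ℕ) (u : K) (n : ℕ) {A : Type*} [Ring A] [Algebra K A]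
    (g t : ℕ → A) : Prop where
  far : ∀ i j, i + 1 < j → j + 1 < n → g i * g j = g j * g i
  near : ∀ i, i + 2 < n → g i * g (i + 1) * g i = g (i + 1) * g i * g (i + 1)
  tt : ∀ i j, i < n → j < n → t i * t j = t j * t i
  tg_left : ∀ i, i + 1 < n → t i * g i = g i * t (i + 1)
  tg_right : ∀ i, i + 1 < n → t (i + 1) * g i = g i * t i
  tg_of_ne : ∀ i j, i + 1 < n → j < n → j ≠ i → j ≠ i + 1 → t j * g i = g i * t j
  tpow : ∀ j, j < n → t j ^ d = 1
  quad : ∀ i, i + 1 < n → g i * g i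
    = 1 + (u - 1) • yokoIdem K d (t i) (t (i + 1))
      + (u - 1) • yokoIdem K d (t i) (t (i + 1)) * g i

section Idem

variable {d : ℕ} {A : Type*} [Ring A] [Algebra K A] {a b c a' b' g : A}

theorem mul_yokoIdem_of_semiconj (ha : g * a = a' * g) (hb : g * b = b' * g) :
    g * yokoIdem K d a b = yokoIdem K d a' b' * g := by
  have ha' : SemiconjBy g a a' := ha
  have hb' : SemiconjBy g b b' := hb
  unfold yokoIdem
  rw [mul_smul_comm, smul_mul_assoc, mul_sum, sum_mul]
  congr 1
  exact sum_congr rfl fun s _ => ((ha'.pow_right s).mul_right (hb'.pow_right (d - s))).eq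

theorem pow_mul_yokoIdem (hab : a * b = b * a) (ha : a ^ d = 1) (hb : b ^ d = 1) (k : ℕ) :
    a ^ k * yokoIdem K d a b = b ^ k * yokoIdem K d a b := by
  have hc : Commute a b := hab
  induction k with
  | zero => simp
  | succ k ih =>
    rw [pow_succ, mul_assoc, mul_yokoIdem hab ha hb, ← mul_assoc, (hc.pow_left k).eq, mul_assoc,
      ih, ← mul_assoc, ← pow_succ']

/-- The idempotents attached to three commuting elements satisfy
`e_{a,b} e_{b,c} = e_{a,c} e_{b,c}`. -/
theorem yokoIdem_mul_yokoIdem (hbc : b * c = c * b) (hb : b ^ d = 1) (hc : c ^ d = 1) :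
    yokoIdem K d a b * yokoIdem K d b c = yokoIdem K d a c * yokoIdem K d b c := by
  conv_lhs => enter [1]; unfold yokoIdem
  conv_rhs => enter [1]; unfold yokoIdem
  rw [smul_mul_assoc, smul_mul_assoc, sum_mul, sum_mul]
  congr 1
  refine sum_congr rfl fun s _ => ?_
  rw [mul_assoc, mul_assoc, pow_mul_yokoIdem hbc hb hc]

theorem Commute.yokoIdem_right (ha : Commute g a) (hb : Commute g b) :
    Commute g (yokoIdem K d a b) :=
  mul_yokoIdem_of_semiconj ha.eq hb.eq

end Idem

section Matrices

open Matrix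

variable {d : ℕ} {u : K} {n : ℕ} {R : Type*} [Ring R] [Algebra K R] {g t : ℕ → R} {T : R}

/-- The `k`-th standard row vector; it stands for the coset representative
`g_{n-1} g_{n-2} ⋯ g_k`. -/
def cosetRow (R : Type*) [Ring R] (n k : ℕ) : Fin (n + 1) → R :=
  fun l => if (l : ℕ) = k then 1 else 0

/-- The matrix of right multiplication by `g_i` on the coset representatives
`g_{n-1} g_{n-2} ⋯ g_k`. The parameters are the generators `g`, `t` of the smaller algebra and the
last framing generator `T`. -/
noncomputable def cosetG (d : ℕ) (u : K) (n : ℕ) {R : Type*} [Ring R] [Algebra K R]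
    (g t : ℕ → R) (T : R) (i : ℕ) :
    Matrix (Fin (n + 1)) (Fin (n + 1)) R := Matrix.of fun k =>
  if i + 1 < k then g i • cosetRow R n k
  else if (k : ℕ) = i + 1 then cosetRow R n i
  else if (k : ℕ) = i then cosetRow R n (i + 1)
    + ((u - 1) • yokoIdem K d (t i) T) • (cosetRow R n (i + 1) + cosetRow R n i)
  else g (i - 1) • cosetRow R n k

/-- The matrix of right multiplication by `t_j` on the coset representatives
`g_{n-1} g_{n-2} ⋯ g_k`. -/
noncomputable def cosetT (n : ℕ) {R : Type*} [Ring R] (t : ℕ → R) (T : R) (j : ℕ) :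
    Matrix (Fin (n + 1)) (Fin (n + 1)) R := Matrix.of fun k =>
  (if j < k then t j else if (k : ℕ) = j then T else t (j - 1)) • cosetRow R n k

theorem cosetRow_vecMul {k : ℕ} (hk : k ≤ n) (A : Matrix (Fin (n + 1)) (Fin (n + 1)) R) :
    cosetRow R n k ᵥ* A = A ⟨k, by omega⟩ := by
  have : cosetRow R n k = Pi.single (⟨k, by omega⟩ : Fin (n + 1)) (1 : R) := by
    ext l
    simp [cosetRow, Pi.single_apply, Fin.ext_iff]
  rw [this, Matrix.single_one_vecMul]
  rfl

theorem ext_of_cosetRow {A B : Matrix (Fin (n + 1)) (Fin (n + 1)) R}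
    (h : ∀ k ≤ n, cosetRow R n k ᵥ* A = cosetRow R n k ᵥ* B) : A = B := by
  ext k l
  have := h k (by omega)
  rw [cosetRow_vecMul (by omega), cosetRow_vecMul (by omega)] at this
  exact congrFun this l

theorem cosetRow_cosetG_of_lt {i k : ℕ} (hk : k ≤ n) (h : i + 1 < k) :
    cosetRow R n k ᵥ* cosetG d u n g t T i = g i • cosetRow R n k := by
  rw [cosetRow_vecMul hk]
  exact if_pos h

theorem cosetRow_cosetG_succ {i k : ℕ} (hk : k ≤ n) (h : k = i + 1) :
    cosetRow R n k ᵥ* cosetG d u n g t T i = cosetRow R n i := by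
  rw [cosetRow_vecMul hk]
  exact (if_neg (by simp; omega)).trans (if_pos h)

theorem cosetRow_cosetG_self {i k : ℕ} (hk : k ≤ n) (h : k = i) :
    cosetRow R n k ᵥ* cosetG d u n g t T i = cosetRow R n (i + 1)
    + ((u - 1) • yokoIdem K d (t i) T) • (cosetRow R n (i + 1) + cosetRow R n i) := by
  rw [cosetRow_vecMul hk]
  exact (if_neg (by simp; omega)).trans ((if_neg (by simp; omega)).trans (if_pos h))

theorem cosetRow_cosetG_of_gt {i k : ℕ} (hk : k ≤ n) (h : k < i) :
    cosetRow R n k ᵥ* cosetG d u n g t T i = g (i - 1) • cosetRow R n k := by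
  rw [cosetRow_vecMul hk]
  exact (if_neg (by simp; omega)).trans ((if_neg (by simp; omega)).trans
    (if_neg (by simp; omega)))

theorem cosetRow_cosetT_of_lt {j k : ℕ} (hk : k ≤ n) (h : j < k) :
    cosetRow R n k ᵥ* cosetT n t T j = t j • cosetRow R n k := by
  rw [cosetRow_vecMul hk]
  exact congrArg (fun a : R => a • cosetRow R n k) (if_pos h)

theorem cosetRow_cosetT_self {j k : ℕ} (hk : k ≤ n) (h : k = j) :
    cosetRow R n k ᵥ* cosetT n t T j = T • cosetRow R n k := by
  rw [cosetRow_vecMul hk]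
  exact congrArg (fun a : R => a • cosetRow R n k)
    ((if_neg (show ¬ j < k by omega)).trans (if_pos h))

theorem cosetRow_cosetT_of_gt {j k : ℕ} (hk : k ≤ n) (h : k < j) :
    cosetRow R n k ᵥ* cosetT n t T j = t (j - 1) • cosetRow R n k := by
  rw [cosetRow_vecMul hk]
  exact congrArg (fun a : R => a • cosetRow R n k)
    ((if_neg (show ¬ j < k by omega)).trans (if_neg (show ¬ k = j by omega)))

theorem vecMul_pow_of_eigen {ι : Type*} [Fintype ι] [DecidableEq ι] {v : ι → R}
    {A : Matrix ι ι R} {a : R} (h : v ᵥ* A = a • v) (s : ℕ) : v ᵥ* A ^ s = a ^ s • v := by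
  induction s with
  | zero => simp
  | succ s ih => rw [pow_succ, ← vecMul_vecMul, ih, smul_vecMul, h, smul_smul, ← pow_succ]

theorem vecMul_yokoIdem_of_eigen {ι : Type*} [Fintype ι] [DecidableEq ι] {v : ι → R}
    {A B : Matrix ι ι R} {a b : R} (ha : v ᵥ* A = a • v) (hb : v ᵥ* B = b • v) :
    v ᵥ* yokoIdem K d A B = yokoIdem K d a b • v := by
  unfold yokoIdem
  rw [vecMul_smul, vecMul_sum, smul_assoc, sum_smul]
  congr 1
  refine sum_congr rfl fun s _ => ?_
  rw [← vecMul_vecMul, vecMul_pow_of_eigen ha, smul_vecMul, vecMul_pow_of_eigen hb, smul_smul]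

/-- The braid relation for the matrices `cosetG`, on the row where both quadratic relations are
used. -/
theorem cosetG_near_aux {M : Type*} [AddCommGroup M] [Module R M] {x y z : M} {a e f q : R}
    (h1 : a * e = f * a) (h2 : a * f = e * a) (h3 : e * f = f * e)
    (h4 : a * a = 1 + q + q * a) (h5 : f * q = e * f) :
    (a • z + f • (a • z + x)) + e • ((a • z + f • (a • z + x)) + a • (y + e • (y + x)))
      = a • ((z + f • (z + y)) + e • ((z + f • (z + y)) + a • x)) := by
  have h6 : a * (e * a) = f + e * f + e * (a * e) := by
    rw [← mul_assoc, h1, mul_assoc, h4, mul_add, mul_add, mul_one, h5, ← mul_assoc, h5, mul_assoc]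
  have h7 : a * (e * f) = e * (f * a) := by rw [← mul_assoc, h1, mul_assoc, h2, ← mul_assoc, ← h3,
    mul_assoc]
  simp only [smul_add, smul_smul]
  rw [h6, h7, h2, h1]
  simp only [add_smul]
  abel

theorem cosetFamily (hf : YokoFamily d u n g t)
    (hTd : T ^ d = 1) (hTg : ∀ i, i + 1 < n → Commute T (g i))
    (hTt : ∀ j, j < n → Commute T (t j)) :
    YokoFamily d u (n + 1) (cosetG d u n g t T) (cosetT n t T) where
  far i j hij hj := by
    refine ext_of_cosetRow fun k hk => ?_
    simp only [← vecMul_vecMul]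
    rcases lt_trichotomy k i with h | rfl | h
    · simp (disch := omega) only [cosetRow_cosetG_of_gt, smul_vecMul, smul_smul]
      rw [hf.far (i - 1) (j - 1) (by omega) (by omega)]
    · simp (disch := omega) only [cosetRow_cosetG_of_gt, cosetRow_cosetG_self, smul_vecMul,
        smul_smul, add_vecMul, smul_add]
      rw [mul_smul_comm, smul_mul_assoc, mul_yokoIdem_of_semiconj (a' := t k) (b' := T)]
      · exact (hf.tg_of_ne (j - 1) k (by omega) (by omega) (by omega) (by omega)).symm
      · exact (hTg (j - 1) (by omega)).eq.symm
    · obtain rfl | h : k = i + 1 ∨ i + 1 < k := by omega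
      · simp (disch := omega) only [cosetRow_cosetG_of_gt, cosetRow_cosetG_succ, smul_vecMul]
      · rcases lt_trichotomy k j with h' | rfl | h'
        · simp (disch := omega) only [cosetRow_cosetG_of_gt, cosetRow_cosetG_of_lt, smul_vecMul,
            smul_smul]
          rw [hf.far i (j - 1) (by omega) (by omega)]
        · simp (disch := omega) only [cosetRow_cosetG_self, cosetRow_cosetG_of_lt, smul_vecMul,
            smul_smul, add_vecMul, smul_add]
          rw [mul_smul_comm, smul_mul_assoc, mul_yokoIdem_of_semiconj (a' := t k) (b' := T)]
          · exact (hf.tg_of_ne i k (by omega) (by omega) (by omega) (by omega)).symm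
          · exact (hTg i (by omega)).eq.symm
        · obtain rfl | h'' : k = j + 1 ∨ j + 1 < k := by omega
          · simp (disch := omega) only [cosetRow_cosetG_succ, cosetRow_cosetG_of_lt, smul_vecMul]
          · simp (disch := omega) only [cosetRow_cosetG_of_lt, smul_vecMul, smul_smul]
            rw [hf.far i j (by omega) (by omega)]
  near i hi := by
    refine ext_of_cosetRow fun k hk => ?_
    simp only [← vecMul_vecMul]
    have he : ∀ a b, g i * a = b * g i →
        g i * ((u - 1) • yokoIdem K d a T) = ((u - 1) • yokoIdem K d b T) * g i := fun a b h => by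
      rw [mul_smul_comm, smul_mul_assoc, mul_yokoIdem_of_semiconj h (hTg i (by omega)).eq.symm]
    have h1 := he _ _ (hf.tg_right i (by omega)).symm
    have h2 := he _ _ (hf.tg_left i (by omega)).symm
    rcases lt_trichotomy k i with h | rfl | h
    · simp (disch := omega) only [cosetRow_cosetG_of_gt, smul_vecMul, smul_smul]
      have := hf.near (i - 1) (by omega)
      rw [show i - 1 + 1 = i by omega] at this
      rw [show i + 1 - 1 = i by omega, this]
    · simp (disch := omega) only [cosetRow_cosetG_of_gt, cosetRow_cosetG_self,
        cosetRow_cosetG_of_lt, cosetRow_cosetG_succ, smul_vecMul, add_vecMul]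
      rw [show k + 1 - 1 = k by omega]
      have hc := hf.tt k (k + 1) (by omega) (by omega)
      have hd := hf.tpow k (by omega)
      have hd' := hf.tpow (k + 1) (by omega)
      refine cosetG_near_aux (q := (u - 1) • yokoIdem K d (t k) (t (k + 1))) h1 h2 ?_ ?_ ?_
      · simp only [smul_mul_smul_comm]
        congr 1
        exact (Commute.yokoIdem_right (Commute.symm (Commute.yokoIdem_right hc.symm
          (hTt _ (by omega)).symm)) (Commute.symm (Commute.yokoIdem_right (hTt _ (by omega))
          (Commute.refl _)))).eq
      · exact hf.quad k (by omega)
      · simp only [smul_mul_smul_comm]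
        congr 1
        have c1 : Commute (yokoIdem K d (t (k + 1)) T) (yokoIdem K d (t k) (t (k + 1))) :=
          (Commute.yokoIdem_right (Commute.symm (Commute.yokoIdem_right hc
          (hTt _ (by omega)).symm)) (Commute.symm (Commute.yokoIdem_right (Commute.refl _)
            (hTt _ (by omega)).symm)))
        rw [c1.eq, yokoIdem_mul_yokoIdem (hTt _ (by omega)).eq.symm hd' hTd]
    · obtain rfl | h : k = i + 1 ∨ i + 1 < k := by omega
      · simp (disch := omega) only [cosetRow_cosetG_of_gt, cosetRow_cosetG_self,
          cosetRow_cosetG_of_lt, cosetRow_cosetG_succ, smul_vecMul, add_vecMul]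
        rw [show i + 1 - 1 = i by omega]
        simp only [smul_add, smul_smul]
        rw [h1]
      · obtain rfl | h : k = i + 2 ∨ i + 2 < k := by omega
        · simp (disch := omega) only [cosetRow_cosetG_of_gt, cosetRow_cosetG_of_lt,
            cosetRow_cosetG_succ, smul_vecMul]
          rw [show i + 1 - 1 = i by omega]
        · simp (disch := omega) only [cosetRow_cosetG_of_lt, smul_vecMul, smul_smul]
          rw [hf.near i (by omega)]
  tt i j hi hj := by
    refine ext_of_cosetRow fun k hk => ?_
    simp only [← vecMul_vecMul]
    rcases lt_trichotomy i k with h | h | h <;> rcases lt_trichotomy j k with h' | h' | h' <;>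
    simp (disch := omega) only [cosetRow_cosetT_of_lt, cosetRow_cosetT_self,
      cosetRow_cosetT_of_gt, smul_vecMul, smul_smul]
    all_goals first
      | rw [hf.tt _ _ (by omega) (by omega)]
      | rw [(hTt _ (by omega)).eq]
  tg_left i hi := by
    refine ext_of_cosetRow fun k hk => ?_
    simp only [← vecMul_vecMul]
    rcases lt_trichotomy k i with h | rfl | h
    · simp (disch := omega) only [cosetRow_cosetG_of_gt, cosetRow_cosetT_of_gt, smul_vecMul,
        smul_smul]
      have := hf.tg_left (i - 1) (by omega)
      rw [show i - 1 + 1 = i by omega] at this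
      rw [show i + 1 - 1 = i by omega, this]
    · simp (disch := omega) only [cosetRow_cosetG_self, cosetRow_cosetT_of_gt, smul_vecMul,
        cosetRow_cosetT_self, add_vecMul, smul_add, smul_smul]
      rw [show k + 1 - 1 = k by omega]
      simp only [mul_smul_comm, smul_mul_assoc]
      have hc := hTt k (by omega)
      have h1 : Commute T (yokoIdem K d (t k) T) := Commute.yokoIdem_right hc (Commute.refl _)
      have h2 : Commute (t k) (yokoIdem K d (t k) T) :=
        Commute.yokoIdem_right (Commute.refl _) hc.symm
      rw [← h1.eq, ← h2.eq, mul_yokoIdem hc.eq.symm (hf.tpow k (by omega)) hTd]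
    · obtain rfl | h : k = i + 1 ∨ i + 1 < k := by omega
      · simp (disch := omega) only [cosetRow_cosetG_succ, cosetRow_cosetT_of_lt, smul_vecMul,
          cosetRow_cosetT_of_gt]
        rfl
      · simp (disch := omega) only [cosetRow_cosetG_of_lt, cosetRow_cosetT_of_lt, smul_vecMul,
          smul_smul]
        rw [hf.tg_left i (by omega)]
  tg_right i hi := by
    refine ext_of_cosetRow fun k hk => ?_
    simp only [← vecMul_vecMul]
    rcases lt_trichotomy k i with h | rfl | h
    · simp (disch := omega) only [cosetRow_cosetG_of_gt, cosetRow_cosetT_of_gt, smul_vecMul,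
        smul_smul]
      have := hf.tg_right (i - 1) (by omega)
      rw [show i - 1 + 1 = i by omega] at this
      rw [show i + 1 - 1 = i by omega, this]
    · simp (disch := omega) only [cosetRow_cosetG_self, cosetRow_cosetT_of_gt, smul_vecMul,
        cosetRow_cosetT_self, cosetRow_cosetT_of_lt, add_vecMul, smul_add, smul_smul]
      rw [show k + 1 - 1 = k by omega]
      simp only [mul_smul_comm, smul_mul_assoc]
      have hc := hTt k (by omega)
      have h1 : Commute T (yokoIdem K d (t k) T) := Commute.yokoIdem_right hc (Commute.refl _)
      have h2 : Commute (t k) (yokoIdem K d (t k) T) :=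
        Commute.yokoIdem_right (Commute.refl _) hc.symm
      rw [← h1.eq, ← h2.eq, mul_yokoIdem hc.eq.symm (hf.tpow k (by omega)) hTd]
    · obtain rfl | h : k = i + 1 ∨ i + 1 < k := by omega
      · simp (disch := omega) only [cosetRow_cosetG_succ, smul_vecMul,
          cosetRow_cosetT_self]
      · simp (disch := omega) only [cosetRow_cosetG_of_lt, cosetRow_cosetT_of_lt, smul_vecMul,
          smul_smul]
        rw [hf.tg_right i (by omega)]
  tg_of_ne i j hi hj hji hji' := by
    refine ext_of_cosetRow fun k hk => ?_
    simp only [← vecMul_vecMul]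
    have hc : ∀ a b : R, a * b = b * a → a * T = T * a →
        a * ((u - 1) • yokoIdem K d b T) = ((u - 1) • yokoIdem K d b T) * a := fun a b h h' => by
      rw [mul_smul_comm, smul_mul_assoc, mul_yokoIdem_of_semiconj h h']
    rcases lt_trichotomy k i with h | rfl | h
    · rcases lt_trichotomy j k with h' | rfl | h'
      · simp (disch := omega) only [cosetRow_cosetG_of_gt, cosetRow_cosetT_of_lt, smul_vecMul,
          smul_smul]
        rw [hf.tg_of_ne _ _ (by omega) (by omega) (by omega) (by omega)]
      · simp (disch := omega) only [cosetRow_cosetG_of_gt, cosetRow_cosetT_self, smul_vecMul,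
          smul_smul]
        rw [(hTg _ (by omega)).eq]
      · simp (disch := omega) only [cosetRow_cosetG_of_gt, cosetRow_cosetT_of_gt, smul_vecMul,
          smul_smul]
        rw [hf.tg_of_ne _ _ (by omega) (by omega) (by omega) (by omega)]
    · rcases lt_or_gt_of_ne hji with h' | h'
      · simp (disch := omega) only [cosetRow_cosetG_self, cosetRow_cosetT_of_lt, smul_vecMul,
          add_vecMul, smul_add, smul_smul]
        rw [hc _ _ (hf.tt _ _ (by omega) (by omega)) (hTt _ (by omega)).eq.symm]
      · simp (disch := omega) only [cosetRow_cosetG_self, cosetRow_cosetT_of_gt, smul_vecMul,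
          add_vecMul, smul_add, smul_smul]
        rw [hc _ _ (hf.tt _ _ (by omega) (by omega)) (hTt _ (by omega)).eq.symm]
    · obtain rfl | h : k = i + 1 ∨ i + 1 < k := by omega
      · rcases lt_or_gt_of_ne hji with h' | h'
        · simp (disch := omega) only [cosetRow_cosetG_succ, cosetRow_cosetT_of_lt, smul_vecMul]
        · simp (disch := omega) only [cosetRow_cosetG_succ, cosetRow_cosetT_of_gt, smul_vecMul]
      · rcases lt_trichotomy j k with h' | rfl | h'
        · simp (disch := omega) only [cosetRow_cosetG_of_lt, cosetRow_cosetT_of_lt, smul_vecMul,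
            smul_smul]
          rw [hf.tg_of_ne _ _ (by omega) (by omega) (by omega) (by omega)]
        · simp (disch := omega) only [cosetRow_cosetG_of_lt, cosetRow_cosetT_self, smul_vecMul,
            smul_smul]
          rw [(hTg _ (by omega)).eq]
        · simp (disch := omega) only [cosetRow_cosetG_of_lt, cosetRow_cosetT_of_gt, smul_vecMul,
            smul_smul]
          rw [hf.tg_of_ne _ _ (by omega) (by omega) (by omega) (by omega)]
  tpow j hj := by
    refine ext_of_cosetRow fun k hk => ?_
    rw [vecMul_one]
    rcases lt_trichotomy j k with h | rfl | h
    · rw [vecMul_pow_of_eigen (cosetRow_cosetT_of_lt hk h), hf.tpow _ (by omega), one_smul]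
    · rw [vecMul_pow_of_eigen (cosetRow_cosetT_self hk rfl), hTd, one_smul]
    · rw [vecMul_pow_of_eigen (cosetRow_cosetT_of_gt hk h), hf.tpow _ (by omega), one_smul]
  quad i hi := by
    refine ext_of_cosetRow fun k hk => ?_
    simp only [vecMul_add, smul_mul_assoc, vecMul_smul, ← vecMul_vecMul, vecMul_one]
    rcases lt_trichotomy k i with h | rfl | h
    · rw [vecMul_yokoIdem_of_eigen (cosetRow_cosetT_of_gt hk h)
        (cosetRow_cosetT_of_gt hk (by omega))]
      simp (disch := omega) only [cosetRow_cosetG_of_gt, smul_vecMul, smul_smul]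
      have := hf.quad (i - 1) (by omega)
      rw [show i - 1 + 1 = i by omega] at this
      rw [show i + 1 - 1 = i by omega, this]
      simp only [add_smul, one_smul, smul_mul_assoc, smul_assoc]
    · rw [vecMul_yokoIdem_of_eigen (cosetRow_cosetT_self hk rfl)
        (cosetRow_cosetT_of_gt hk (by omega))]
      simp (disch := omega) only [cosetRow_cosetG_self, cosetRow_cosetG_succ, smul_vecMul,
        add_vecMul]
      rw [show k + 1 - 1 = k by omega,
        yokoIdem_comm (hTt k (by omega)).eq hTd (hf.tpow k (by omega))]
      simp only [smul_add, smul_assoc]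
      abel
    · obtain rfl | h : k = i + 1 ∨ i + 1 < k := by omega
      · rw [vecMul_yokoIdem_of_eigen (cosetRow_cosetT_of_lt hk (by omega))
          (cosetRow_cosetT_self hk rfl)]
        simp (disch := omega) only [cosetRow_cosetG_self, cosetRow_cosetG_succ, smul_vecMul]
        simp only [smul_add, smul_assoc]
        abel
      · rw [vecMul_yokoIdem_of_eigen (cosetRow_cosetT_of_lt hk (by omega))
          (cosetRow_cosetT_of_lt hk (by omega))]
        simp (disch := omega) only [cosetRow_cosetG_of_lt, smul_vecMul, smul_smul]
        rw [hf.quad i (by omega)]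
        simp only [add_smul, one_smul, smul_mul_assoc, smul_assoc]

end Matrices

/-! ### Generators of the Yokonuma-Hecke algebra indexed by natural numbers -/

section Generators

variable {d : ℕ} {u : K} {n : ℕ}

/-- The braiding generator of `Y_{d,n}(u)` with strands `i`, `i + 1`, counted from `0`; it is `0`
if there is no such generator. -/
noncomputable def yg (d : ℕ) (u : K) (n i : ℕ) : YokoAlg d u n :=
  if h : i < n - 1 then yokoG d u ⟨i, h⟩ else 0

/-- The framing generator of `Y_{d,n}(u)` of the strand `j`, counted from `0`; it is `1` if there
is no such generator. -/
noncomputable def yt (d : ℕ) (u : K) (n j : ℕ) : YokoAlg d u n :=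
  if h : j < n then yokoT d u ⟨j, h⟩ else 1

theorem yg_of_lt {i : ℕ} (h : i < n - 1) : yg d u n i = yokoG d u ⟨i, h⟩ := dif_pos h

theorem yt_of_lt {j : ℕ} (h : j < n) : yt d u n j = yokoT d u ⟨j, h⟩ := dif_pos h

theorem yokoFamily (d : ℕ) (u : K) (n : ℕ) : YokoFamily d u n (yg d u n) (yt d u n) where
  far i j hij hj := by
    rw [yg_of_lt (show i < n - 1 by omega), yg_of_lt (show j < n - 1 by omega)]
    exact yokoG_far d u _ _ hij
  near i hi := by
    rw [yg_of_lt (show i < n - 1 by omega), yg_of_lt (show i + 1 < n - 1 by omega)]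
    exact yokoG_near d u _ _ rfl
  tt i j hi hj := by
    rw [yt_of_lt hi, yt_of_lt hj]
    exact yokoT_comm d u _ _
  tg_left i hi := by
    have h := yokoT_mul_yokoG d u (⟨i, by omega⟩ : Fin (n - 1)) (strandL ⟨i, by omega⟩)
    rw [Equiv.swap_apply_left] at h
    rw [yg_of_lt (show i < n - 1 by omega), yt_of_lt hi, yt_of_lt (show i < n by omega)]
    exact h
  tg_right i hi := by
    have h := yokoT_mul_yokoG d u (⟨i, by omega⟩ : Fin (n - 1)) (strandR ⟨i, by omega⟩)
    rw [Equiv.swap_apply_right] at h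
    rw [yg_of_lt (show i < n - 1 by omega), yt_of_lt hi, yt_of_lt (show i < n by omega)]
    exact h
  tg_of_ne i j hi hj h1 h2 := by
    have h := yokoT_mul_yokoG d u (⟨i, by omega⟩ : Fin (n - 1)) ⟨j, hj⟩
    rw [Equiv.swap_apply_of_ne_of_ne (by simpa [strandL] using h1)
      (by simpa [strandR] using h2)] at h
    rw [yg_of_lt (show i < n - 1 by omega), yt_of_lt hj]
    exact h
  tpow j hj := by
    rw [yt_of_lt hj]
    exact yokoT_pow d u _
  quad i hi := by
    rw [yg_of_lt (show i < n - 1 by omega), yt_of_lt hi, yt_of_lt (show i < n by omega)]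
    have h := yokoG_sq d u (⟨i, by omega⟩ : Fin (n - 1))
    rw [pow_two, ← smul_mul_assoc] at h
    exact h

namespace YokoFamily

variable {A B : Type*} [Ring A] [Algebra K A] [Ring B] [Algebra K B] {g t : ℕ → A}

theorem map (hf : YokoFamily d u n g t) (f : A →ₐ[K] B) :
    YokoFamily d u n (f ∘ g) (f ∘ t) where
  far i j hij hj := by simpa using congrArg f (hf.far i j hij hj)
  near i hi := by simpa using congrArg f (hf.near i hi)
  tt i j hi hj := by simpa using congrArg f (hf.tt i j hi hj)
  tg_left i hi := by simpa using congrArg f (hf.tg_left i hi)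
  tg_right i hi := by simpa using congrArg f (hf.tg_right i hi)
  tg_of_ne i j hi hj h1 h2 := by simpa using congrArg f (hf.tg_of_ne i j hi hj h1 h2)
  tpow j hj := by simpa using congrArg f (hf.tpow j hj)
  quad i hi := by simpa [map_yokoIdem] using congrArg f (hf.quad i hi)

/-- The universal property of `Y_{d,n}(u)`. -/
noncomputable def lift (hf : YokoFamily d u n g t) : YokoAlg d u n →ₐ[K] A :=
  RingQuot.liftAlgHom K ⟨FreeAlgebra.lift K (fun
      | .g i => g i
      | .t j => t j), by
    rintro _ _ (⟨i, j, h⟩ | ⟨i, j, h⟩ | ⟨i, j⟩ | ⟨i, j⟩ | j | i)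
    · simpa using hf.far i j h (by omega)
    · simpa [← h] using hf.near i (by omega)
    · simpa using hf.tt i j i.2 j.2
    · simp only [map_mul, FreeAlgebra.lift_ι_apply]
      by_cases h1 : j = strandL i
      · subst h1
        rw [Equiv.swap_apply_left]
        exact hf.tg_left i (by omega)
      by_cases h2 : j = strandR i
      · subst h2
        rw [Equiv.swap_apply_right]
        exact hf.tg_right i (by omega)
      rw [Equiv.swap_apply_of_ne_of_ne h1 h2]
      exact hf.tg_of_ne i j (by omega) j.2 (fun h => h1 (Fin.ext h)) (fun h => h2 (Fin.ext h))
    · simpa using hf.tpow j j.2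
    · simpa [map_yokoIdem, pow_two, strandL, strandR] using hf.quad i (by omega)⟩

theorem lift_yg (hf : YokoFamily d u n g t) {i : ℕ} (hi : i + 1 < n) :
    hf.lift (yg d u n i) = g i := by
  rw [yg_of_lt (show i < n - 1 by omega), yokoG, lift, RingQuot.liftAlgHom_mkAlgHom_apply]
  simp

theorem lift_yt (hf : YokoFamily d u n g t) {j : ℕ} (hj : j < n) :
    hf.lift (yt d u n j) = t j := by
  rw [yt_of_lt hj, yokoT, lift, RingQuot.liftAlgHom_mkAlgHom_apply]
  simp

end YokoFamily

theorem yokoIncl_yg {i : ℕ} (hi : i + 1 < n) :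
    yokoIncl d u n (yg d u n i) = yg d u (n + 1) i := by
  rw [yg_of_lt (show i < n - 1 by omega), yg_of_lt (show i < n + 1 - 1 by omega), yokoG, yokoIncl,
    RingQuot.liftAlgHom_mkAlgHom_apply]
  simp [crossSucc]

theorem yokoIncl_yt {j : ℕ} (hj : j < n) :
    yokoIncl d u n (yt d u n j) = yt d u (n + 1) j := by
  rw [yt_of_lt hj, yt_of_lt (show j < n + 1 by omega), yokoT, yokoIncl,
    RingQuot.liftAlgHom_mkAlgHom_apply]
  simp

theorem yoko_induction {P : YokoAlg d u n → Prop} (algebraMap : ∀ r, P (algebraMap K _ r))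
    (add : ∀ a b, P a → P b → P (a + b)) (mul : ∀ a b, P a → P b → P (a * b))
    (g : ∀ i, i + 1 < n → P (yg d u n i)) (t : ∀ j, j < n → P (yt d u n j)) (y) : P y := by
  obtain ⟨w, rfl⟩ := RingQuot.mkAlgHom_surjective K (YokoRel d u n) y
  induction w using FreeAlgebra.induction with
  | grade0 r => simpa using algebraMap r
  | grade1 x =>
    cases x with
    | g i => simpa [yg_of_lt, yokoG] using g i (by omega)
    | t j => simpa [yt_of_lt, yokoT] using t j j.2
  | mul a b ha hb => simpa using mul _ _ ha hb
  | add a b ha hb => simpa using add _ _ ha hb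

/-- A subspace of `Y_{d,n}(u)` that contains `1` and is stable under right multiplication by the
generators is everything. -/
theorem yoko_eq_top {W : Submodule K (YokoAlg d u n)} (one : 1 ∈ W)
    (g : ∀ i, i + 1 < n → ∀ w ∈ W, w * yg d u n i ∈ W)
    (t : ∀ j, j < n → ∀ w ∈ W, w * yt d u n j ∈ W) : W = ⊤ := by
  have h : ∀ y : YokoAlg d u n, ∀ w ∈ W, w * y ∈ W := by
    intro y
    induction y using yoko_induction with
    | algebraMap r =>
      intro w hw
      rw [← Algebra.commutes, ← Algebra.smul_def]
      exact W.smul_mem _ hw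
    | add a b ha hb => exact fun w hw => by rw [mul_add]; exact W.add_mem (ha w hw) (hb w hw)
    | mul a b ha hb => exact fun w hw => by rw [← mul_assoc]; exact hb _ (ha w hw)
    | g i hi => exact g i hi
    | t j hj => exact t j hj
  exact eq_top_iff.2 fun y _ => by simpa using h y 1 one

theorem commute_of_commute_gen {A : Type*} [Ring A] [Algebra K A] {y : A}
    (f : YokoAlg d u n →ₐ[K] A) (g : ∀ i, i + 1 < n → Commute y (f (yg d u n i)))
    (t : ∀ j, j < n → Commute y (f (yt d u n j))) (a : YokoAlg d u n) : Commute y (f a) := by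
  induction a using yoko_induction with
  | algebraMap r =>
    rw [AlgHom.commutes]
    exact (Algebra.commutes r y).symm
  | add a b ha hb => rw [map_add]; exact ha.add_right hb
  | mul a b ha hb => rw [map_mul]; exact ha.mul_right hb
  | g i hi => exact g i hi
  | t j hj => exact t j hj

/-- The last framing generator commutes with the algebra on fewer strands. -/
theorem commute_yt_yokoIncl (a : YokoAlg d u n) :
    Commute (yt d u (n + 1) n) (yokoIncl d u n a) := by
  have hf := yokoFamily d u (n + 1)
  refine commute_of_commute_gen _ (fun i hi => ?_) (fun j hj => ?_) a
  · rw [yokoIncl_yg hi]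
    exact hf.tg_of_ne _ _ (by omega) (by omega) (by omega) (by omega)
  · rw [yokoIncl_yt hj]
    exact hf.tt _ _ (by omega) (by omega)

/-- The last braiding generator commutes with the algebra on two strands fewer. -/
theorem commute_yg_yokoIncl (c : YokoAlg d u n) :
    Commute (yg d u (n + 2) n) (yokoIncl d u (n + 1) (yokoIncl d u n c)) := by
  have hf := yokoFamily d u (n + 2)
  refine commute_of_commute_gen ((yokoIncl d u (n + 1)).comp (yokoIncl d u n))
    (fun i hi => ?_) (fun j hj => ?_) c
  · rw [AlgHom.comp_apply, yokoIncl_yg hi, yokoIncl_yg (by omega)]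
    exact (hf.far _ _ (by omega) (by omega)).symm
  · rw [AlgHom.comp_apply, yokoIncl_yt hj, yokoIncl_yt (by omega)]
    exact (hf.tg_of_ne _ _ (by omega) (by omega) (by omega) (by omega)).symm

theorem yt_pow_mul_yg (s : ℕ) : yt d u (n + 2) (n + 1) ^ s * yg d u (n + 2) n
    = yg d u (n + 2) n * yokoIncl d u (n + 1) (yt d u (n + 1) n) ^ s := by
  rw [yokoIncl_yt (by omega)]
  exact ((show SemiconjBy (yg d u (n + 2) n) (yt d u (n + 2) n) (yt d u (n + 2) (n + 1)) from
    ((yokoFamily d u (n + 2)).tg_right n (by omega)).symm).pow_right s).eq.symm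

theorem yokoIncl_yt_pow_mul_yg (s : ℕ) :
    yokoIncl d u (n + 1) (yt d u (n + 1) n) ^ s * yg d u (n + 2) n
    = yg d u (n + 2) n * yt d u (n + 2) (n + 1) ^ s := by
  rw [yokoIncl_yt (by omega)]
  exact ((show SemiconjBy (yg d u (n + 2) n) (yt d u (n + 2) (n + 1)) (yt d u (n + 2) n) from
    ((yokoFamily d u (n + 2)).tg_left n (by omega)).symm).pow_right s).eq.symm

/-- The idempotent `e` of the last two strands. -/
noncomputable def lastE (d : ℕ) (u : K) (n : ℕ) : YokoAlg d u (n + 2) :=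
  yokoIdem K d (yokoIncl d u (n + 1) (yt d u (n + 1) n)) (yt d u (n + 2) (n + 1))

theorem yg_mul_self : yg d u (n + 2) n * yg d u (n + 2) n
    = 1 + (u - 1) • lastE d u n + (u - 1) • lastE d u n * yg d u (n + 2) n := by
  rw [lastE, yokoIncl_yt (by omega)]
  exact (yokoFamily d u (n + 2)).quad n (by omega)

theorem yg_yokoIncl_yg : yg d u (n + 3) (n + 1) * yokoIncl d u (n + 2) (yg d u (n + 2) n)
      * yg d u (n + 3) (n + 1)
    = yokoIncl d u (n + 2) (yg d u (n + 2) n) * yg d u (n + 3) (n + 1)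
      * yokoIncl d u (n + 2) (yg d u (n + 2) n) := by
  rw [yokoIncl_yg (by omega)]
  exact ((yokoFamily d u (n + 3)).near n (by omega)).symm

end Generators

/-! ### Spanning sets -/

section Span

variable {d : ℕ} {u : K}

/-- `Y_{n+1}` is spanned by the products `a t_{n+1}^s` and `a g_n b` with `a`, `b` in `Y_n`. -/
theorem span_incl (d : ℕ) (u : K) (n : ℕ) : Submodule.span K
    ({y | ∃ a s, y = yokoIncl d u n a * yt d u (n + 1) n ^ s} ∪
      {y | ∃ a b, y = yokoIncl d u n a * yg d u (n + 1) (n - 1) * yokoIncl d u n b}) = ⊤ := by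
  induction n with
  | zero =>
    refine yoko_eq_top (Submodule.subset_span (Or.inl ⟨1, 0, by simp⟩)) (fun i hi => by omega) ?_
    intro j hj w hw
    obtain rfl : j = 0 := by omega
    induction hw using Submodule.span_induction with
    | zero => simp
    | add x y _ _ hx hy => rw [add_mul]; exact Submodule.add_mem _ hx hy
    | smul r x _ hx => rw [smul_mul_assoc]; exact Submodule.smul_mem _ _ hx
    | mem x hx =>
      rcases hx with ⟨a, s, rfl⟩ | ⟨a, b, rfl⟩
      · exact Submodule.subset_span (Or.inl ⟨a, s + 1, by rw [pow_succ, mul_assoc]⟩)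
      · simp [yg]
  | succ m ih =>
    simp only [Nat.add_sub_cancel]
    set G := yg d u (m + 2) m with hG
    set T := yt d u (m + 2) (m + 1) with hT
    set ι := yokoIncl d u (m + 1) with hι
    set F := Submodule.span K {y | ∃ a s, y = ι a * T ^ s} with hF
    set W := Submodule.span K
      ({y | ∃ a s, y = ι a * T ^ s} ∪ {y | ∃ a b, y = ι a * G * ι b}) with hW
    have hFW : F ≤ W := Submodule.span_mono Set.subset_union_left
    have hTι : ∀ a, Commute T (ι a) := fun a => commute_yt_yokoIncl a
    have hFι : ∀ w ∈ F, ∀ b, w * ι b ∈ F := by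
      intro w hw b
      induction hw using Submodule.span_induction with
      | zero => simp
      | add x y _ _ hx hy => rw [add_mul]; exact Submodule.add_mem _ hx hy
      | smul r x _ hx => rw [smul_mul_assoc]; exact Submodule.smul_mem _ _ hx
      | mem x hx =>
        obtain ⟨a, s, rfl⟩ := hx
        refine Submodule.subset_span ⟨a * b, s, ?_⟩
        rw [mul_assoc, ((hTι b).pow_left s).eq, map_mul, mul_assoc]
    have hFT : ∀ w ∈ F, ∀ s, w * T ^ s ∈ F := by
      intro w hw b
      induction hw using Submodule.span_induction with
      | zero => simp
      | add x y _ _ hx hy => rw [add_mul]; exact Submodule.add_mem _ hx hy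
      | smul r x _ hx => rw [smul_mul_assoc]; exact Submodule.smul_mem _ _ hx
      | mem x hx =>
        obtain ⟨a, s, rfl⟩ := hx
        exact Submodule.subset_span ⟨a, s + b, by rw [mul_assoc, pow_add]⟩
    have hFG : ∀ w ∈ F, w * G ∈ W := by
      intro w hw
      induction hw using Submodule.span_induction with
      | zero => simp
      | add x y _ _ hx hy => rw [add_mul]; exact Submodule.add_mem _ hx hy
      | smul r x _ hx => rw [smul_mul_assoc]; exact Submodule.smul_mem _ _ hx
      | mem x hx =>
        obtain ⟨a, s, rfl⟩ := hx
        refine Submodule.subset_span (Or.inr ⟨a, yt d u (m + 1) m ^ s, ?_⟩)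
        rw [mul_assoc, yt_pow_mul_yg, map_pow, mul_assoc]
    have hWι : ∀ w ∈ W, ∀ b, w * ι b ∈ W := by
      intro w hw b
      induction hw using Submodule.span_induction with
      | zero => simp
      | add x y _ _ hx hy => rw [add_mul]; exact Submodule.add_mem _ hx hy
      | smul r x _ hx => rw [smul_mul_assoc]; exact Submodule.smul_mem _ _ hx
      | mem x hx =>
        rcases hx with hx | ⟨a, c, rfl⟩
        · exact hFW (hFι _ (Submodule.subset_span hx) b)
        · exact Submodule.subset_span (Or.inr ⟨a, c * b, by rw [map_mul, mul_assoc]⟩)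
    have hWT : ∀ w ∈ W, ∀ s, w * T ^ s ∈ W := by
      intro w hw s
      induction hw using Submodule.span_induction with
      | zero => simp
      | add x y _ _ hx hy => rw [add_mul]; exact Submodule.add_mem _ hx hy
      | smul r x _ hx => rw [smul_mul_assoc]; exact Submodule.smul_mem _ _ hx
      | mem x hx =>
        rcases hx with hx | ⟨a, c, rfl⟩
        · exact hFW (hFT _ (Submodule.subset_span hx) s)
        · refine Submodule.subset_span (Or.inr ⟨a * yt d u (m + 1) m ^ s, c, ?_⟩)
          rw [mul_assoc, ← ((hTι c).pow_left s).eq, mul_assoc, ← mul_assoc G,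
            ← yokoIncl_yt_pow_mul_yg, map_mul, map_pow]
          simp only [mul_assoc]
          rfl
    have hFe : ∀ w ∈ F, w * lastE d u m ∈ F := by
      intro w hw
      rw [lastE, yokoIdem, mul_smul_comm, mul_sum]
      refine Submodule.smul_mem _ _ (Submodule.sum_mem _ fun s _ => ?_)
      rw [← mul_assoc, ← map_pow]
      exact hFT _ (hFι _ hw _) _
    have hWG : ∀ w ∈ W, w * G ∈ W := by
      intro w hw
      induction hw using Submodule.span_induction with
      | zero => simp
      | add x y _ _ hx hy => rw [add_mul]; exact Submodule.add_mem _ hx hy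
      | smul r x _ hx => rw [smul_mul_assoc]; exact Submodule.smul_mem _ _ hx
      | mem x hx =>
        rcases hx with hx | ⟨a, b, rfl⟩
        · exact hFG _ (Submodule.subset_span hx)
        have hb : b ∈ (⊤ : Submodule K (YokoAlg d u (m + 1))) := Submodule.mem_top
        rw [← ih] at hb
        induction hb using Submodule.span_induction with
        | zero => simp
        | add x y _ _ hx hy => rw [map_add, mul_add, add_mul]; exact Submodule.add_mem _ hx hy
        | smul r x _ hx =>
          rw [map_smul, mul_smul_comm, smul_mul_assoc]; exact Submodule.smul_mem _ _ hx
        | mem x hx =>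
          rcases hx with ⟨c, s, rfl⟩ | ⟨c, c', rfl⟩
          · have h1 : ι a * G * ι (yokoIncl d u m c * yt d u (m + 1) m ^ s) * G
                = (ι (a * yokoIncl d u m c) * (G * G)) * T ^ s := by
              rw [map_mul, map_pow, map_mul, mul_assoc _ _ G, mul_assoc _ _ G,
                yokoIncl_yt_pow_mul_yg, mul_assoc (ι a), ← mul_assoc G,
                (commute_yg_yokoIncl c).eq]
              simp only [mul_assoc]
              rfl
            rw [h1]
            refine hWT _ ?_ s
            have h2 : ι (a * yokoIncl d u m c) ∈ F :=
              Submodule.subset_span ⟨a * yokoIncl d u m c, 0, by rw [pow_zero, mul_one]⟩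
            rw [yg_mul_self, mul_add, mul_add, mul_one, smul_mul_assoc, mul_smul_comm,
              mul_smul_comm, ← mul_assoc]
            exact Submodule.add_mem _ (Submodule.add_mem _ (hFW h2)
              (Submodule.smul_mem _ _ (hFW (hFe _ h2))))
              (Submodule.smul_mem _ _ (hFG _ (hFe _ h2)))
          · cases m with
            | zero => simp [yg]
            | succ l =>
              have h1 : ι a * G * ι (yokoIncl d u (l + 1) c * yg d u (l + 1 + 1) (l + 1 - 1)
                    * yokoIncl d u (l + 1) c') * G
                  = ι (a * yokoIncl d u (l + 1) c * yg d u (l + 2) l) * G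
                    * ι (yg d u (l + 2) l * yokoIncl d u (l + 1) c') := by
                simp only [map_mul, mul_assoc, Nat.add_sub_cancel]
                rw [← (commute_yg_yokoIncl c').eq, ← mul_assoc G (ι (yokoIncl d u (l + 1) c)),
                  (commute_yg_yokoIncl c).eq, mul_assoc, ← mul_assoc G, ← mul_assoc (G * _),
                  yg_yokoIncl_yg]
                simp only [mul_assoc]
                rfl
              rw [h1]
              exact Submodule.subset_span (Or.inr ⟨_, _, rfl⟩)
    refine yoko_eq_top (hFW (Submodule.subset_span ⟨1, 0, by simp⟩)) ?_ ?_
    · intro i hi w hw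
      obtain rfl | h : i = m ∨ i + 1 < m + 1 := by omega
      · exact hWG w hw
      · rw [← yokoIncl_yg h]
        exact hWι w hw _
    · intro j hj w hw
      obtain rfl | h : j = m + 1 ∨ j < m + 1 := by omega
      · simpa using hWT w hw 1
      · rw [← yokoIncl_yt h]
        exact hWι w hw _

/-- Induction over the spanning set of `span_incl`. -/
theorem yoko_span_induction {n : ℕ} {P : YokoAlg d u (n + 1) → Prop}
    (add : ∀ x y, P x → P y → P (x + y))
    (smul : ∀ (r : K) x, P x → P (r • x))
    (framing : ∀ a s, P (yokoIncl d u n a * yt d u (n + 1) n ^ s))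
    (braiding : ∀ m (_ : n = m + 1) (a b : YokoAlg d u n),
      P (yokoIncl d u n a * yg d u (n + 1) (n - 1) * yokoIncl d u n b)) (y) : P y := by
  have hy : y ∈ (⊤ : Submodule K (YokoAlg d u (n + 1))) := Submodule.mem_top
  rw [← span_incl] at hy
  induction hy using Submodule.span_induction with
  | zero => simpa using smul 0 _ (framing 0 0)
  | add x y _ _ hx hy => exact add x y hx hy
  | smul r x _ hx => exact smul r x hx
  | mem x hx =>
    rcases hx with ⟨a, s, rfl⟩ | ⟨a, b, rfl⟩
    · exact framing a s
    · cases n with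
      | zero => simpa [yg] using framing 0 0
      | succ m => exact braiding m rfl a b

/-- The product `g_{n-2} g_{n-3} ⋯` of `j` factors in `Y_n`, with strands counted from `0`. -/
noncomputable def cosetElt (d : ℕ) (u : K) (n : ℕ) : ℕ → YokoAlg d u n
  | 0 => 1
  | j + 1 => cosetElt d u n j * yg d u n (n - 2 - j)

theorem cosetElt_succ (n j : ℕ) (hj : j ≤ n) : cosetElt d u (n + 2) (j + 1)
    = yg d u (n + 2) n * yokoIncl d u (n + 1) (cosetElt d u (n + 1) j) := by
  induction j with
  | zero => simp [cosetElt]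
  | succ j ih =>
    rw [cosetElt, ih (by omega), cosetElt, map_mul, yokoIncl_yg (by omega), mul_assoc,
      show n + 2 - 2 - (j + 1) = n + 1 - 2 - j by omega]

/-- `Y_{n+1}` is spanned by the products `a t_{n+1}^s g_n g_{n-1} ⋯ g_k` with `a` in `Y_n`. -/
theorem span_cosetElt (d : ℕ) (u : K) (n : ℕ) : Submodule.span K
    {y | ∃ a s j, j ≤ n ∧ y = yokoIncl d u n a * yt d u (n + 1) n ^ s * cosetElt d u (n + 1) j}
      = ⊤ := by
  induction n with
  | zero =>
    refine Submodule.eq_top_iff'.2 fun y => ?_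
    induction y using yoko_span_induction with
    | add x y hx hy => exact Submodule.add_mem _ hx hy
    | smul r x hx => exact Submodule.smul_mem _ r hx
    | framing a s => exact Submodule.subset_span ⟨a, s, 0, le_rfl, by simp [cosetElt]⟩
    | braiding m h => omega
  | succ m ih =>
    refine Submodule.eq_top_iff'.2 fun y => ?_
    induction y using yoko_span_induction with
    | add x y hx hy => exact Submodule.add_mem _ hx hy
    | smul r x hx => exact Submodule.smul_mem _ r hx
    | framing a s => exact Submodule.subset_span ⟨a, s, 0, by omega, by simp [cosetElt]⟩
    | braiding _ _ a b =>
      have hb : b ∈ (⊤ : Submodule K (YokoAlg d u (m + 1))) := Submodule.mem_top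
      rw [← ih] at hb
      induction hb using Submodule.span_induction with
      | zero => simp
      | add x y _ _ hx hy => rw [map_add, mul_add]; exact Submodule.add_mem _ hx hy
      | smul r x _ hx => rw [map_smul, mul_smul_comm]; exact Submodule.smul_mem _ _ hx
      | mem x hx =>
        obtain ⟨c, s, j, hj, rfl⟩ := hx
        refine Submodule.subset_span ⟨a * yokoIncl d u m c, s, j + 1, by omega, ?_⟩
        rw [cosetElt_succ _ _ hj, ← mul_assoc, mul_assoc _ _ (yg d u (m + 2) m), yt_pow_mul_yg]
        simp only [map_mul, map_pow, mul_assoc, Nat.add_sub_cancel]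
        rw [← mul_assoc (yg d u (m + 1 + 1) m), (commute_yg_yokoIncl c).eq]
        simp only [mul_assoc]

end Span

/-! ### The coset representation and the extension of a trace -/

section Extend

open Matrix

variable {d : ℕ} {u : K} {n : ℕ}

/-- The algebra `Y_n[t] / (t^d - 1)` in which the matrices of the coset representation of
`Y_{n+1}` have their entries. -/
abbrev CoefAlg (d : ℕ) (u : K) (n : ℕ) := AddMonoidAlgebra (YokoAlg d u n) (ZMod d)

/-- The inclusion of the constants in `Y_n[t] / (t^d - 1)`. -/
noncomputable def coefIncl (d : ℕ) (u : K) (n : ℕ) : YokoAlg d u n →ₐ[K] CoefAlg d u n :=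
  AddMonoidAlgebra.singleZeroAlgHom

/-- The class of `t` in `Y_n[t] / (t^d - 1)`. -/
noncomputable def coefT (d : ℕ) (u : K) (n : ℕ) : CoefAlg d u n := AddMonoidAlgebra.single 1 1

theorem coefIncl_mul_coefT_pow (a : YokoAlg d u n) (s : ℕ) :
    coefIncl d u n a * coefT d u n ^ s = AddMonoidAlgebra.single (s : ZMod d) a := by
  simp [coefIncl, coefT, AddMonoidAlgebra.single_pow, AddMonoidAlgebra.single_mul_single]

theorem commute_coefT (a : YokoAlg d u n) : Commute (coefT d u n) (coefIncl d u n a) := by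
  simp [coefIncl, coefT, Commute, SemiconjBy, AddMonoidAlgebra.single_mul_single]

theorem coefT_pow : coefT d u n ^ d = 1 := by
  have h := coefIncl_mul_coefT_pow (d := d) (u := u) (n := n) 1 d
  rw [map_one, one_mul] at h
  rw [h, ZMod.natCast_self, AddMonoidAlgebra.one_def]

theorem yokoFamily_coset (d : ℕ) (u : K) (n : ℕ) : YokoFamily d u (n + 1)
    (cosetG d u n (coefIncl d u n ∘ yg d u n) (coefIncl d u n ∘ yt d u n) (coefT d u n))
    (cosetT n (coefIncl d u n ∘ yt d u n) (coefT d u n)) :=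
  cosetFamily ((yokoFamily d u n).map (B := CoefAlg d u n) (coefIncl d u n)) coefT_pow
    (fun _ _ => commute_coefT _) (fun _ _ => commute_coefT _)

/-- The representation of `Y_{n+1}` by right multiplication on the free left module over
`Y_n[t] / (t^d - 1)` with basis the coset representatives `g_n g_{n-1} ⋯ g_k`. -/
noncomputable def cosetRep (d : ℕ) (u : K) (n : ℕ) :
    YokoAlg d u (n + 1) →ₐ[K] Matrix (Fin (n + 1)) (Fin (n + 1)) (CoefAlg d u n) :=
  (yokoFamily_coset d u n).lift

theorem cosetRow_cosetRep_yokoIncl (a : YokoAlg d u n) :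
    cosetRow (CoefAlg d u n) n n ᵥ* cosetRep d u n (yokoIncl d u n a)
      = coefIncl d u n a • cosetRow _ n n := by
  induction a using yoko_induction with
  | algebraMap r =>
    simp only [AlgHom.commutes]
    rw [Algebra.algebraMap_eq_smul_one, Algebra.algebraMap_eq_smul_one, vecMul_smul, vecMul_one,
      smul_assoc, one_smul]
  | add a b ha hb => rw [map_add, map_add, vecMul_add, ha, hb, map_add, add_smul]
  | mul a b ha hb =>
    rw [map_mul, map_mul, ← vecMul_vecMul, ha, smul_vecMul, hb, smul_smul, map_mul]
  | g i hi =>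
    rw [yokoIncl_yg hi, cosetRep, YokoFamily.lift_yg _ (by omega),
      cosetRow_cosetG_of_lt le_rfl hi]
    rfl
  | t j hj =>
    rw [yokoIncl_yt hj, cosetRep, YokoFamily.lift_yt _ (by omega),
      cosetRow_cosetT_of_lt le_rfl hj]
    rfl

theorem cosetRow_cosetRep_yt_pow (s : ℕ) :
    cosetRow (CoefAlg d u n) n n ᵥ* cosetRep d u n (yt d u (n + 1) n ^ s)
      = coefT d u n ^ s • cosetRow _ n n := by
  rw [map_pow, cosetRep, YokoFamily.lift_yt _ (by omega)]
  exact vecMul_pow_of_eigen (cosetRow_cosetT_self le_rfl rfl) s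

theorem cosetRow_cosetRep_cosetElt {j : ℕ} (hj : j ≤ n) :
    cosetRow (CoefAlg d u n) n n ᵥ* cosetRep d u n (cosetElt d u (n + 1) j)
      = cosetRow _ n (n - j) := by
  induction j with
  | zero => simp [cosetElt]
  | succ j ih =>
    rw [cosetElt, map_mul, ← vecMul_vecMul, ih (by omega), cosetRep,
      YokoFamily.lift_yg _ (by omega), cosetRow_cosetG_succ (by omega) (by omega)]
    congr 1
    omega

/-- The linear form on `Y_n[t] / (t^d - 1)` with value `f s a` at `a t^s`. -/
noncomputable def coefFun (f : ZMod d → YokoAlg d u n →ₗ[K] K) : CoefAlg d u n →ₗ[K] K :=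
  Finsupp.lsum K f ∘ₗ (AddMonoidAlgebra.coeffLinearEquiv K).toLinearMap

theorem coefFun_single (f : ZMod d → YokoAlg d u n →ₗ[K] K) (s : ZMod d) (a : YokoAlg d u n) :
    coefFun f (AddMonoidAlgebra.single s a) = f s a := by
  simp [coefFun, AddMonoidAlgebra.coeffLinearEquiv]

/-- The linear form on `Y_n[t] / (t^d - 1)` that gives the contribution of the coset representative
`g_n ⋯ g_k` to the extended trace: `a t^s g_n ⋯ g_k = a g_n t_n^s g_{n-1} ⋯ g_k` has the trace of
`z a t_n^s g_{n-1} ⋯ g_k`. -/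
noncomputable def extendCoef (x : ZMod d → K) (z : K) (tr : YokoAlg d u n →ₗ[K] K) (k : ℕ) :
    CoefAlg d u n →ₗ[K] K :=
  coefFun (if k = n then fun s => x s • tr else fun s =>
    z • tr ∘ₗ LinearMap.mulRight K (yt d u n (n - 1) ^ s.val * cosetElt d u n (n - 1 - k)))

/-- The only possible extension to `Y_{n+1}` of a Markov trace on `Y_n`. -/
noncomputable def extendTrace (x : ZMod d → K) (z : K) (tr : YokoAlg d u n →ₗ[K] K) :
    YokoAlg d u (n + 1) →ₗ[K] K :=
  ∑ k : Fin (n + 1), extendCoef x z tr k ∘ₗ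
    Matrix.entryLinearMap K (CoefAlg d u n) (Fin.last n) k ∘ₗ (cosetRep d u n).toLinearMap

theorem extendTrace_of_row {x : ZMod d → K} {z : K} {tr : YokoAlg d u n →ₗ[K] K}
    {h : YokoAlg d u (n + 1)} {r : CoefAlg d u n} {k : ℕ} (hk : k ≤ n)
    (hr : cosetRow (CoefAlg d u n) n n ᵥ* cosetRep d u n h = r • cosetRow _ n k) :
    extendTrace x z tr h = extendCoef x z tr k r := by
  rw [cosetRow_vecMul le_rfl] at hr
  have : ∀ l : Fin (n + 1), cosetRep d u n h (Fin.last n) l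
      = if l = ⟨k, by omega⟩ then r else 0 := fun l => by
    have := congrFun hr l
    refine this.trans ?_
    simp [cosetRow, Fin.ext_iff]
  simp [extendTrace, this, apply_ite]

theorem extendTrace_framing [NeZero d] (x : ZMod d → K) (z : K) (tr : YokoAlg d u n →ₗ[K] K)
    (a : YokoAlg d u n) (s : ℕ) :
    extendTrace x z tr (yokoIncl d u n a * yt d u (n + 1) n ^ s) = x s * tr a := by
  rw [extendTrace_of_row (r := AddMonoidAlgebra.single (s : ZMod d) a) le_rfl, extendCoef,
    coefFun_single, if_pos rfl]
  · simp
  · rw [map_mul, ← vecMul_vecMul, cosetRow_cosetRep_yokoIncl, smul_vecMul,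
      cosetRow_cosetRep_yt_pow, smul_smul, coefIncl_mul_coefT_pow]

theorem yt_pow_natCast_val [NeZero d] {j : ℕ} (hj : j < n) (s : ℕ) :
    yt d u n j ^ (s : ZMod d).val = yt d u n j ^ s := by
  rw [ZMod.val_natCast, ← pow_mod_orderOf, Nat.mod_mod_of_dvd _
    (orderOf_dvd_of_pow_eq_one ((yokoFamily d u n).tpow j hj)), pow_mod_orderOf]

theorem extendTrace_braiding [NeZero d] (x : ZMod d → K) (z : K)
    (tr : YokoAlg d u (n + 1) →ₗ[K] K) (a b : YokoAlg d u (n + 1)) :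
    extendTrace x z tr (yokoIncl d u (n + 1) a * yg d u (n + 2) n * yokoIncl d u (n + 1) b)
      = z * tr (a * b) := by
  have hb : b ∈ (⊤ : Submodule K (YokoAlg d u (n + 1))) := Submodule.mem_top
  rw [← span_cosetElt] at hb
  induction hb using Submodule.span_induction with
  | zero => simp
  | add x y _ _ hx hy => rw [map_add, mul_add, map_add, hx, hy, mul_add, map_add, mul_add]
  | smul r x _ hx =>
    rw [map_smul, mul_smul_comm, map_smul, hx, mul_smul_comm, map_smul, smul_eq_mul, smul_eq_mul]
    ring
  | mem b hb =>
    obtain ⟨c, s, j, hj, rfl⟩ := hb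
    have h : yokoIncl d u (n + 1) a * yg d u (n + 2) n
          * yokoIncl d u (n + 1) (yokoIncl d u n c * yt d u (n + 1) n ^ s * cosetElt d u (n + 1) j)
        = yokoIncl d u (n + 1) (a * yokoIncl d u n c) * yt d u (n + 2) (n + 1) ^ s
          * cosetElt d u (n + 2) (j + 1) := by
      rw [cosetElt_succ _ _ hj, ← mul_assoc, mul_assoc _ _ (yg d u (n + 2) n), yt_pow_mul_yg]
      simp only [map_mul, map_pow, mul_assoc]
      rw [← mul_assoc (yg d u (n + 2) n), (commute_yg_yokoIncl c).eq]
      simp only [mul_assoc]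
    rw [h, extendTrace_of_row (k := n + 1 - (j + 1))
      (r := AddMonoidAlgebra.single (s : ZMod d) (a * yokoIncl d u n c)) (by omega), extendCoef,
      coefFun_single, if_neg (by omega)]
    · simp only [LinearMap.smul_apply, LinearMap.comp_apply, LinearMap.mulRight_apply, smul_eq_mul]
      rw [Nat.add_sub_cancel, yt_pow_natCast_val (by omega),
        show n - (n + 1 - (j + 1)) = j by omega]
      simp only [mul_assoc]
    · rw [map_mul, ← vecMul_vecMul, map_mul, ← vecMul_vecMul, cosetRow_cosetRep_yokoIncl,
        smul_vecMul, cosetRow_cosetRep_yt_pow, smul_smul, coefIncl_mul_coefT_pow, smul_vecMul,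
        cosetRow_cosetRep_cosetElt (by omega)]

end Extend

/-! ### The trace property and the existence of the Juyumaya trace -/

section Trace

variable {d : ℕ} {u : K} {n : ℕ}

/-- The rules of a Markov trace that link the linear forms `tr` on `Y_n` and `T` on `Y_{n+1}`, in
the form in which they determine `T`. -/
structure MarkovStep (x : ZMod d → K) (z : K) (tr : YokoAlg d u n →ₗ[K] K)
    (T : YokoAlg d u (n + 1) →ₗ[K] K) : Prop where
  framing : ∀ a (s : ℕ), T (yokoIncl d u n a * yt d u (n + 1) n ^ s) = x s * tr a
  braiding : 1 ≤ n → ∀ a b, T (yokoIncl d u n a * yg d u (n + 1) (n - 1) * yokoIncl d u n b)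
    = z * tr (a * b)

theorem markovStep_extendTrace [NeZero d] (x : ZMod d → K) (z : K) (tr : YokoAlg d u n →ₗ[K] K) :
    MarkovStep x z tr (extendTrace x z tr) where
  framing := extendTrace_framing x z tr
  braiding hn a b := by
    obtain ⟨m, rfl⟩ : ∃ m, n = m + 1 := ⟨n - 1, by omega⟩
    exact extendTrace_braiding x z tr a b

theorem trace_mul_lastE_mul (T : YokoAlg d u (n + 2) →ₗ[K] K) (X Y : YokoAlg d u (n + 2)) :
    T (X * lastE d u n * Y) = (d : K)⁻¹ * ∑ j ∈ range d,
      T (X * (yokoIncl d u (n + 1) (yt d u (n + 1) n) ^ j * yt d u (n + 2) (n + 1) ^ (d - j))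
        * Y) := by
  rw [lastE, yokoIdem, mul_smul_comm, smul_mul_assoc, map_smul, mul_sum, sum_mul, map_sum,
    smul_eq_mul]

theorem lastE_eq_swap : lastE d u n
    = yokoIdem K d (yt d u (n + 2) (n + 1)) (yokoIncl d u (n + 1) (yt d u (n + 1) n)) := by
  have hf := yokoFamily d u (n + 2)
  rw [lastE, yokoIncl_yt (by omega)]
  exact yokoIdem_comm (hf.tt _ _ (by omega) (by omega)) (hf.tpow _ (by omega))
    (hf.tpow _ (by omega))

theorem trace_mul_lastE_mul' (T : YokoAlg d u (n + 2) →ₗ[K] K) (X Y : YokoAlg d u (n + 2)) :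
    T (X * lastE d u n * Y) = (d : K)⁻¹ * ∑ j ∈ range d,
      T (X * (yt d u (n + 2) (n + 1) ^ j * yokoIncl d u (n + 1) (yt d u (n + 1) n) ^ (d - j))
        * Y) := by
  rw [lastE_eq_swap, yokoIdem, mul_smul_comm, smul_mul_assoc, map_smul, mul_sum, sum_mul, map_sum,
    smul_eq_mul]

theorem yokoIncl_yt_pow_period (s : ℕ) {j : ℕ} (hj : j ≤ d) :
    yt d u (n + 1) n ^ j * yt d u (n + 1) n ^ (s + (d - j)) = yt d u (n + 1) n ^ s := by
  rw [← pow_add, show j + (s + (d - j)) = s + d by omega, pow_add,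
    (yokoFamily d u (n + 1)).tpow n (by omega), mul_one]

namespace MarkovStep

variable {x : ZMod d → K} {z : K}

section

variable {tr : YokoAlg d u n →ₗ[K] K} {T : YokoAlg d u (n + 1) →ₗ[K] K}

theorem incl (hT : MarkovStep x z tr T) (hx : x 0 = 1) (a : YokoAlg d u n) :
    T (yokoIncl d u n a) = tr a := by
  have h := hT.framing a 0
  rwa [pow_zero, mul_one, Nat.cast_zero, hx, one_mul] at h

theorem comm_incl (hT : MarkovStep x z tr T) (htr : ∀ a b, tr (a * b) = tr (b * a))
    (y : YokoAlg d u n) (X : YokoAlg d u (n + 1)) :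
    T (X * yokoIncl d u n y) = T (yokoIncl d u n y * X) := by
  induction X using yoko_span_induction with
  | add X Y hX hY => rw [add_mul, mul_add, map_add, map_add, hX, hY]
  | smul r X hX => rw [smul_mul_assoc, mul_smul_comm, map_smul, map_smul, hX]
  | framing a s =>
    rw [mul_assoc, ((commute_yt_yokoIncl y).pow_left s).eq, ← mul_assoc, ← mul_assoc, ← map_mul,
      ← map_mul, hT.framing, hT.framing, htr]
  | braiding m h a b =>
    rw [mul_assoc, ← map_mul, ← mul_assoc, ← mul_assoc, ← map_mul, hT.braiding (by omega),
      hT.braiding (by omega), ← mul_assoc, htr, mul_assoc]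

end

section

variable {tr : YokoAlg d u (n + 1) →ₗ[K] K} {T : YokoAlg d u (n + 2) →ₗ[K] K}

theorem braiding' (hT : MarkovStep x z tr T) (a b : YokoAlg d u (n + 1)) :
    T (yokoIncl d u (n + 1) a * yg d u (n + 2) n * yokoIncl d u (n + 1) b) = z * tr (a * b) :=
  hT.braiding (by omega) a b

theorem braiding_right (hT : MarkovStep x z tr T) (a : YokoAlg d u (n + 1)) :
    T (yokoIncl d u (n + 1) a * yg d u (n + 2) n) = z * tr a := by
  simpa using hT.braiding' a 1

theorem framing_lastE (hT : MarkovStep x z tr T) (a : YokoAlg d u (n + 1)) (s : ℕ) :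
    T (yokoIncl d u (n + 1) a * yt d u (n + 2) (n + 1) ^ s * lastE d u n)
      = (d : K)⁻¹ * ∑ j ∈ range d, x (s + (d - j) : ℕ) * tr (a * yt d u (n + 1) n ^ j) := by
  have h := trace_mul_lastE_mul T (yokoIncl d u (n + 1) a * yt d u (n + 2) (n + 1) ^ s) 1
  simp only [mul_one] at h
  rw [h]
  congr 1
  refine sum_congr rfl fun j _ => ?_
  rw [mul_assoc, ← mul_assoc (_ ^ s), ← map_pow, ((commute_yt_yokoIncl _).pow_left s).eq,
    mul_assoc, ← pow_add, ← mul_assoc, ← map_mul, hT.framing]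

theorem framing_lastE_mul_yg [NeZero d] [CharZero K] (hT : MarkovStep x z tr T)
    (a : YokoAlg d u (n + 1)) (s : ℕ) :
    T (yokoIncl d u (n + 1) a * yt d u (n + 2) (n + 1) ^ s * lastE d u n * yg d u (n + 2) n)
      = z * tr (a * yt d u (n + 1) n ^ s) := by
  rw [trace_mul_lastE_mul]
  rw [sum_congr rfl (g := fun _ => z * tr (a * yt d u (n + 1) n ^ s))]
  · rw [sum_const, card_range, nsmul_eq_mul, inv_mul_cancel_left₀ (by simpa using NeZero.ne d)]
  intro j hj
  rw [mul_assoc (yokoIncl d u (n + 1) a), ← mul_assoc (_ ^ s), ← map_pow,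
    ((commute_yt_yokoIncl _).pow_left s).eq, mul_assoc _ (_ ^ s) (_ ^ (d - j)), ← pow_add,
    mul_assoc, mul_assoc,
    yt_pow_mul_yg, ← map_pow, ← mul_assoc, ← map_mul, ← mul_assoc, hT.braiding', mul_assoc,
    yokoIncl_yt_pow_period _ (mem_range.1 hj).le]

/-- The trace of `a t^s g²`, where `g` and `t` are the last generators. -/
theorem framing_yg_sq [NeZero d] [CharZero K] (hT : MarkovStep x z tr T)
    (a : YokoAlg d u (n + 1)) (s : ℕ) :
    T (yokoIncl d u (n + 1) a * yt d u (n + 2) (n + 1) ^ s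
        * (yg d u (n + 2) n * yg d u (n + 2) n))
      = x s * tr a + (u - 1) * ((d : K)⁻¹ *
          ∑ j ∈ range d, x (s + (d - j) : ℕ) * tr (a * yt d u (n + 1) n ^ j))
        + (u - 1) * (z * tr (a * yt d u (n + 1) n ^ s)) := by
  rw [yg_mul_self, mul_add, mul_add, mul_one, smul_mul_assoc, mul_smul_comm, mul_smul_comm,
    map_add, map_add, map_smul, map_smul, ← mul_assoc, hT.framing, hT.framing_lastE,
    hT.framing_lastE_mul_yg, smul_eq_mul, smul_eq_mul]

/-- The trace of `a g c t_n^s g`, where `g` is the last braiding generator, `t_n` the last framing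
generator of `Y_n`, and `c` is in `Y_{n-1}`. -/
theorem yg_framing_yg [NeZero d] [CharZero K] (hT : MarkovStep x z tr T)
    (a : YokoAlg d u (n + 1)) (c : YokoAlg d u n) (s : ℕ) :
    T (yokoIncl d u (n + 1) a * yg d u (n + 2) n
        * yokoIncl d u (n + 1) (yokoIncl d u n c * yt d u (n + 1) n ^ s) * yg d u (n + 2) n)
      = x s * tr (a * yokoIncl d u n c) + (u - 1) * ((d : K)⁻¹ * ∑ j ∈ range d,
          x (s + (d - j) : ℕ) * tr (a * yokoIncl d u n c * yt d u (n + 1) n ^ j))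
        + (u - 1) * (z * tr (a * yokoIncl d u n c * yt d u (n + 1) n ^ s)) := by
  rw [← hT.framing_yg_sq]
  congr 1
  have hts : Commute (yt d u (n + 2) (n + 1) ^ s) (yg d u (n + 2) n * yg d u (n + 2) n) := by
    rw [Commute, SemiconjBy, ← mul_assoc, yt_pow_mul_yg, mul_assoc, yokoIncl_yt_pow_mul_yg,
      mul_assoc]
  rw [map_mul, map_pow, map_mul, mul_assoc _ _ (yg d u (n + 2) n), mul_assoc _ _ (yg d u (n + 2) n),
    yokoIncl_yt_pow_mul_yg, mul_assoc _ (_ ^ s), hts.eq, mul_assoc (yokoIncl d u (n + 1) a),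
    ← mul_assoc (yg d u (n + 2) n), (commute_yg_yokoIncl c).eq]
  simp only [mul_assoc]

end

section

variable {tr : YokoAlg d u (n + 2) →ₗ[K] K} {T : YokoAlg d u (n + 3) →ₗ[K] K}

/-- The trace of `a g c g' c' g`, where `g`, `g'` are the last two braiding generators and `c`, `c'`
commute with `g`. -/
theorem yg_braiding_yg (hT : MarkovStep x z tr T)
    (a : YokoAlg d u (n + 2)) (c c' : YokoAlg d u (n + 1)) :
    T (yokoIncl d u (n + 2) a * yg d u (n + 3) (n + 1)
        * yokoIncl d u (n + 2) (yokoIncl d u (n + 1) c * yg d u (n + 2) n * yokoIncl d u (n + 1) c')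
        * yg d u (n + 3) (n + 1))
      = z * tr (a * yokoIncl d u (n + 1) c * (yg d u (n + 2) n * yg d u (n + 2) n)
          * yokoIncl d u (n + 1) c') := by
  have h : yokoIncl d u (n + 2) a * yg d u (n + 3) (n + 1)
        * yokoIncl d u (n + 2) (yokoIncl d u (n + 1) c * yg d u (n + 2) n * yokoIncl d u (n + 1) c')
        * yg d u (n + 3) (n + 1)
      = yokoIncl d u (n + 2) (a * yokoIncl d u (n + 1) c * yg d u (n + 2) n)
        * yg d u (n + 3) (n + 1)
        * yokoIncl d u (n + 2) (yg d u (n + 2) n * yokoIncl d u (n + 1) c') := by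
    simp only [map_mul, mul_assoc]
    rw [← (commute_yg_yokoIncl c').eq, ← mul_assoc (yg d u (n + 3) (n + 1)),
      (commute_yg_yokoIncl c).eq, mul_assoc, ← mul_assoc (yg d u (n + 3) (n + 1)),
      ← mul_assoc (_ * _) (yg d u (n + 3) (n + 1)), yg_yokoIncl_yg]
    simp only [mul_assoc]
  rw [h, hT.braiding']
  simp only [mul_assoc]

end

section

variable {tr' : YokoAlg d u (n + 1) →ₗ[K] K} {tr : YokoAlg d u (n + 2) →ₗ[K] K}

theorem yg_sq_symm (htr : ∀ a b, tr (a * b) = tr (b * a)) (ht : MarkovStep x z tr' tr)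
    (A B : YokoAlg d u (n + 1)) :
    tr (yg d u (n + 2) n * yokoIncl d u (n + 1) A * (yg d u (n + 2) n * yg d u (n + 2) n)
        * yokoIncl d u (n + 1) B)
      = tr (yg d u (n + 2) n * yokoIncl d u (n + 1) B * (yg d u (n + 2) n * yg d u (n + 2) n)
        * yokoIncl d u (n + 1) A) := by
  set g := yg d u (n + 2) n with hg
  set ι := yokoIncl d u (n + 1) with hι
  set p := yt d u (n + 2) (n + 1) with hp
  set p' := yt d u (n + 1) n with hp'
  set e := lastE d u n with he
  have hpι : ∀ a s, p ^ s * ι a = ι a * p ^ s := fun a s => ((commute_yt_yokoIncl a).pow_left s).eq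
  have h1 : ∀ s, p ^ s * g = g * ι p' ^ s := yt_pow_mul_yg
  have h2 : ∀ s, ι p' ^ s * g = g * p ^ s := yokoIncl_yt_pow_mul_yg
  have hB : ∀ a b, tr (ι a * g * ι b) = z * tr' (a * b) := ht.braiding'
  rw [mul_assoc (g * ι B), htr (g * ι B)]
  have hgg : g * g = 1 + (u - 1) • e + (u - 1) • (e * g) := by
    rw [← smul_mul_assoc]; exact yg_mul_self
  have hpι' : ∀ a s w, p ^ s * (ι a * w) = ι a * (p ^ s * w) := fun a s w => by
    rw [← mul_assoc, hpι, mul_assoc]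
  have hpp : ∀ r s, p ^ s * ι p' ^ r = ι p' ^ r * p ^ s := fun r s => by rw [← map_pow, hpι]
  have hpp' : ∀ r s w, p ^ s * (ι p' ^ r * w) = ι p' ^ r * (p ^ s * w) := fun r s w => by
    rw [← mul_assoc, hpp, mul_assoc]
  have h1' : ∀ s w, p ^ s * (g * w) = g * (ι p' ^ s * w) := fun s w => by
    rw [← mul_assoc, h1, mul_assoc]
  have h2' : ∀ s w, ι p' ^ s * (g * w) = g * (p ^ s * w) := fun s w => by
    rw [← mul_assoc, h2, mul_assoc]
  have t1 : tr (g * ι A * 1 * ι B) = tr (1 * (ι A * (g * ι B))) := by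
    have e1 : g * ι A * 1 * ι B = ι 1 * g * ι (A * B) := by
      rw [map_one, one_mul, mul_one, map_mul, mul_assoc]
    rw [e1, hB, one_mul, one_mul, ← mul_assoc, hB]
  have t2 : tr (g * ι A * e * ι B) = tr (e * (ι A * (g * ι B))) := by
    have r := trace_mul_lastE_mul' tr 1 (ι A * (g * ι B))
    rw [one_mul] at r
    rw [trace_mul_lastE_mul, r]
    congr 1
    refine sum_congr rfl fun j _ => ?_
    have e1 : g * ι A * (ι p' ^ j * p ^ (d - j)) * ι B
        = g * ι (A * p' ^ j * B) * p ^ (d - j) := by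
      simp only [map_mul, map_pow, mul_assoc, hpι]
    have e2 : p ^ (d - j) * (g * ι (A * p' ^ j * B))
        = ι 1 * g * ι (p' ^ (d - j) * (A * p' ^ j * B)) := by
      simp only [map_mul, map_pow, map_one, one_mul, mul_assoc, h1']
    have e3 : 1 * (p ^ j * ι p' ^ (d - j)) * (ι A * (g * ι B))
        = ι (p' ^ (d - j) * A) * g * ι (p' ^ j * B) := by
      simp only [map_mul, map_pow, one_mul, mul_assoc, hpι', hpp', h1']
    rw [e1, htr, e2, hB]
    refine Eq.trans ?_ (congrArg tr e3).symm
    rw [hB]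
    simp only [mul_assoc, one_mul]
  have t3 : tr (g * ι A * (e * g) * ι B) = tr (e * g * (ι A * (g * ι B))) := by
    have r := trace_mul_lastE_mul' tr 1 (g * (ι A * (g * ι B)))
    rw [one_mul] at r
    rw [← mul_assoc (g * ι A), mul_assoc _ g (ι B), trace_mul_lastE_mul, mul_assoc e, r]
    congr 1
    refine sum_congr rfl fun j _ => ?_
    have e1 : g * ι A * (ι p' ^ j * p ^ (d - j)) * (g * ι B)
        = g * (p ^ (d - j) * (ι A * (g * ι B))) * p ^ j := by
      simp only [mul_assoc, hpι', hpι, hpp', h1', h2']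
    have e2 : 1 * (p ^ j * ι p' ^ (d - j)) * (g * (ι A * (g * ι B)))
        = p ^ j * (g * (p ^ (d - j) * (ι A * (g * ι B)))) := by
      rw [one_mul, mul_assoc, h2']
    refine (congrArg tr e1).trans (Eq.trans ?_ (congrArg tr e2).symm)
    rw [htr]
  have hcomb : ∀ X Y : YokoAlg d u (n + 2), tr (X * (g * g) * Y)
      = tr (X * 1 * Y) + (u - 1) * tr (X * e * Y) + (u - 1) * tr (X * (e * g) * Y) := by
    intro X Y
    rw [hgg]
    simp only [mul_add, add_mul, map_add, mul_smul_comm, smul_mul_assoc, map_smul, smul_eq_mul]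
  have hcomb' := hcomb 1 (ι A * (g * ι B))
  simp only [one_mul] at hcomb' t1
  rw [hcomb, t1, t2, t3]
  rw [← hcomb']
  simp only [mul_assoc]

end

section

variable [NeZero d] [CharZero K]

theorem beta_symm_framing {tr₀ : YokoAlg d u n →ₗ[K] K} {tr : YokoAlg d u (n + 1) →ₗ[K] K}
    {T : YokoAlg d u (n + 2) →ₗ[K] K} (htr₀ : ∀ a b, tr₀ (a * b) = tr₀ (b * a))
    (ht : MarkovStep x z tr₀ tr) (hT : MarkovStep x z tr T) (c f : YokoAlg d u n) (r s : ℕ) :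
    T (yokoIncl d u (n + 1) (yokoIncl d u n c * yt d u (n + 1) n ^ r) * yg d u (n + 2) n
        * yokoIncl d u (n + 1) (yokoIncl d u n f * yt d u (n + 1) n ^ s) * yg d u (n + 2) n)
      = T (yokoIncl d u (n + 1) (yokoIncl d u n f * yt d u (n + 1) n ^ s) * yg d u (n + 2) n
        * yokoIncl d u (n + 1) (yokoIncl d u n c * yt d u (n + 1) n ^ r) * yg d u (n + 2) n) := by
  have hpc : ∀ (a b : YokoAlg d u n) (s j : ℕ),
      tr (yokoIncl d u n a * yt d u (n + 1) n ^ s * yokoIncl d u n b * yt d u (n + 1) n ^ j)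
        = x ((s : ZMod d) + j) * tr₀ (a * b) := fun a b s j => by
    rw [mul_assoc (yokoIncl d u n a), ((commute_yt_yokoIncl b).pow_left s).eq, ← mul_assoc,
      mul_assoc, ← pow_add, ← map_mul, ht.framing, Nat.cast_add]
  have hpc' : ∀ (a b : YokoAlg d u n) (s : ℕ),
      tr (yokoIncl d u n a * yt d u (n + 1) n ^ s * yokoIncl d u n b)
        = x s * tr₀ (a * b) := fun a b s => by
    simpa using hpc a b s 0
  -- The sum of `x_{s-j} x_{r+j}` over `j` modulo `d` is symmetric in `r` and `s`.
  have hsum : ∀ s r : ℕ, ∑ j ∈ range d, x (s + (d - j) : ℕ) * x ((r : ZMod d) + j)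
      = ∑ j : ZMod d, x (s - j) * x (r + j) := by
    intro s r
    rw [← Fin.sum_univ_eq_sum_range (fun j => x (s + (d - j) : ℕ) * x ((r : ZMod d) + j))]
    obtain ⟨e, rfl⟩ : ∃ e, d = e + 1 := ⟨d - 1, by have := NeZero.ne d; omega⟩
    refine Fintype.sum_congr _ _ fun (j : ZMod (e + 1)) => ?_
    change x ((s + (e + 1 - ZMod.val j) : ℕ) : ZMod (e + 1))
        * x ((r : ZMod (e + 1)) + ((ZMod.val j : ℕ) : ZMod (e + 1)))
      = x (s - j) * x (r + j)
    rw [Nat.cast_add, Nat.cast_sub (ZMod.val_lt j).le, ZMod.natCast_zmod_val, ZMod.natCast_self,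
      zero_sub, sub_eq_add_neg]
  have hsymm : ∑ j : ZMod d, x (s - j) * x (r + j) = ∑ j : ZMod d, x (r - j) * x (s + j) := by
    refine (Equiv.sum_comp (Equiv.neg (ZMod d)) _).symm.trans ?_
    refine Fintype.sum_congr _ _ fun j => ?_
    rw [Equiv.neg_apply, mul_comm, sub_neg_eq_add, ← sub_eq_add_neg]
  rw [hT.yg_framing_yg, hT.yg_framing_yg]
  simp only [hpc, hpc', htr₀ f c, ← mul_assoc, ← sum_mul]
  rw [hsum, hsum, hsymm, add_comm (r : ZMod d)]
  ring

theorem beta_symm_mixed {tr₀ : YokoAlg d u (n + 1) →ₗ[K] K} {tr : YokoAlg d u (n + 2) →ₗ[K] K}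
    {T : YokoAlg d u (n + 3) →ₗ[K] K} (htr₀ : ∀ a b, tr₀ (a * b) = tr₀ (b * a))
    (ht : MarkovStep x z tr₀ tr) (hT : MarkovStep x z tr T) (c c' f : YokoAlg d u (n + 1)) (s : ℕ) :
    T (yokoIncl d u (n + 2) (yokoIncl d u (n + 1) c * yg d u (n + 2) n * yokoIncl d u (n + 1) c')
        * yg d u (n + 3) (n + 1)
        * yokoIncl d u (n + 2) (yokoIncl d u (n + 1) f * yt d u (n + 2) (n + 1) ^ s)
        * yg d u (n + 3) (n + 1))
      = T (yokoIncl d u (n + 2) (yokoIncl d u (n + 1) f * yt d u (n + 2) (n + 1) ^ s)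
        * yg d u (n + 3) (n + 1)
        * yokoIncl d u (n + 2) (yokoIncl d u (n + 1) c * yg d u (n + 2) n * yokoIncl d u (n + 1) c')
        * yg d u (n + 3) (n + 1)) := by
  rw [hT.yg_framing_yg, hT.yg_braiding_yg]
  set g := yg d u (n + 2) n with hg
  set ι := yokoIncl d u (n + 1) with hι
  set p := yt d u (n + 2) (n + 1) with hp
  set p' := yt d u (n + 1) n with hp'
  set e := lastE d u n with he
  have hpι : ∀ a s, p ^ s * ι a = ι a * p ^ s := fun a s => ((commute_yt_yokoIncl a).pow_left s).eq
  have hpι' : ∀ a s w, p ^ s * (ι a * w) = ι a * (p ^ s * w) := fun a s w => by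
    rw [← mul_assoc, hpι, mul_assoc]
  have h1 : ∀ s, p ^ s * g = g * ι p' ^ s := yt_pow_mul_yg
  have hB : ∀ a b, tr (ι a * g * ι b) = z * tr₀ (a * b) := ht.braiding'
  have hF : ∀ (a) (s : ℕ), tr (ι a * p ^ s) = x s * tr₀ a := ht.framing
  have hgp' : ∀ j, g * p ^ j = ι p' ^ j * g := fun j => (yokoIncl_yt_pow_mul_yg j).symm
  have hgp : ∀ j, tr (ι c * g * ι c' * ι f * p ^ j) = z * tr₀ (f * c * p' ^ j * c') := by
    intro j
    have e1 : ι c * g * ι c' * ι f * p ^ j = ι (c * p' ^ j) * g * ι (c' * f) := by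
      rw [mul_assoc _ (ι c'), ← map_mul, mul_assoc _ _ (p ^ j), ← hpι, ← mul_assoc,
        mul_assoc _ g, hgp']
      simp only [map_mul, map_pow, mul_assoc]
    rw [e1, hB, ← mul_assoc, htr₀]
    simp only [mul_assoc]
  have hg0 : tr (ι c * g * ι c' * ι f) = z * tr₀ (f * c * c') := by simpa using hgp 0
  have hgg : g * g = 1 + (u - 1) • e + (u - 1) • (e * g) := by
    rw [← smul_mul_assoc]; exact yg_mul_self
  have r1 : tr (ι f * p ^ s * ι c * ι c') = x s * tr₀ (f * c * c') := by
    rw [← hF, mul_assoc (ι f), hpι]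
    simp only [map_mul, mul_assoc, hpι]
  have r2 : tr (ι f * p ^ s * ι c * e * ι c') = (d : K)⁻¹ * ∑ j ∈ range d,
      x (s + (d - j) : ℕ) * tr₀ (f * c * p' ^ j * c') := by
    rw [trace_mul_lastE_mul]
    congr 1
    refine sum_congr rfl fun j _ => ?_
    have e1 : ι f * p ^ s * ι c * (ι p' ^ j * p ^ (d - j)) * ι c'
        = ι (f * c * p' ^ j * c') * p ^ (s + (d - j)) := by
      rw [pow_add, mul_assoc, mul_assoc (ι p' ^ j), hpι, ← map_pow]
      simp only [map_mul, mul_assoc, hpι']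
    exact (congrArg tr e1).trans (hF _ _)
  have r3 : tr (ι f * p ^ s * ι c * (e * g) * ι c') = z * tr₀ (f * c * p' ^ s * c') := by
    rw [← mul_assoc _ e, mul_assoc _ g, trace_mul_lastE_mul]
    rw [sum_congr rfl (g := fun _ => z * tr₀ (f * c * p' ^ s * c'))]
    · rw [sum_const, card_range, nsmul_eq_mul, inv_mul_cancel_left₀ (by simpa using NeZero.ne d)]
    intro j hj
    have e1 : ι f * p ^ s * ι c * (ι p' ^ j * p ^ (d - j)) * (g * ι c')
        = ι (f * c * p' ^ j) * g * ι (p' ^ (s + (d - j)) * c') := by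
      rw [map_mul ι (p' ^ _), map_pow ι p' (s + (d - j)), mul_assoc (ι (f * c * p' ^ j)) g,
        ← mul_assoc g, ← h1, pow_add]
      simp only [map_mul, mul_assoc, hpι']
      rw [← map_pow, hpι']
    refine (congrArg tr e1).trans ?_
    rw [hB, ← mul_assoc, mul_assoc _ (p' ^ j), yokoIncl_yt_pow_period _ (mem_range.1 hj).le]
  rw [hg0, hgp]
  simp only [hgp]
  have hR : tr (ι (f) * p ^ s * ι c * (g * g) * ι c')
      = tr (ι f * p ^ s * ι c * ι c') + (u - 1) * tr (ι f * p ^ s * ι c * e * ι c')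
        + (u - 1) * tr (ι f * p ^ s * ι c * (e * g) * ι c') := by
    rw [hgg]
    simp only [mul_add, add_mul, map_add, mul_smul_comm, smul_mul_assoc, map_smul, smul_eq_mul,
      mul_one]
  rw [hR, r1, r2, r3]
  simp only [mul_add, mul_sum]
  congr 1
  congr 1
  · ring
  · exact sum_congr rfl fun j _ => by ring
  · ring

/-- The trace of `a g b g` is symmetric in `a` and `b`. -/
theorem beta_symm {tr₀ : YokoAlg d u n →ₗ[K] K} {tr : YokoAlg d u (n + 1) →ₗ[K] K}
    {T : YokoAlg d u (n + 2) →ₗ[K] K} (htr₀ : ∀ a b, tr₀ (a * b) = tr₀ (b * a))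
    (htr : ∀ a b, tr (a * b) = tr (b * a))
    (ht : MarkovStep x z tr₀ tr) (hT : MarkovStep x z tr T) (a b : YokoAlg d u (n + 1)) :
    T (yokoIncl d u (n + 1) a * yg d u (n + 2) n * yokoIncl d u (n + 1) b * yg d u (n + 2) n)
      = T (yokoIncl d u (n + 1) b * yg d u (n + 2) n * yokoIncl d u (n + 1) a
          * yg d u (n + 2) n) := by
  induction a using yoko_span_induction with
  | add a a' ha ha' => simp only [map_add, mul_add, add_mul, ha, ha']
  | smul r a ha => simp only [map_smul, mul_smul_comm, smul_mul_assoc, ha]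
  | framing c r =>
    induction b using yoko_span_induction with
    | add b b' hb hb' => simp only [map_add, mul_add, add_mul, hb, hb']
    | smul r b hb => simp only [map_smul, mul_smul_comm, smul_mul_assoc, hb]
    | framing f s => exact beta_symm_framing htr₀ ht hT c f r s
    | braiding m h f f' =>
      subst h
      exact (beta_symm_mixed htr₀ ht hT f f' c r).symm
  | braiding m h c c' =>
    subst h
    induction b using yoko_span_induction with
    | add b b' hb hb' => simp only [map_add, mul_add, add_mul, hb, hb']
    | smul r b hb => simp only [map_smul, mul_smul_comm, smul_mul_assoc, hb]
    | framing f s => exact beta_symm_mixed htr₀ ht hT c c' f s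
    | braiding l h f f' =>
      obtain rfl : m = l := by omega
      simp only [Nat.add_sub_cancel]
      rw [hT.yg_braiding_yg, hT.yg_braiding_yg]
      have h1 := yg_sq_symm htr ht (c' * f) (f' * c)
      have h2 : ∀ a b a' b' : YokoAlg d u (m + 1),
          tr (yg d u (m + 2) m * yokoIncl d u (m + 1) (a * b)
            * (yg d u (m + 2) m * yg d u (m + 2) m) * yokoIncl d u (m + 1) (a' * b'))
          = tr (yokoIncl d u (m + 1) b' * yg d u (m + 2) m * yokoIncl d u (m + 1) a
            * yokoIncl d u (m + 1) b * (yg d u (m + 2) m * yg d u (m + 2) m)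
            * yokoIncl d u (m + 1) a') := by
        intro a b a' b'
        rw [map_mul (yokoIncl d u (m + 1)), map_mul (yokoIncl d u (m + 1)),
          ← mul_assoc _ (yokoIncl d u (m + 1) a'), htr]
        simp only [mul_assoc]
      rw [h2, h2] at h1
      rw [h1]

/-- The trace property passes from `Y_n` to `Y_{n+1}`. -/
theorem comm_succ {tr₀ : YokoAlg d u n →ₗ[K] K} {tr : YokoAlg d u (n + 1) →ₗ[K] K}
    {T : YokoAlg d u (n + 2) →ₗ[K] K} (htr₀ : ∀ a b, tr₀ (a * b) = tr₀ (b * a))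
    (htr : ∀ a b, tr (a * b) = tr (b * a))
    (ht : MarkovStep x z tr₀ tr) (hT : MarkovStep x z tr T) (X Y : YokoAlg d u (n + 2)) :
    T (X * Y) = T (Y * X) := by
  have hp : ∀ X, T (X * yt d u (n + 2) (n + 1)) = T (yt d u (n + 2) (n + 1) * X) := by
    intro X
    induction X using yoko_span_induction with
    | add X Y hX hY => rw [add_mul, mul_add, map_add, map_add, hX, hY]
    | smul r X hX => rw [smul_mul_assoc, mul_smul_comm, map_smul, map_smul, hX]
    | framing a s =>
      rw [← mul_assoc, (commute_yt_yokoIncl a).eq, mul_assoc, mul_assoc, ← pow_succ, ← pow_succ']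
    | braiding m h a b =>
      simp only [Nat.add_sub_cancel]
      have h1 := yt_pow_mul_yg (d := d) (u := u) (n := n) 1
      have h2 := yokoIncl_yt_pow_mul_yg (d := d) (u := u) (n := n) 1
      rw [pow_one, pow_one] at h1 h2
      rw [mul_assoc _ (yokoIncl d u (n + 1) b), ← (commute_yt_yokoIncl b).eq, ← mul_assoc,
        mul_assoc _ _ (yt d u (n + 2) (n + 1)), ← h2, ← mul_assoc, ← mul_assoc, ← mul_assoc,
        (commute_yt_yokoIncl a).eq, mul_assoc _ (yt d u (n + 2) (n + 1)) (yg d u (n + 2) n), h1,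
        ← map_mul,
        hT.braiding', ← mul_assoc, mul_assoc _ _ (yokoIncl d u (n + 1) b), ← map_mul,
        hT.braiding', mul_assoc]
  have hg : ∀ X, T (X * yg d u (n + 2) n) = T (yg d u (n + 2) n * X) := by
    intro X
    induction X using yoko_span_induction with
    | add X Y hX hY => rw [add_mul, mul_add, map_add, map_add, hX, hY]
    | smul r X hX => rw [smul_mul_assoc, mul_smul_comm, map_smul, map_smul, hX]
    | framing a s =>
      rw [mul_assoc, yt_pow_mul_yg, ← ((commute_yt_yokoIncl a).pow_left s).eq, ← mul_assoc,
        ← mul_assoc, ← yokoIncl_yt_pow_mul_yg, ← map_pow, hT.braiding', hT.braiding', htr]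
    | braiding m h a b =>
      simp only [Nat.add_sub_cancel]
      rw [beta_symm htr₀ htr ht hT, ← mul_assoc, hT.comm_incl htr, ← mul_assoc, ← mul_assoc]
  induction Y using yoko_induction generalizing X with
  | algebraMap r => rw [Algebra.commutes]
  | add a b ha hb => rw [mul_add, add_mul, map_add, map_add, ha, hb]
  | mul a b ha hb => rw [← mul_assoc, hb, ← mul_assoc, ha, mul_assoc]
  | g i hi =>
    obtain rfl | h : i = n ∨ i + 1 < n + 1 := by omega
    · exact hg X
    · rw [← yokoIncl_yg h]
      exact hT.comm_incl htr _ _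
  | t j hj =>
    obtain rfl | h : j = n + 1 ∨ j < n + 1 := by omega
    · exact hp X
    · rw [← yokoIncl_yt h]
      exact hT.comm_incl htr _ _

end

end MarkovStep

/-- The algebra `Y_{d,0}(u)` is the base field. -/
theorem yoko_zero_eq_smul_one (a : YokoAlg d u 0) : ∃ r : K, a = r • 1 := by
  induction a using yoko_induction with
  | algebraMap r => exact ⟨r, Algebra.algebraMap_eq_smul_one r⟩
  | add a b ha hb =>
    obtain ⟨r, rfl⟩ := ha
    obtain ⟨s, rfl⟩ := hb
    exact ⟨r + s, (add_smul _ _ _).symm⟩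
  | mul a b ha hb =>
    obtain ⟨r, rfl⟩ := ha
    obtain ⟨s, rfl⟩ := hb
    exact ⟨r * s, by rw [smul_mul_smul_comm, one_mul]⟩
  | g i hi => omega
  | t j hj => omega

theorem yokoFamily_zero (d : ℕ) (u : K) : YokoFamily d u 0 (fun _ => (0 : K))
    (fun _ => (0 : K)) := by
  constructor <;> intros <;> omega

/-- The Markov trace on the tower of the Yokonuma-Hecke algebras, by recursion. -/
noncomputable def traceRec (d : ℕ) (u z : K) (x : ZMod d → K) : ∀ n, YokoAlg d u n →ₗ[K] K
  | 0 => (yokoFamily_zero d u).lift.toLinearMap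
  | n + 1 => extendTrace x z (traceRec d u z x n)

theorem traceRec_zero_one {z : K} {x : ZMod d → K} : traceRec d u z x 0 1 = 1 := by
  simp [traceRec]

variable [NeZero d] {x : ZMod d → K} {z : K}

theorem markovStep_traceRec : MarkovStep x z (traceRec d u z x n) (traceRec d u z x (n + 1)) :=
  markovStep_extendTrace x z _

theorem traceRec_comm [CharZero K] (n : ℕ) : ∀ a b : YokoAlg d u n,
    traceRec d u z x n (a * b) = traceRec d u z x n (b * a) := by
  induction n using Nat.strong_induction_on with
  | _ n ih =>
    match n with
    | 0 =>
      intro a b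
      obtain ⟨r, rfl⟩ := yoko_zero_eq_smul_one a
      rw [smul_mul_assoc, mul_smul_comm, one_mul, mul_one]
    | 1 =>
      have h : ∀ X : YokoAlg d u (0 + 1), Commute X (yt d u (0 + 1) 0) := by
        intro X
        induction X using yoko_span_induction with
        | add X Y hX hY => exact hX.add_left hY
        | smul r X hX => exact hX.smul_left r
        | framing a s => exact (commute_yt_yokoIncl a).symm.mul_left ((Commute.refl _).pow_left s)
        | braiding m h a b => omega
      intro a b
      refine congrArg _ (Commute.eq ?_)
      induction b using yoko_induction with
      | algebraMap r => exact (Algebra.commutes r a).symm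
      | add b b' hb hb' => exact hb.add_right hb'
      | mul b b' hb hb' => exact hb.mul_right hb'
      | g i hi => omega
      | t j hj =>
        obtain rfl : j = 0 := by omega
        exact h a
    | n + 2 =>
      exact MarkovStep.comm_succ (ih n (by omega)) (ih (n + 1) (by omega))
        (markovStep_traceRec (x := x) (z := z)) (markovStep_traceRec (x := x) (z := z))

end Trace

/-! ### Existence and uniqueness of the Markov traces -/

section Juyumaya

variable {d : ℕ} {u z : K} {x : ZMod d → K}

theorem yokoG_crossLast (n : ℕ) : yokoG d u (crossLast n) = yg d u (n + 2) n :=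
  (yg_of_lt (show n < n + 2 - 1 by omega)).symm

theorem yokoT_last (n : ℕ) : yokoT d u (Fin.last n) = yt d u (n + 1) n :=
  (yt_of_lt (show n < n + 1 by omega)).symm

variable [NeZero d]

theorem isJuyumayaTrace_traceRec [CharZero K] (hx : x 0 = 1) :
    IsJuyumayaTrace d u z x (traceRec d u z x) where
  incl _ a := markovStep_traceRec.incl hx a
  comm := traceRec_comm
  one n := by
    induction n with
    | zero => exact traceRec_zero_one
    | succ n ih => rw [← map_one (yokoIncl d u n), markovStep_traceRec.incl hx, ih]
  markov n a := by
    rw [yokoG_crossLast]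
    exact markovStep_traceRec.braiding_right a
  framing n a m _ _ := by
    rw [yokoT_last]
    exact markovStep_traceRec.framing a m

theorem isJuyumayaTrace_juyumayaTrace [CharZero K] (hx : x 0 = 1) :
    IsJuyumayaTrace d u z x (juyumayaTrace d u z x) := by
  have h : ∃ tr, IsJuyumayaTrace d u z x tr := ⟨_, isJuyumayaTrace_traceRec hx⟩
  rw [juyumayaTrace, dif_pos h]
  exact h.choose_spec

namespace IsJuyumayaTrace

variable {tr tr' : ∀ n, YokoAlg d u n →ₗ[K] K}

theorem markovStep (h : IsJuyumayaTrace d u z x tr) (hx : x 0 = 1) (n : ℕ) :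
    MarkovStep x z (tr n) (tr (n + 1)) where
  framing a s := by
    have hpow : yt d u (n + 1) n ^ s = yt d u (n + 1) n ^ (s % d) := by
      conv_lhs => rw [← Nat.mod_add_div s d]
      rw [pow_add, pow_mul, (yokoFamily d u (n + 1)).tpow n (by omega), one_pow, mul_one]
    rw [hpow, ← ZMod.natCast_mod s d]
    rcases Nat.eq_zero_or_pos (s % d) with h0 | h0
    · rw [h0, pow_zero, mul_one, Nat.cast_zero, hx, one_mul, h.incl]
    · rw [← yokoT_last]
      exact h.framing n a _ h0 (Nat.mod_lt _ (NeZero.pos d))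
  braiding hn a b := by
    obtain ⟨m, rfl⟩ : ∃ m, n = m + 1 := ⟨n - 1, by omega⟩
    have := h.markov m (b * a)
    rw [yokoG_crossLast, map_mul (yokoIncl d u (m + 1))] at this
    rw [h.comm, ← mul_assoc, h.comm _ a]
    exact this

theorem unique (h : IsJuyumayaTrace d u z x tr) (h' : IsJuyumayaTrace d u z x tr')
    (hx : x 0 = 1) (n : ℕ) : tr n = tr' n := by
  induction n with
  | zero =>
    ext a
    obtain ⟨r, rfl⟩ := yoko_zero_eq_smul_one a
    rw [map_smul, map_smul, h.one, h'.one]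
  | succ n ih =>
    ext a
    induction a using yoko_span_induction with
    | add a b ha hb => rw [map_add, map_add, ha, hb]
    | smul r a ha => rw [map_smul, map_smul, ha]
    | framing a s => rw [(h.markovStep hx n).framing, (h'.markovStep hx n).framing, ih]
    | braiding m hm a b =>
      rw [(h.markovStep hx n).braiding (by omega), (h'.markovStep hx n).braiding (by omega), ih]

end IsJuyumayaTrace

end Juyumaya

section Ocneanu

variable {q ζ : K}

theorem yokoE_one {n : ℕ} (i : Fin (n - 1)) : yokoE 1 q i = 1 := by
  have h := yokoT_pow 1 q (strandR i)
  rw [pow_one] at h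
  simp [yokoE, yokoIdem, h]

/-- For `d = 1` the Hecke algebra maps to the Yokonuma-Hecke algebra. -/
noncomputable def heckeToYoko (q : K) (n : ℕ) : HeckeAlg q n →ₐ[K] YokoAlg 1 q n :=
  RingQuot.liftAlgHom K ⟨FreeAlgebra.lift K (fun i => yokoG 1 q i), by
    rintro _ _ (⟨i, j, h⟩ | ⟨i, j, h⟩ | i)
    · simpa using yokoG_far 1 q i j h
    · simpa using yokoG_near 1 q i j h
    · have h := yokoG_sq 1 q i
      rw [yokoE_one] at h
      simp only [map_pow, FreeAlgebra.lift_ι_apply, map_add, map_smul, map_one, h, one_mul]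
      module⟩

/-- For `d = 1` the Yokonuma-Hecke algebra maps to the Hecke algebra. -/
noncomputable def yokoToHecke (q : K) (n : ℕ) : YokoAlg 1 q n →ₐ[K] HeckeAlg q n :=
  RingQuot.liftAlgHom K ⟨FreeAlgebra.lift K (fun
      | .g i => heckeG q i
      | .t _ => 1), by
    rintro _ _ (⟨i, j, h⟩ | ⟨i, j, h⟩ | ⟨i, j⟩ | ⟨i, j⟩ | j | i)
    · simpa using heckeG_far q i j h
    · simpa using heckeG_near q i j h
    · simp
    · simp
    · simp
    · simp only [map_pow, FreeAlgebra.lift_ι_apply, map_add, map_smul, map_one, map_mul,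
        heckeG_sq, map_yokoIdem]
      simp only [yokoIdem, Nat.cast_one, inv_one, range_one, sum_singleton, one_pow, one_smul,
        one_mul]
      module⟩

@[simp] theorem heckeToYoko_heckeG {n : ℕ} (i : Fin (n - 1)) :
    heckeToYoko q n (heckeG q i) = yokoG 1 q i := by
  rw [heckeG, heckeToYoko, RingQuot.liftAlgHom_mkAlgHom_apply]
  simp

@[simp] theorem yokoToHecke_yokoG {n : ℕ} (i : Fin (n - 1)) :
    yokoToHecke q n (yokoG 1 q i) = heckeG q i := by
  rw [yokoG, yokoToHecke, RingQuot.liftAlgHom_mkAlgHom_apply]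
  simp

@[simp] theorem yokoToHecke_yokoT {n : ℕ} (i : Fin n) :
    yokoToHecke q n (yokoT 1 q i) = 1 := by
  rw [yokoT, yokoToHecke, RingQuot.liftAlgHom_mkAlgHom_apply]
  simp

theorem hecke_algHom_ext {A : Type*} [Ring A] [Algebra K A] {n : ℕ} {f f' : HeckeAlg q n →ₐ[K] A}
    (h : ∀ i, f (heckeG q i) = f' (heckeG q i)) : f = f' := by
  refine RingQuot.ringQuot_ext' _ _ _ (FreeAlgebra.hom_ext (funext fun i => ?_))
  exact h i

theorem yoko_algHom_ext {d : ℕ} {u : K} {A : Type*} [Ring A] [Algebra K A] {n : ℕ}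
    {f f' : YokoAlg d u n →ₐ[K] A} (h : ∀ i, f (yokoG d u i) = f' (yokoG d u i))
    (h' : ∀ i, f (yokoT d u i) = f' (yokoT d u i)) : f = f' := by
  refine RingQuot.ringQuot_ext' _ _ _ (FreeAlgebra.hom_ext (funext fun i => ?_))
  cases i with
  | g i => exact h i
  | t i => exact h' i

@[simp] theorem heckeIncl_heckeG {n : ℕ} (i : Fin (n - 1)) :
    heckeIncl q n (heckeG q i) = heckeG q (crossSucc i) := by
  rw [heckeIncl, heckeG, RingQuot.liftAlgHom_mkAlgHom_apply]
  simp

@[simp] theorem yokoIncl_yokoG {d : ℕ} {u : K} {n : ℕ} (i : Fin (n - 1)) :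
    yokoIncl d u n (yokoG d u i) = yokoG d u (crossSucc i) := by
  rw [yokoIncl, yokoG, RingQuot.liftAlgHom_mkAlgHom_apply]
  simp

@[simp] theorem yokoIncl_yokoT {d : ℕ} {u : K} {n : ℕ} (i : Fin n) :
    yokoIncl d u n (yokoT d u i) = yokoT d u i.castSucc := by
  rw [yokoIncl, yokoT, RingQuot.liftAlgHom_mkAlgHom_apply]
  simp

theorem heckeToYoko_heckeIncl {n : ℕ} (h : HeckeAlg q n) :
    heckeToYoko q (n + 1) (heckeIncl q n h) = yokoIncl 1 q n (heckeToYoko q n h) := by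
  have : (heckeToYoko q (n + 1)).comp (heckeIncl q n)
      = (yokoIncl 1 q n).comp (heckeToYoko q n) := hecke_algHom_ext fun i => by simp
  exact DFunLike.congr_fun this h

theorem yokoToHecke_yokoIncl {n : ℕ} (h : YokoAlg 1 q n) :
    yokoToHecke q (n + 1) (yokoIncl 1 q n h) = heckeIncl q n (yokoToHecke q n h) := by
  have : (yokoToHecke q (n + 1)).comp (yokoIncl 1 q n)
      = (heckeIncl q n).comp (yokoToHecke q n) :=
    yoko_algHom_ext (fun i => by simp) (fun i => by simp)
  exact DFunLike.congr_fun this h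

theorem yokoToHecke_heckeToYoko {n : ℕ} (h : HeckeAlg q n) :
    yokoToHecke q n (heckeToYoko q n h) = h := by
  have : (yokoToHecke q n).comp (heckeToYoko q n) = AlgHom.id K _ :=
    hecke_algHom_ext fun i => by simp
  exact DFunLike.congr_fun this h

theorem isOcneanuTrace_comp_heckeToYoko {tr : ∀ n, YokoAlg 1 q n →ₗ[K] K}
    (h : IsJuyumayaTrace 1 q ζ (fun _ => 1) tr) :
    IsOcneanuTrace q ζ (fun n => tr n ∘ₗ (heckeToYoko q n).toLinearMap) where
  incl n a := by simp [heckeToYoko_heckeIncl, h.incl]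
  comm n a b := by simp [h.comm n (heckeToYoko q n a)]
  one n := by simp [h.one]
  markov n a := by simp [heckeToYoko_heckeIncl, h.markov]

theorem IsOcneanuTrace.isJuyumayaTrace {τ : ∀ n, HeckeAlg q n →ₗ[K] K}
    (h : IsOcneanuTrace q ζ τ) :
    IsJuyumayaTrace 1 q ζ (fun _ => 1) (fun n => τ n ∘ₗ (yokoToHecke q n).toLinearMap) where
  incl n a := by simp [yokoToHecke_yokoIncl, h.incl]
  comm n a b := by simp [h.comm n (yokoToHecke q n a)]
  one n := by simp [h.one]
  markov n a := by simp [yokoToHecke_yokoIncl, h.markov]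
  framing n a m h1 h2 := by omega

theorem isOcneanuTrace_ocneanuTrace [CharZero K] (q ζ : K) :
    IsOcneanuTrace q ζ (ocneanuTrace q ζ) := by
  have h : ∃ τ, IsOcneanuTrace q ζ τ :=
    ⟨_, isOcneanuTrace_comp_heckeToYoko (isJuyumayaTrace_traceRec (d := 1) rfl)⟩
  rw [ocneanuTrace, dif_pos h]
  exact h.choose_spec

theorem IsOcneanuTrace.unique {τ τ' : ∀ n, HeckeAlg q n →ₗ[K] K}
    (h : IsOcneanuTrace q ζ τ) (h' : IsOcneanuTrace q ζ τ') (n : ℕ) (a : HeckeAlg q n) :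
    τ n a = τ' n a := by
  have := h.isJuyumayaTrace.unique h'.isJuyumayaTrace rfl n
  have := DFunLike.congr_fun this (heckeToYoko q n a)
  simpa [yokoToHecke_heckeToYoko] using this

end Ocneanu

/-! ### The radical of a trace -/

section Radical

variable {A : Type*} [Ring A] [Algebra K A]

/-- Congruence modulo the radical of the bilinear form `(X, a) ↦ tr (X a)` of a trace `tr`. -/
def traceCon (tr : A →ₗ[K] K) (comm : ∀ a b, tr (a * b) = tr (b * a)) : RingCon A where
  r a b := ∀ X, tr (X * a) = tr (X * b)
  iseqv := ⟨fun _ _ => rfl, fun h X => (h X).symm, fun h h' X => (h X).trans (h' X)⟩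
  mul' {w x y z} h h' X := by
    rw [← mul_assoc, ← mul_assoc, comm _ y, ← mul_assoc, h, mul_assoc, comm, h']
  add' {w x y z} h h' X := by rw [mul_add, mul_add, map_add, map_add, h, h']

variable {tr : A →ₗ[K] K} {comm : ∀ a b, tr (a * b) = tr (b * a)}

theorem mk_traceCon_eq {a b : A} : (traceCon tr comm).mkₐ K a = (traceCon tr comm).mkₐ K b
    ↔ ∀ X, tr (X * a) = tr (X * b) :=
  RingCon.eq (traceCon tr comm)

/-- A trace factors through the quotient by its radical. -/
theorem exists_trace_quotient (comm : ∀ a b, tr (a * b) = tr (b * a)) :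
    ∃ f : (traceCon tr comm).Quotient →ₗ[K] K,
      ∀ a, f ((traceCon tr comm).mkₐ K a) = tr a := by
  obtain ⟨s, hs⟩ := ((traceCon tr comm).mkₐ K).toLinearMap.exists_rightInverse_of_surjective
    (LinearMap.range_eq_top.2 (RingCon.mkₐ_surjective (α := K) (traceCon tr comm)))
  refine ⟨tr ∘ₗ s, fun a => ?_⟩
  have h : (traceCon tr comm).mkₐ K (s ((traceCon tr comm).mkₐ K a))
    = (traceCon tr comm).mkₐ K a := DFunLike.congr_fun hs _
  simpa using mk_traceCon_eq.1 h 1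

end Radical

theorem braidLift_of {G : Type*} [Group G] {n : ℕ} (f : Fin (n - 1) → G) (far near)
    (i : Fin (n - 1)) : braidLift f far near (PresentedGroup.of i) = f i :=
  PresentedGroup.toGroup.of _

section Factor

variable {d : ℕ} {u z p : K} {x : ZMod d → K} {tr : ∀ n, YokoAlg d u n →ₗ[K] K}

/-- If the generators `g_i` satisfy the quadratic relation of `H_n(p)` modulo the radical of the
Juyumaya trace, then this trace is, on braids, the Ocneanu trace of `H_n(p)`. -/
theorem IsJuyumayaTrace.eq_ocneanuTrace [CharZero K] (h : IsJuyumayaTrace d u z x tr)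
    (hquad : ∀ n (i : Fin (n - 1)) X, tr n (X * yokoG d u i ^ 2)
      = tr n (X * ((p - 1) • yokoG d u i + p • 1)))
    (hu : u ≠ 0) (hp : p ≠ 0) (n : ℕ) (α : BraidGroup n) :
    tr n (yokoRep d hu n α : YokoAlg d u n)
      = ocneanuTrace p z n (heckeRep hp n α : HeckeAlg p n) := by
  let mk : ∀ n, YokoAlg d u n →ₐ[K] (traceCon (tr n) (h.comm n)).Quotient :=
    fun n => (traceCon (tr n) (h.comm n)).mkₐ K
  let φ : ∀ n, HeckeAlg p n →ₐ[K] (traceCon (tr n) (h.comm n)).Quotient := fun n =>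
    RingQuot.liftAlgHom K ⟨FreeAlgebra.lift K fun i => mk n (yokoG d u i), by
      rintro _ _ (⟨i, j, h⟩ | ⟨i, j, h⟩ | i)
      · simpa using congrArg (mk n) (yokoG_far d u i j h)
      · simpa using congrArg (mk n) (yokoG_near d u i j h)
      · have := mk_traceCon_eq (comm := h.comm n).2 (hquad n i)
        simp only [map_pow, FreeAlgebra.lift_ι_apply, map_add, map_smul, map_one] at this ⊢
        exact this⟩
  have hφG : ∀ n i, φ n (heckeG p i) = mk n (yokoG d u i) := by
    intro n i
    change RingQuot.liftAlgHom K _ (RingQuot.mkAlgHom K _ _) = _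
    rw [RingQuot.liftAlgHom_mkAlgHom_apply]
    simp
  choose f hf using fun n => exists_trace_quotient (h.comm n)
  have hmk : ∀ n (a : HeckeAlg p n), ∃ y : YokoAlg d u n,
      φ n a = mk n y ∧ φ (n + 1) (heckeIncl p n a) = mk (n + 1) (yokoIncl d u n y) := by
    intro n a
    obtain ⟨w, rfl⟩ := RingQuot.mkAlgHom_surjective K (HeckeRel p n) a
    refine ⟨FreeAlgebra.lift K (fun i => yokoG d u i) w, ?_, ?_⟩
    · have : (φ n).comp (RingQuot.mkAlgHom K (HeckeRel p n))
          = (mk n).comp (FreeAlgebra.lift K (fun i => yokoG d u i)) := by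
        refine FreeAlgebra.hom_ext (funext fun i => ?_)
        simp only [Function.comp_apply, AlgHom.coe_comp, FreeAlgebra.lift_ι_apply]
        exact hφG n i
      exact DFunLike.congr_fun this w
    · have : (φ (n + 1)).comp ((heckeIncl p n).comp (RingQuot.mkAlgHom K (HeckeRel p n)))
          = (mk (n + 1)).comp ((yokoIncl d u n).comp
            (FreeAlgebra.lift K (fun i => yokoG d u i))) := by
        refine FreeAlgebra.hom_ext (funext fun i => ?_)
        simp only [Function.comp_apply, AlgHom.coe_comp, FreeAlgebra.lift_ι_apply, yokoIncl_yokoG]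
        rw [← hφG, ← heckeIncl_heckeG]
        rfl
      exact DFunLike.congr_fun this w
  have hO : IsOcneanuTrace p z (fun n => f n ∘ₗ (φ n).toLinearMap) := by
    refine ⟨fun n a => ?_, fun n a b => ?_, fun n => ?_, fun n a => ?_⟩
    · obtain ⟨y, hy, hy'⟩ := hmk n a
      simp only [LinearMap.comp_apply, AlgHom.toLinearMap_apply, hy, hy']
      rw [hf, hf, h.incl]
    · obtain ⟨y, hy, -⟩ := hmk n a
      obtain ⟨y', hy', -⟩ := hmk n b
      simp only [LinearMap.comp_apply, AlgHom.toLinearMap_apply, hy, hy', map_mul]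
      rw [← map_mul, ← map_mul, hf, hf, h.comm]
    · simp only [LinearMap.comp_apply, AlgHom.toLinearMap_apply, map_one]
      rw [← map_one (mk n), hf, h.one]
    · obtain ⟨y, hy, hy'⟩ := hmk (n + 1) a
      simp only [LinearMap.comp_apply, AlgHom.toLinearMap_apply, hy, hy', map_mul, hφG]
      rw [← map_mul, hf, hf, h.markov]
  rw [(isOcneanuTrace_ocneanuTrace p z).unique hO]
  have hhom : (Units.map (MonoidHomClass.toMonoidHom (mk n))).comp (yokoRep d hu n)
      = (Units.map (MonoidHomClass.toMonoidHom (φ n))).comp (heckeRep hp n) := by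
    refine PresentedGroup.ext fun i => Units.ext ?_
    simp only [MonoidHom.comp_apply, yokoRep, heckeRep, braidLift_of, Units.coe_map]
    exact (hφG n i).symm
  have := congrArg Units.val (DFunLike.congr_fun hhom α)
  simp only [MonoidHom.comp_apply, Units.coe_map] at this
  rw [← hf]
  exact congrArg (f n) this

theorem deltaInv_eq_homflypt [NeZero d] [CharZero K] (hx : x 0 = 1)
    (hquad : ∀ n (i : Fin (n - 1)) X, juyumayaTrace d u z x n (X * yokoG d u i ^ 2)
      = juyumayaTrace d u z x n (X * ((p - 1) • yokoG d u i + p • 1)))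
    (hu : u ≠ 0) (hp : p ≠ 0) (r : K) {n : ℕ} (α : BraidGroup n) :
    deltaInv x hu z r α = homflypt hp z r α := by
  rw [deltaInv, homflypt, (isJuyumayaTrace_juyumayaTrace hx).eq_ocneanuTrace hquad hu hp]
  rfl

/-- The radical of the trace on `Y_n` is contained in that of the trace on `Y_{n+1}`. -/
theorem MarkovStep.radical {n : ℕ} {T : YokoAlg d u (n + 1) →ₗ[K] K} {t : YokoAlg d u n →ₗ[K] K}
    (hT : MarkovStep x z t T) {y : YokoAlg d u n} (hy : ∀ X, t (X * y) = 0)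
    (X : YokoAlg d u (n + 1)) : T (X * yokoIncl d u n y) = 0 := by
  induction X using yoko_span_induction with
  | add X Y hX hY => rw [add_mul, map_add, hX, hY, add_zero]
  | smul r X hX => rw [smul_mul_assoc, map_smul, hX, smul_zero]
  | framing a s =>
    rw [mul_assoc, ((commute_yt_yokoIncl y).pow_left s).eq, ← mul_assoc, ← map_mul, hT.framing, hy,
      mul_zero]
  | braiding m h a b =>
    rw [mul_assoc, ← map_mul, hT.braiding (by omega), ← mul_assoc, hy, mul_zero]

/-- An element of `Y_m` in the radical of the trace stays in the radical in all `Y_n`: the case of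
elements given by polynomials in the generators. -/
theorem IsJuyumayaTrace.radical [NeZero d] (h : IsJuyumayaTrace d u z x tr) (hx : x 0 = 1)
    {y : ∀ n, YokoAlg d u n} {m : ℕ} (hy : ∀ X, tr m (X * y m) = 0)
    (hyi : ∀ n, m ≤ n → yokoIncl d u n (y n) = y (n + 1)) (n : ℕ) (hn : m ≤ n) :
    ∀ X, tr n (X * y n) = 0 := by
  induction n, hn using Nat.le_induction with
  | base => exact hy
  | succ n hmn ih =>
    rw [← hyi n hmn]
    exact (h.markovStep hx n).radical ih

end Factor

/-! ### Solutions of the E-system -/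

section ESystem

variable {d : ℕ} [NeZero d] {x : ZMod d → K}

theorem sum_range_eq_sum_zmod (x y : ZMod d → K) :
    ∑ j ∈ range d, x ((d - j : ℕ) : ZMod d) * y j = ∑ s : ZMod d, y s * x (-s) := by
  rw [← Fin.sum_univ_eq_sum_range (fun j => x ((d - j : ℕ) : ZMod d) * y (j : ZMod d))]
  obtain ⟨e, rfl⟩ : ∃ e, d = e + 1 := ⟨d - 1, by have := NeZero.ne d; omega⟩
  refine Fintype.sum_congr _ _ fun (j : ZMod (e + 1)) => ?_
  change x ((e + 1 - ZMod.val j : ℕ) : ZMod (e + 1)) * y ((ZMod.val j : ℕ) : ZMod (e + 1))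
    = y j * x (-j)
  rw [Nat.cast_sub (ZMod.val_lt j).le, ZMod.natCast_zmod_val, ZMod.natCast_self, zero_sub, mul_comm]

theorem IsESolution.sum_eq [CharZero K] (hx : IsESolution x) (m : ZMod d) :
    ∑ s : ZMod d, x (m + s) * x (-s) = d * paramE x * x m := by
  have hd : (d : K) ≠ 0 := Nat.cast_ne_zero.2 (NeZero.ne d)
  rw [paramE, mul_inv_cancel_left₀ hd, mul_comm]
  by_cases hm : m = 0
  · simp [hm, hx.1]
  · exact hx.2 m hm

/-- The E-system says that the circulant matrix with entries `x (i - j) / (d E)` is an idempotent;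
its trace `1 / E` is therefore its rank. -/
theorem IsESolution.exists_idempotent [CharZero K] (hx : IsESolution x) (hE : paramE x ≠ 0) :
    ∃ f : (ZMod d → K) →ₗ[K] ZMod d → K, IsIdempotentElem f ∧
      (Module.finrank K (LinearMap.range f) : K) * paramE x = 1 ∧
      ∀ j i, f (Pi.single j 1) i = (d * paramE x)⁻¹ * x (i - j) := by
  have hd : (d : K) ≠ 0 := Nat.cast_ne_zero.2 (NeZero.ne d)
  have hdE : (d : K) * paramE x ≠ 0 := mul_ne_zero hd hE
  let M : Matrix (ZMod d) (ZMod d) K := Matrix.of fun i j => (d * paramE x)⁻¹ * x (i - j)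
  have hM : M * M = M := by
    ext i k
    rw [Matrix.mul_apply]
    simp only [M, Matrix.of_apply]
    rw [← Equiv.sum_comp (Equiv.addRight k), ← Equiv.sum_comp (Equiv.neg (ZMod d))]
    have h := hx.sum_eq (i - k)
    calc ∑ s : ZMod d, (d * paramE x)⁻¹ * x (i - (-s + k)) * ((d * paramE x)⁻¹ * x (-s + k - k))
        = (d * paramE x)⁻¹ * ((d * paramE x)⁻¹ * ∑ s : ZMod d, x (i - k + s) * x (-s)) := by
          rw [mul_sum, mul_sum]
          refine sum_congr rfl fun s _ => ?_
          rw [show i - (-s + k) = i - k + s by ring, show -s + k - k = -s by ring]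
          ring
      _ = _ := by rw [h]; field_simp
  have hf : IsIdempotentElem (Matrix.toLin' M) := by
    rw [IsIdempotentElem, Module.End.mul_eq_comp, ← Matrix.toLin'_mul, hM]
  refine ⟨Matrix.toLin' M, hf, ?_, fun j i => ?_⟩
  · have h1 : LinearMap.trace K _ (Matrix.toLin' M) = Module.finrank K
        (LinearMap.range (Matrix.toLin' M)) :=
      LinearMap.IsIdempotentElem.isProj_range _ hf |>.trace
    rw [← h1, Matrix.trace_toLin'_eq, Matrix.trace]
    simp only [M, Matrix.diag_apply, Matrix.of_apply, sub_self, hx.1, mul_one, sum_const, card_univ,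
      ZMod.card, nsmul_eq_mul]
    field_simp
  · simp [M]

theorem IsESolution.paramE_ne_neg_one [CharZero K] (hx : IsESolution x) : paramE x ≠ -1 := by
  intro h
  obtain ⟨f, -, hf, -⟩ := hx.exists_idempotent (by rw [h]; simp)
  rw [h] at hf
  have : ((Module.finrank K (LinearMap.range f) + 1 : ℕ) : K) = 0 := by
    push_cast
    linear_combination -hf
  exact Nat.succ_ne_zero _ (Nat.cast_eq_zero.1 this)

/-- For `E = 1` the circulant matrix of `x` has rank one, so that `x` is a character. -/
theorem IsESolution.add_one [CharZero K] (hx : IsESolution x) (hE : paramE x = 1) (m : ZMod d) :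
    x (m + 1) = x 1 * x m := by
  obtain ⟨f, -, hf, hfx⟩ := hx.exists_idempotent (by rw [hE]; simp)
  have hd : (d : K) ≠ 0 := Nat.cast_ne_zero.2 (NeZero.ne d)
  rw [hE, mul_one] at hf
  simp only [hE, mul_one] at hfx
  have hv : (⟨f (Pi.single 0 1), _, rfl⟩ : LinearMap.range f) ≠ 0 := by
    intro h
    have := congrFun (congrArg Subtype.val h) 0
    simp only [hfx, sub_zero, hx.1, mul_one] at this
    exact inv_ne_zero hd this
  obtain ⟨c, hc⟩ := (finrank_eq_one_iff_of_nonzero' _ hv).1 (by exact_mod_cast hf)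
    ⟨f (Pi.single 1 1), _, rfl⟩
  have hc' : ∀ i, c * x i = x (i - 1) := fun i => by
    have := congrFun (congrArg Subtype.val hc) i
    simp only [Submodule.coe_smul, Pi.smul_apply, smul_eq_mul, hfx, sub_zero] at this
    refine mul_left_cancel₀ (inv_ne_zero hd) ?_
    rw [← this]
    ring
  have h1 := hc' 1
  rw [sub_self, hx.1] at h1
  have h2 := hc' (m + 1)
  rw [add_sub_cancel_right] at h2
  rw [← h2, ← mul_assoc, mul_comm (x 1), h1, one_mul]

theorem IsESolution.pow [CharZero K] (hx : IsESolution x) (hE : paramE x = 1) (m : ℕ) :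
    x m = x 1 ^ m := by
  induction m with
  | zero => simp [hx.1]
  | succ m ih => rw [Nat.cast_succ, hx.add_one hE, ih, pow_succ']

end ESystem

/-! ### Elements of the radical of the Juyumaya trace -/

section RadicalElements

variable {d : ℕ} {u z : K} {x : ZMod d → K} {n : ℕ}

theorem pow_mul_lastE (s : ℕ) : yt d u (n + 2) (n + 1) ^ s * lastE d u n
    = yokoIncl d u (n + 1) (yt d u (n + 1) n) ^ s * lastE d u n := by
  have hf := yokoFamily d u (n + 2)
  rw [lastE, yokoIncl_yt (by omega)]
  exact (pow_mul_yokoIdem (hf.tt _ _ (by omega) (by omega)) (hf.tpow _ (by omega))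
    (hf.tpow _ (by omega)) s).symm

theorem lastE_mul_lastE [CharZero K] : lastE d u n * lastE d u n = lastE d u n := by
  have hf := yokoFamily d u (n + 2)
  rw [lastE, yokoIncl_yt (by omega)]
  exact yokoIdem_sq (hf.tt _ _ (by omega) (by omega)) (hf.tpow _ (by omega))
    (hf.tpow _ (by omega))

theorem yg_mul_lastE : yg d u (n + 2) n * lastE d u n = lastE d u n * yg d u (n + 2) n := by
  conv_rhs => rw [lastE_eq_swap]
  refine mul_yokoIdem_of_semiconj ?_ ?_
  · simpa using (yt_pow_mul_yg (d := d) (u := u) (n := n) 1).symm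
  · simpa using (yokoIncl_yt_pow_mul_yg (d := d) (u := u) (n := n) 1).symm

/-- The element `h = e (1 + g)` of `Y_{n+2}`, where `g` is the last braiding generator and `e` the
idempotent in its quadratic relation `g² = 1 + (u - 1) h`. -/
noncomputable def lastH (d : ℕ) (u : K) (n : ℕ) : YokoAlg d u (n + 2) :=
  lastE d u n + lastE d u n * yg d u (n + 2) n

theorem yg_mul_self_eq_lastH :
    yg d u (n + 2) n * yg d u (n + 2) n = 1 + (u - 1) • lastH d u n := by
  rw [yg_mul_self, lastH, smul_add, smul_mul_assoc, add_assoc]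

theorem lastH_mul_yg [CharZero K] : lastH d u n * yg d u (n + 2) n = u • lastH d u n := by
  rw [lastH, add_mul, mul_assoc, yg_mul_self_eq_lastH, lastH]
  simp only [mul_add, mul_one, mul_smul_comm, ← mul_assoc, lastE_mul_lastE]
  module

theorem yg_mul_lastH [CharZero K] : yg d u (n + 2) n * lastH d u n = u • lastH d u n := by
  rw [← lastH_mul_yg, lastH, mul_add, add_mul, ← mul_assoc, yg_mul_lastE]

theorem commute_lastH_yokoIncl (c : YokoAlg d u n) :
    Commute (lastH d u n) (yokoIncl d u (n + 1) (yokoIncl d u n c)) := by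
  have he : Commute (yokoIncl d u (n + 1) (yokoIncl d u n c)) (lastE d u n) := by
    refine Commute.yokoIdem_right ?_ (commute_yt_yokoIncl _).symm
    rw [Commute, SemiconjBy, ← map_mul, ← map_mul, (commute_yt_yokoIncl c).eq]
  exact (he.add_right (he.mul_right (commute_yg_yokoIncl c).symm)).symm

theorem yg_mul_yokoIncl_yg_mul_lastH : yg d u (n + 3) (n + 1)
      * yokoIncl d u (n + 2) (yg d u (n + 2) n) * lastH d u (n + 1)
    = yokoIncl d u (n + 2) (lastH d u n) * (yg d u (n + 3) (n + 1)
      * yokoIncl d u (n + 2) (yg d u (n + 2) n)) := by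
  have he : yg d u (n + 3) (n + 1) * yokoIncl d u (n + 2) (yg d u (n + 2) n) * lastE d u (n + 1)
      = yokoIncl d u (n + 2) (lastE d u n) * (yg d u (n + 3) (n + 1)
      * yokoIncl d u (n + 2) (yg d u (n + 2) n)) := by
    rw [lastE, lastE, map_yokoIdem]
    refine mul_yokoIdem_of_semiconj ?_ ?_
    · have h1 := yokoIncl_yt_pow_mul_yg (d := d) (u := u) (n := n) 1
      rw [pow_one, pow_one] at h1
      rw [mul_assoc, ← map_mul, ← h1, map_mul, ← mul_assoc, (commute_yg_yokoIncl _).eq, mul_assoc]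
    · have h1 := yokoIncl_yt_pow_mul_yg (d := d) (u := u) (n := n + 1) 1
      rw [pow_one, pow_one] at h1
      rw [mul_assoc, ← (commute_yt_yokoIncl _).eq, ← mul_assoc, ← h1, mul_assoc]
  simp only [lastH, mul_add, map_add, add_mul, map_mul, he]
  rw [← mul_assoc _ (lastE d u (n + 1)), he]
  simp only [mul_assoc]
  congr 2
  simpa only [mul_assoc] using yg_yokoIncl_yg

theorem yt_pow_mul_lastH (s : ℕ) : yt d u (n + 2) (n + 1) ^ s * lastH d u n
    = yokoIncl d u (n + 1) (yt d u (n + 1) n ^ s) * lastH d u n := by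
  rw [lastH, mul_add, ← mul_assoc, pow_mul_lastE, map_pow, mul_add, mul_assoc]

variable [NeZero d] {tr : ∀ n, YokoAlg d u n →ₗ[K] K}

/-- For a solution of the E-system, `e` may be removed from the trace at the cost of `E`. -/
theorem IsJuyumayaTrace.yokoIncl_mul_lastE [CharZero K] (h : IsJuyumayaTrace d u z x tr)
    (hx : IsESolution x) (n : ℕ) (a : YokoAlg d u (n + 1)) :
    tr (n + 2) (yokoIncl d u (n + 1) a * lastE d u n) = paramE x * tr (n + 1) a := by
  have hd : (d : K) ≠ 0 := Nat.cast_ne_zero.2 (NeZero.ne d)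
  have hT := fun n => h.markovStep hx.1 n
  have key : ∀ n (a : YokoAlg d u (n + 1)), tr (n + 2) (yokoIncl d u (n + 1) a * lastE d u n)
      = (d : K)⁻¹ * ∑ j ∈ range d, x (d - j : ℕ) * tr (n + 1) (a * yt d u (n + 1) n ^ j) := by
    intro n a
    simpa using (hT (n + 1)).framing_lastE a 0
  induction n using Nat.strong_induction_on with
  | _ n ih =>
    induction a using yoko_span_induction with
    | add a b ha hb => rw [map_add, add_mul, map_add, map_add, ha, hb, mul_add]
    | smul r a ha => rw [map_smul, smul_mul_assoc, map_smul, map_smul, ha, smul_eq_mul, smul_eq_mul,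
        mul_left_comm]
    | framing b s =>
      rw [key]
      have := sum_range_eq_sum_zmod x (fun j => x (s + j) * tr n b)
      simp only [mul_assoc, ← pow_add, (hT n).framing, Nat.cast_add]
      rw [this]
      simp only [mul_right_comm _ (tr n b), ← sum_mul, hx.sum_eq]
      field_simp
    | braiding m hm b c =>
      subst hm
      rw [key]
      change (d : K)⁻¹ * ∑ j ∈ range d, x (d - j : ℕ) * tr (m + 2) (yokoIncl d u (m + 1) b
          * yg d u (m + 2) m * yokoIncl d u (m + 1) c * yt d u (m + 2) (m + 1) ^ j)
        = paramE x * tr (m + 2) (yokoIncl d u (m + 1) b * yg d u (m + 2) m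
          * yokoIncl d u (m + 1) c)
      rw [(hT (m + 1)).braiding' b c, h.comm _ b, mul_left_comm, ← ih m (by omega), key,
        mul_left_comm]
      congr 1
      rw [mul_sum]
      refine sum_congr rfl fun j _ => ?_
      rw [mul_left_comm, mul_assoc, ← ((commute_yt_yokoIncl c).pow_left j).eq,
        ← mul_assoc, mul_assoc _ _ (yt d u (m + 2) (m + 1) ^ j)]
      have h1 := yokoIncl_yt_pow_mul_yg (d := d) (u := u) (n := m) j
      rw [← map_pow] at h1
      rw [← h1]
      rw [← mul_assoc, ← map_mul, (hT (m + 1)).braiding', h.comm _ _ c, mul_assoc c]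

theorem IsJuyumayaTrace.yokoIncl_mul_lastH [CharZero K] (h : IsJuyumayaTrace d u z x tr)
    (hx : IsESolution x) (n : ℕ) (a : YokoAlg d u (n + 1)) :
    tr (n + 2) (yokoIncl d u (n + 1) a * lastH d u n) = (paramE x + z) * tr (n + 1) a := by
  have := (h.markovStep hx.1 (n + 1)).framing_lastE_mul_yg a 0
  simp only [pow_zero, mul_one] at this
  rw [lastH, mul_add, map_add, h.yokoIncl_mul_lastE hx, ← mul_assoc, this, add_mul]

/-- For `z = -E` the elements `e_i (1 + g_i)` lie in the radical of the trace. -/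
theorem IsJuyumayaTrace.mul_lastH_eq_zero [CharZero K] (h : IsJuyumayaTrace d u z x tr)
    (hx : IsESolution x) (hz : z = -paramE x) (n : ℕ) (X : YokoAlg d u (n + 2)) :
    tr (n + 2) (X * lastH d u n) = 0 := by
  have hT := fun n => h.markovStep hx.1 n
  have h0 : ∀ n a, tr (n + 2) (yokoIncl d u (n + 1) a * lastH d u n) = 0 := fun n a => by
    rw [h.yokoIncl_mul_lastH hx, hz, add_neg_cancel, zero_mul]
  have hframing : ∀ n a c s, tr (n + 2) (yokoIncl d u (n + 1) a * yg d u (n + 2) n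
      * yokoIncl d u (n + 1) (yokoIncl d u n c * yt d u (n + 1) n ^ s) * lastH d u n) = 0 := by
    intro n a c s
    rw [map_mul (yokoIncl d u (n + 1)), mul_assoc, mul_assoc, mul_assoc, ← yt_pow_mul_lastH,
      ← mul_assoc (yg d u _ _),
      (commute_yg_yokoIncl c).eq, mul_assoc, ← mul_assoc (yg d u _ _), ← yokoIncl_yt_pow_mul_yg,
      mul_assoc, yg_mul_lastH, mul_smul_comm, mul_smul_comm, mul_smul_comm, map_smul, ← map_pow,
      ← mul_assoc, ← mul_assoc, ← map_mul, ← map_mul, h0, smul_zero]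
  induction n using Nat.strong_induction_on with
  | _ n ih =>
    induction X using yoko_span_induction with
    | add a b ha hb => rw [add_mul, map_add, ha, hb, add_zero]
    | smul r a ha => rw [smul_mul_assoc, map_smul, ha, smul_zero]
    | framing a s => rw [mul_assoc, yt_pow_mul_lastH, ← mul_assoc, ← map_mul, h0]
    | braiding m hm a b =>
      clear hm
      induction b using yoko_span_induction with
      | add b c hb hc => rw [map_add, mul_add, add_mul, map_add, hb, hc, add_zero]
      | smul r b hb => rw [map_smul, mul_smul_comm, smul_mul_assoc, map_smul, hb, smul_zero]
      | framing c s => exact hframing n a c s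
      | braiding k hk c c' =>
        subst hk
        have e : yokoIncl d u (k + 2) a * yg d u (k + 3) (k + 1) * yokoIncl d u (k + 2)
              (yokoIncl d u (k + 1) c * yg d u (k + 2) k * yokoIncl d u (k + 1) c')
              * lastH d u (k + 1)
            = yokoIncl d u (k + 2) (a * yokoIncl d u (k + 1) c * lastH d u k)
              * yg d u (k + 3) (k + 1)
              * yokoIncl d u (k + 2) (yg d u (k + 2) k * yokoIncl d u (k + 1) c') := by
          have e1 := yg_mul_yokoIncl_yg_mul_lastH (d := d) (u := u) (n := k)
          rw [mul_assoc] at e1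
          simp only [map_mul, mul_assoc]
          rw [← (commute_lastH_yokoIncl c').eq, ← mul_assoc (yg d u (k + 3) (k + 1)),
            (commute_yg_yokoIncl c).eq, ← mul_assoc _ (lastH d u (k + 1)), mul_assoc,
            ← mul_assoc (yg d u (k + 3) (k + 1)), e1]
          simp only [mul_assoc]
        refine (congrArg (tr (k + 3)) e).trans ?_
        rw [(hT (k + 2)).braiding', h.comm, ← mul_assoc, ih k (by omega), mul_zero]

/-- For `E = 1` the framing generators act on the trace by the scalar `x_1`. -/
theorem IsJuyumayaTrace.mul_yt_last [CharZero K] (h : IsJuyumayaTrace d u z x tr)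
    (hx : IsESolution x) (hE : paramE x = 1) (n : ℕ) (X : YokoAlg d u (n + 1)) :
    tr (n + 1) (X * yt d u (n + 1) n) = x 1 * tr (n + 1) X := by
  have hT := fun n => h.markovStep hx.1 n
  induction n using Nat.strong_induction_on with
  | _ n ih =>
    induction X using yoko_span_induction with
    | add a b ha hb => rw [add_mul, map_add, map_add, ha, hb, mul_add]
    | smul r a ha => rw [smul_mul_assoc, map_smul, map_smul, ha, smul_eq_mul, smul_eq_mul,
        mul_left_comm]
    | framing a s => rw [mul_assoc, ← pow_succ, (hT _).framing, (hT _).framing, Nat.cast_succ,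
        hx.add_one hE, mul_assoc]
    | braiding m hm a b =>
      subst hm
      have h1 := yokoIncl_yt_pow_mul_yg (d := d) (u := u) (n := m) 1
      rw [pow_one, pow_one] at h1
      have e : yokoIncl d u (m + 1) a * yg d u (m + 2) m * yokoIncl d u (m + 1) b
          * yt d u (m + 2) (m + 1)
          = yokoIncl d u (m + 1) (a * yt d u (m + 1) m) * yg d u (m + 2) m
            * yokoIncl d u (m + 1) b := by
        rw [mul_assoc, ← (commute_yt_yokoIncl b).eq, ← mul_assoc, mul_assoc _ (yg d u _ _), ← h1,
          map_mul, ← mul_assoc (yokoIncl d u (m + 1) a)]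
      refine (congrArg (tr (m + 2)) e).trans ?_
      rw [(hT (m + 1)).braiding']
      refine Eq.trans ?_ (congrArg _ ((hT (m + 1)).braiding' a b).symm)
      rw [h.comm, ← mul_assoc, ih m (by omega), h.comm, mul_left_comm]

theorem IsJuyumayaTrace.mul_lastE_eq [CharZero K] (h : IsJuyumayaTrace d u z x tr)
    (hx : IsESolution x) (hE : paramE x = 1) (n : ℕ) (X : YokoAlg d u (n + 2)) :
    tr (n + 2) (X * lastE d u n) = tr (n + 2) X := by
  have hd : (d : K) ≠ 0 := Nat.cast_ne_zero.2 (NeZero.ne d)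
  have h1 : ∀ (k : ℕ) (X : YokoAlg d u (n + 2)),
      tr (n + 2) (X * yt d u (n + 2) (n + 1) ^ k) = x 1 ^ k * tr (n + 2) X := by
    intro k
    induction k with
    | zero => simp
    | succ k ih =>
      intro X
      rw [pow_succ, ← mul_assoc, h.mul_yt_last hx hE, ih, pow_succ', mul_assoc]
  have h2' : ∀ X : YokoAlg d u (n + 2),
      tr (n + 2) (X * yokoIncl d u (n + 1) (yt d u (n + 1) n)) = x 1 * tr (n + 2) X := by
    intro X
    have := (h.markovStep hx.1 (n + 1)).radical (y := yt d u (n + 1) n - x 1 • 1) (fun X => by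
      rw [mul_sub, map_sub, h.mul_yt_last hx hE, mul_smul_comm, mul_one, map_smul, smul_eq_mul,
        sub_self]) X
    rwa [map_sub, map_smul, map_one, mul_sub, map_sub, mul_smul_comm, mul_one, map_smul,
      smul_eq_mul, sub_eq_zero] at this
  have h2 : ∀ (k : ℕ) (X : YokoAlg d u (n + 2)),
      tr (n + 2) (X * yokoIncl d u (n + 1) (yt d u (n + 1) n) ^ k) = x 1 ^ k * tr (n + 2) X := by
    intro k
    induction k with
    | zero => simp
    | succ k ih =>
      intro X
      rw [pow_succ, ← mul_assoc, h2', ih, pow_succ', mul_assoc]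
  have := trace_mul_lastE_mul (tr (n + 2)) X 1
  rw [mul_one] at this
  rw [this, sum_congr rfl (g := fun _ => tr (n + 2) X)]
  · rw [sum_const, card_range, nsmul_eq_mul, inv_mul_cancel_left₀ hd]
  · intro j hj
    rw [mul_one, ← mul_assoc, h1, h2, ← mul_assoc, ← pow_add,
      Nat.sub_add_cancel (mem_range.1 hj).le, ← hx.pow hE, ZMod.natCast_self, hx.1, one_mul]

/-! ### The quadratic relation modulo the radical -/

/-- A quadratic relation for the last generators `g` modulo the radical extends to all `g_i`. -/
theorem IsJuyumayaTrace.quad_of_last {p : K} (h : IsJuyumayaTrace d u z x tr) (hx : x 0 = 1)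
    (hlast : ∀ n X, tr (n + 2) (X * (yg d u (n + 2) n * yg d u (n + 2) n))
      = (p - 1) * tr (n + 2) (X * yg d u (n + 2) n) + p * tr (n + 2) X)
    (n : ℕ) (i : Fin (n - 1)) (X : YokoAlg d u n) : tr n (X * yokoG d u i ^ 2)
      = tr n (X * ((p - 1) • yokoG d u i + p • 1)) := by
  have hi := i.2
  have key := h.radical hx (m := i + 2)
    (y := fun n => yg d u n i * yg d u n i - ((p - 1) • yg d u n i + p • 1))
    (fun X => by
      rw [mul_sub, map_sub, hlast, mul_add, mul_smul_comm, mul_smul_comm, map_add, map_smul,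
        map_smul, mul_one, smul_eq_mul, smul_eq_mul, sub_self])
    (fun n hn => by
      rw [map_sub, map_mul, map_add, map_smul, map_smul, map_one, yokoIncl_yg (by omega)])
    n (by omega) X
  rw [mul_sub, map_sub, sub_eq_zero, yg_of_lt hi] at key
  rw [pow_two]
  exact key

theorem IsJuyumayaTrace.quad_of_u_eq_one [CharZero K] (h : IsJuyumayaTrace d u z x tr)
    (hx : x 0 = 1) (hu : u = 1) (n : ℕ) (i : Fin (n - 1)) (X : YokoAlg d u n) :
    tr n (X * yokoG d u i ^ 2) = tr n (X * (((1 : K) - 1) • yokoG d u i + (1 : K) • 1)) := by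
  refine h.quad_of_last hx (fun n X => ?_) n i X
  rw [yg_mul_self_eq_lastH]
  simp [hu]

theorem IsJuyumayaTrace.quad_of_z_eq_neg [CharZero K] (h : IsJuyumayaTrace d u z x tr)
    (hx : IsESolution x) (hz : z = -paramE x) (n : ℕ) (i : Fin (n - 1)) (X : YokoAlg d u n) :
    tr n (X * yokoG d u i ^ 2) = tr n (X * (((1 : K) - 1) • yokoG d u i + (1 : K) • 1)) := by
  refine h.quad_of_last hx.1 (fun n X => ?_) n i X
  rw [yg_mul_self_eq_lastH, mul_add, map_add, mul_smul_comm, map_smul, h.mul_lastH_eq_zero hx hz]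
  simp

theorem IsJuyumayaTrace.quad_of_paramE_eq_one [CharZero K] (h : IsJuyumayaTrace d u z x tr)
    (hx : IsESolution x) (hE : paramE x = 1) (n : ℕ) (i : Fin (n - 1)) (X : YokoAlg d u n) :
    tr n (X * yokoG d u i ^ 2) = tr n (X * ((u - 1) • yokoG d u i + u • 1)) := by
  refine h.quad_of_last hx.1 (fun n X => ?_) n i X
  rw [yg_mul_self, mul_add, mul_add, mul_one, map_add, map_add, smul_mul_assoc, mul_smul_comm,
    mul_smul_comm, map_smul, map_smul, h.mul_lastE_eq hx hE, ← yg_mul_lastE, ← mul_assoc,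
    h.mul_lastE_eq hx hE, smul_eq_mul, smul_eq_mul]
  ring

end RadicalElements

/-! ### Symmetry and degenerations of the HOMFLYPT polynomial -/

section Homflypt

theorem expSum_mul {n : ℕ} (α β : BraidGroup n) : expSum (α * β) = expSum α + expSum β := by
  simp [expSum]

theorem expSum_of {n : ℕ} (i : Fin (n - 1)) : expSum (PresentedGroup.of i : BraidGroup n) = 1 := by
  rw [expSum, braidLift_of, toAdd_ofAdd]

variable {q ζ : K}

/-- An algebra map of `H_n(q)` that takes the generators to multiples `c H_i` of units `H_i` that
satisfy the braid relations takes `π(α)` to `c ^ ε(α)` times the image of `α` under `σ_i ↦ H_i`. -/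
theorem map_heckeRep (hq : q ≠ 0) {n : ℕ} {A : Type*} [Ring A] [Algebra K A]
    (φ : HeckeAlg q n →ₐ[K] A) {c : K} (hc : c ≠ 0) (ρ : BraidGroup n →* Aˣ)
    (h : ∀ i, φ (heckeG q i) = c • (ρ (PresentedGroup.of i) : A)) (α : BraidGroup n) :
    φ (heckeRep hq n α : HeckeAlg q n) = c ^ expSum α • (ρ α : A) := by
  let k : Kˣ →* Aˣ := Units.map (MonoidHomClass.toMonoidHom (algebraMap K A))
  have hk : ∀ (y : Kˣ) (w : Aˣ), k y * w = w * k y := fun y w =>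
    Units.ext (Algebra.commutes (y : K) (w : A))
  let F : BraidGroup n →* Aˣ := MonoidHom.mk' (fun α => k (Units.mk0 c hc ^ expSum α) * ρ α)
    fun α β => by
      rw [expSum_mul, zpow_add, map_mul, map_mul, mul_assoc, mul_assoc, ← mul_assoc _ (ρ α),
        hk _ (ρ α), mul_assoc]
  have hF : (Units.map (MonoidHomClass.toMonoidHom φ)).comp (heckeRep hq n) = F := by
    refine PresentedGroup.ext fun i => Units.ext ?_
    simp only [MonoidHom.comp_apply, heckeRep, braidLift_of, F, MonoidHom.mk'_apply, expSum_of,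
      zpow_one]
    rw [Units.val_mul]
    exact (h i).trans (Algebra.smul_def _ _)
  have := congrArg Units.val (DFunLike.congr_fun hF α)
  refine this.trans ?_
  rw [Algebra.smul_def]
  simp only [F, MonoidHom.mk'_apply, Units.val_mul, k]
  congr 1
  rw [Units.coe_map]
  exact congrArg (algebraMap K A) (by rw [Units.val_zpow_eq_zpow_val, Units.val_mk0])

/-- The isomorphism `H_n(q) → H_n(q⁻¹)`, `G_i ↦ -q G_i`. -/
noncomputable def heckeSymm (q : K) {q' : K} (h : q * q' = 1) (n : ℕ) :
    HeckeAlg q n →ₐ[K] HeckeAlg q' n :=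
  RingQuot.liftAlgHom K ⟨FreeAlgebra.lift K (fun i => (-q) • heckeG q' i), by
    rintro _ _ (⟨i, j, hij⟩ | ⟨i, j, hij⟩ | i)
    · simp only [map_mul, FreeAlgebra.lift_ι_apply, smul_mul_smul_comm, heckeG_far q' i j hij]
    · simp only [map_mul, FreeAlgebra.lift_ι_apply, smul_mul_smul_comm, heckeG_near q' i j hij]
    · simp only [map_pow, FreeAlgebra.lift_ι_apply, map_add, map_smul, map_one, smul_pow,
        heckeG_sq q' i]
      match_scalars <;> linear_combination q * h⟩

theorem heckeSymm_heckeG {q' : K} (h : q * q' = 1) {n : ℕ} (i : Fin (n - 1)) :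
    heckeSymm q h n (heckeG q i) = (-q) • heckeG q' i := by
  rw [heckeG, heckeSymm, RingQuot.liftAlgHom_mkAlgHom_apply]
  simp

theorem heckeSymm_heckeIncl {q' : K} (h : q * q' = 1) {n : ℕ} (a : HeckeAlg q n) :
    heckeSymm q h (n + 1) (heckeIncl q n a) = heckeIncl q' n (heckeSymm q h n a) := by
  have : (heckeSymm q h (n + 1)).comp (heckeIncl q n)
      = (heckeIncl q' n).comp (heckeSymm q h n) :=
    hecke_algHom_ext fun i => by simp [heckeSymm_heckeG]
  exact DFunLike.congr_fun this a

theorem ocneanuTrace_heckeRep_symm [CharZero K] (hq : q ≠ 0) {q' ζ' : K} (hq' : q' ≠ 0)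
    (h : q * q' = 1) (hζ : ζ = -q * ζ') {n : ℕ} (α : BraidGroup n) :
    ocneanuTrace q ζ n (heckeRep hq n α : HeckeAlg q n)
      = (-q) ^ expSum α * ocneanuTrace q' ζ' n (heckeRep hq' n α : HeckeAlg q' n) := by
  have hO' := isOcneanuTrace_ocneanuTrace q' ζ'
  have hO : IsOcneanuTrace q ζ
      (fun n => ocneanuTrace q' ζ' n ∘ₗ (heckeSymm q h n).toLinearMap) := by
    refine ⟨fun n a => ?_, fun n a b => ?_, fun n => ?_, fun n a => ?_⟩
    · simp [heckeSymm_heckeIncl, hO'.incl]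
    · simp [hO'.comm n (heckeSymm q h n a)]
    · simp [hO'.one]
    · simp only [LinearMap.comp_apply, AlgHom.toLinearMap_apply, map_mul, heckeSymm_heckeIncl,
        heckeSymm_heckeG, mul_smul_comm, map_smul, hO'.markov, smul_eq_mul, hζ, mul_assoc]
  rw [(isOcneanuTrace_ocneanuTrace q ζ).unique hO, LinearMap.comp_apply, AlgHom.toLinearMap_apply,
    map_heckeRep hq (heckeSymm q h n) (neg_ne_zero.2 hq) (heckeRep hq' n) (fun i => ?_) α,
    map_smul, smul_eq_mul]
  rw [heckeSymm_heckeG, heckeRep, braidLift_of]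
  rfl

/-- The HOMFLYPT polynomial is invariant under `q ↦ q⁻¹`, `ζ ↦ -ζ / q`, `√λ_H ↦ -q √λ_H`. -/
theorem homflypt_symm [CharZero K] (hq : q ≠ 0) {q' ζ' r r' : K} (hq' : q' ≠ 0)
    (h : q * q' = 1) (hζ : ζ = -q * ζ') (hr : r' = -q * r) {n : ℕ} (α : BraidGroup n) :
    homflypt hq ζ r α = homflypt hq' ζ' r' α := by
  rw [homflypt, homflypt, ocneanuTrace_heckeRep_symm hq hq' h hζ, hr, mul_zpow, DH, DH, hζ]
  ring

/-- If `ζ` is a root of the quadratic relation, the Ocneanu trace is the character `G_i ↦ ζ`. -/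
theorem homflypt_of_sq_eq [CharZero K] (hq : q ≠ 0) (hζ0 : ζ ≠ 0) (hζ : ζ ^ 2 = (q - 1) * ζ + q)
    (r : K) {n : ℕ} (α : BraidGroup n) :
    homflypt hq ζ r α = (1 / (ζ * r)) ^ (n - 1) * (ζ * r) ^ expSum α := by
  let χ : ∀ n, HeckeAlg q n →ₐ[K] K := fun n =>
    RingQuot.liftAlgHom K ⟨FreeAlgebra.lift K (fun _ => ζ), by
      rintro _ _ (⟨i, j, hij⟩ | ⟨i, j, hij⟩ | i)
      · simp
      · simp
      · simpa using hζ⟩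
  have hχ : ∀ n i, χ n (heckeG q i) = ζ := fun n i => by
    change RingQuot.liftAlgHom K _ (RingQuot.mkAlgHom K _ _) = _
    rw [RingQuot.liftAlgHom_mkAlgHom_apply]
    simp
  have hχi : ∀ n a, χ (n + 1) (heckeIncl q n a) = χ n a := fun n a => by
    have : (χ (n + 1)).comp (heckeIncl q n) = χ n := hecke_algHom_ext fun i => by simp [hχ]
    exact DFunLike.congr_fun this a
  clear_value χ
  have hO : IsOcneanuTrace q ζ (fun n => (χ n).toLinearMap) := by
    refine ⟨hχi, fun n a b => ?_, fun n => map_one (χ n), fun n a => ?_⟩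
    · rw [AlgHom.toLinearMap_apply, AlgHom.toLinearMap_apply, map_mul, map_mul, mul_comm]
    · rw [AlgHom.toLinearMap_apply, AlgHom.toLinearMap_apply, map_mul, hχi, hχ, mul_comm]
  rw [homflypt, (isOcneanuTrace_ocneanuTrace q ζ).unique hO, AlgHom.toLinearMap_apply,
    map_heckeRep hq (χ n) hζ0 1 (fun i => by simp [hχ]) α, DH, mul_zpow]
  simp only [MonoidHom.one_apply, Units.val_one, smul_eq_mul, mul_one]
  ring

theorem isESolution_one : IsESolution (fun _ : ZMod 1 => (1 : K)) :=
  ⟨rfl, fun m hm => absurd (Subsingleton.elim m 0) hm⟩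

theorem paramE_one : paramE (fun _ : ZMod 1 => (1 : K)) = 1 := by simp [paramE]

/-- The HOMFLYPT polynomial is the invariant of the Yokonuma-Hecke algebras for `d = 1`. -/
theorem homflypt_eq_deltaInv [CharZero K] (hq : q ≠ 0) (ζ r : K) {n : ℕ} (α : BraidGroup n) :
    homflypt hq ζ r α = deltaInv (fun _ : ZMod 1 => (1 : K)) hq ζ r α :=
  (deltaInv_eq_homflypt rfl ((isJuyumayaTrace_juyumayaTrace rfl).quad_of_paramE_eq_one
    isESolution_one paramE_one) hq hq r α).symm

end Homflypt

/-! ### The Juyumaya trace of some braids on two and three strands -/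

section Values

variable {d : ℕ} {u : K}

theorem lastE_mul_lastH [CharZero K] (n : ℕ) : lastE d u n * lastH d u n = lastH d u n := by
  rw [lastH, mul_add, ← mul_assoc, lastE_mul_lastE]

theorem lastH_mul_lastE [CharZero K] (n : ℕ) : lastH d u n * lastE d u n = lastH d u n := by
  rw [lastH, add_mul, mul_assoc, yg_mul_lastE, ← mul_assoc, lastE_mul_lastE]

/-- The idempotent `e` attached to the first and the last of the last three strands. -/
noncomputable def outerE (d : ℕ) (u : K) (n : ℕ) : YokoAlg d u (n + 3) :=
  yokoIdem K d (yokoIncl d u (n + 2) (yokoIncl d u (n + 1) (yt d u (n + 1) n)))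
    (yt d u (n + 3) (n + 2))

theorem yokoIncl_lastE_mul_lastE (n : ℕ) :
    yokoIncl d u (n + 2) (lastE d u n) * lastE d u (n + 1) = outerE d u n * lastE d u (n + 1) := by
  rw [lastE, lastE, outerE, map_yokoIdem]
  exact yokoIdem_mul_yokoIdem (commute_yt_yokoIncl _).eq.symm
    (by rw [← map_pow, (yokoFamily d u (n + 2)).tpow _ (by omega), map_one])
    ((yokoFamily d u (n + 3)).tpow _ (by omega))

theorem lastE_mul_yokoIncl_lastE (n : ℕ) : lastE d u (n + 1) * yokoIncl d u (n + 2) (lastE d u n)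
    = outerE d u n * yokoIncl d u (n + 2) (lastE d u n) := by
  have hf := yokoFamily d u (n + 3)
  have h1 : yokoIncl d u (n + 2) (lastE d u n)
      = yokoIdem K d (yokoIncl d u (n + 2) (yt d u (n + 2) (n + 1)))
        (yokoIncl d u (n + 2) (yokoIncl d u (n + 1) (yt d u (n + 1) n))) := by
    rw [lastE_eq_swap, map_yokoIdem]
  have h2 : outerE d u n = yokoIdem K d (yt d u (n + 3) (n + 2))
      (yokoIncl d u (n + 2) (yokoIncl d u (n + 1) (yt d u (n + 1) n))) := by
    rw [outerE, yokoIncl_yt (by omega), yokoIncl_yt (by omega)]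
    exact yokoIdem_comm (hf.tt _ _ (by omega) (by omega)) (hf.tpow _ (by omega))
      (hf.tpow _ (by omega))
  rw [h1, h2, lastE_eq_swap]
  refine yokoIdem_mul_yokoIdem ?_ ?_ ?_
  · rw [← map_mul, ← map_mul, (commute_yt_yokoIncl _).eq]
  · rw [← map_pow, (yokoFamily d u (n + 2)).tpow _ (by omega), map_one]
  · rw [← map_pow, ← map_pow, (yokoFamily d u (n + 1)).tpow _ (by omega), map_one, map_one]

theorem yokoIncl_yg_mul_lastE (n : ℕ) :
    yokoIncl d u (n + 2) (yg d u (n + 2) n) * lastE d u (n + 1)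
      = outerE d u n * yokoIncl d u (n + 2) (yg d u (n + 2) n) := by
  have h1 := yokoIncl_yt_pow_mul_yg (d := d) (u := u) (n := n) 1
  rw [pow_one, pow_one] at h1
  rw [lastE, outerE]
  refine mul_yokoIdem_of_semiconj ?_ (commute_yt_yokoIncl _).eq.symm
  rw [← map_mul, ← map_mul, h1]

theorem yokoIncl_yg_mul_outerE (n : ℕ) :
    yokoIncl d u (n + 2) (yg d u (n + 2) n) * outerE d u n
      = lastE d u (n + 1) * yokoIncl d u (n + 2) (yg d u (n + 2) n) := by
  have h1 := yt_pow_mul_yg (d := d) (u := u) (n := n) 1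
  rw [pow_one, pow_one] at h1
  rw [lastE, outerE]
  refine mul_yokoIdem_of_semiconj ?_ (commute_yt_yokoIncl _).eq.symm
  rw [← map_mul, ← map_mul, h1]

theorem yokoIncl_yg_mul_lastE_mul_yokoIncl_lastH [CharZero K] (n : ℕ) :
    yokoIncl d u (n + 2) (yg d u (n + 2) n) * lastE d u (n + 1)
        * yokoIncl d u (n + 2) (lastH d u n)
      = u • (lastE d u (n + 1) * yokoIncl d u (n + 2) (lastH d u n)) := by
  rw [← lastE_mul_lastH n, map_mul, ← mul_assoc, mul_assoc _ (lastE d u (n + 1)),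
    lastE_mul_yokoIncl_lastE, ← mul_assoc, yokoIncl_yg_mul_outerE, mul_assoc, mul_assoc,
    ← map_mul (yokoIncl d u (n + 2)) (lastE d u n), lastE_mul_lastH, ← map_mul, yg_mul_lastH,
    map_smul, mul_smul_comm]

variable [NeZero d] {z : K} {x : ZMod d → K} {tr : ∀ n, YokoAlg d u n →ₗ[K] K}

theorem IsJuyumayaTrace.apply_yg (h : IsJuyumayaTrace d u z x tr) (hx : IsESolution x) (n : ℕ) :
    tr (n + 2) (yg d u (n + 2) n) = z := by
  have := (h.markovStep hx.1 (n + 1)).braiding_right 1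
  rwa [map_one, one_mul, h.one, mul_one] at this

variable [CharZero K]

theorem IsJuyumayaTrace.apply_lastE (h : IsJuyumayaTrace d u z x tr) (hx : IsESolution x) (n : ℕ) :
    tr (n + 2) (lastE d u n) = paramE x := by
  have := h.yokoIncl_mul_lastE hx n 1
  rwa [map_one, one_mul, h.one, mul_one] at this

theorem IsJuyumayaTrace.apply_lastH (h : IsJuyumayaTrace d u z x tr) (hx : IsESolution x) (n : ℕ) :
    tr (n + 2) (lastH d u n) = paramE x + z := by
  have := h.yokoIncl_mul_lastH hx n 1
  rwa [map_one, one_mul, h.one, mul_one] at this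

theorem IsJuyumayaTrace.apply_yg_sq (h : IsJuyumayaTrace d u z x tr) (hx : IsESolution x) (n : ℕ) :
    tr (n + 2) (yg d u (n + 2) n * yg d u (n + 2) n) = 1 + (u - 1) * (paramE x + z) := by
  rw [yg_mul_self_eq_lastH, map_add, map_smul, h.one, h.apply_lastH hx, smul_eq_mul]

theorem IsJuyumayaTrace.apply_yg_cube (h : IsJuyumayaTrace d u z x tr) (hx : IsESolution x)
    (n : ℕ) : tr (n + 2) (yg d u (n + 2) n * yg d u (n + 2) n * yg d u (n + 2) n)
      = z + (u - 1) * (u * (paramE x + z)) := by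
  rw [yg_mul_self_eq_lastH, add_mul, one_mul, smul_mul_assoc, lastH_mul_yg, map_add, map_smul,
    map_smul, h.apply_lastH hx, h.apply_yg hx, smul_eq_mul, smul_eq_mul]

/-- The trace of `(g_1 (g_2 + c h_2))²`. As `g⁻¹ = g + (u⁻¹ - 1) h`, the case `c = u⁻¹ - 1` is that
of the figure-eight braid `σ_1 σ_2⁻¹ σ_1 σ_2⁻¹`. -/
theorem IsJuyumayaTrace.apply_figureEight (h : IsJuyumayaTrace d u z x tr) (hx : IsESolution x)
    (n : ℕ) (c : K) :
    tr (n + 3) (yokoIncl d u (n + 2) (yg d u (n + 2) n)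
        * (yg d u (n + 3) (n + 1) + c • lastH d u (n + 1))
        * yokoIncl d u (n + 2) (yg d u (n + 2) n)
        * (yg d u (n + 3) (n + 1) + c • lastH d u (n + 1)))
      = z * (z + (u - 1) * (u * (paramE x + z))) + 2 * c * (z * (u ^ 2 * (paramE x + z)))
        + c ^ 2 * ((paramE x + z) * (paramE x + (u - 1) * (paramE x + z))
          + u ^ 2 * z * (paramE x + z)) := by
  have hT := h.markovStep hx.1 (n + 2)
  set a := yg d u (n + 2) n with ha
  set b := yg d u (n + 3) (n + 1) with hb
  set ι := yokoIncl d u (n + 2) with hι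
  have hnear : b * ι a * b = ι a * b * ι a := yg_yokoIncl_yg
  have hH : b * ι a * lastH d u (n + 1) = ι (lastH d u n) * (b * ι a) :=
    yg_mul_yokoIncl_yg_mul_lastH
  have hB : ∀ v w, tr (n + 3) (ι v * b * ι w) = z * tr (n + 2) (v * w) := hT.braiding'
  have h1 : tr (n + 3) (ι a * b * ι a * b) = z * (z + (u - 1) * (u * (paramE x + z))) := by
    rw [mul_assoc, mul_assoc, ← mul_assoc b, hnear, ← mul_assoc, ← mul_assoc, ← map_mul, hB,
      h.apply_yg_cube hx]
  have h2 : tr (n + 3) (ι a * b * ι a * lastH d u (n + 1))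
      = z * (u ^ 2 * (paramE x + z)) := by
    rw [mul_assoc, mul_assoc, ← mul_assoc b, hH, ← mul_assoc, ← mul_assoc, ← map_mul, hB,
      yg_mul_lastH, smul_mul_assoc, lastH_mul_yg, map_smul, map_smul, h.apply_lastH hx, smul_eq_mul,
      smul_eq_mul]
    ring
  have h3 : tr (n + 3) (ι a * lastH d u (n + 1) * ι a * b)
      = z * (u ^ 2 * (paramE x + z)) := by
    rw [mul_assoc, h.comm, ← mul_assoc, h2]
  have h4 : tr (n + 3) (ι a * lastE d u (n + 1) * ι a * lastH d u (n + 1))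
      = (paramE x + z) * (paramE x + (u - 1) * (paramE x + z)) := by
    have e1 : ι a * outerE d u n = lastE d u (n + 1) * ι a := yokoIncl_yg_mul_outerE n
    have e2 : ι a * lastE d u (n + 1) = outerE d u n * ι a := yokoIncl_yg_mul_lastE n
    have hc : outerE d u n * (ι a * ι a) = ι a * ι a * outerE d u n := by
      rw [mul_assoc, e1, ← mul_assoc, ← mul_assoc, e2]
    rw [e2, mul_assoc (outerE d u n), hc, ← lastE_mul_lastH, mul_assoc,
      ← mul_assoc (outerE d u n), ← yokoIncl_lastE_mul_lastE, mul_assoc (ι _) (lastE d u (n + 1)),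
      lastE_mul_lastH, ← mul_assoc, ← map_mul, ← map_mul, h.yokoIncl_mul_lastH hx]
    congr 1
    rw [yg_mul_self_eq_lastH, add_mul, one_mul, smul_mul_assoc, lastH_mul_lastE, map_add, map_smul,
      h.apply_lastE hx, h.apply_lastH hx, smul_eq_mul]
  have h5 : tr (n + 3) (ι a * (lastE d u (n + 1) * b) * ι a * lastH d u (n + 1))
      = u ^ 2 * z * (paramE x + z) := by
    have e1 : ι a * (lastE d u (n + 1) * b) * ι a * lastH d u (n + 1)
        = u • (lastE d u (n + 1) * (b * ι a * lastH d u (n + 1))) := by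
      rw [hH, ← mul_assoc (lastE d u (n + 1)), ← smul_mul_assoc,
        ← yokoIncl_yg_mul_lastE_mul_yokoIncl_lastH]
      rw [mul_assoc _ _ (b * ι a), ← hH]
      simp only [mul_assoc]
      rfl
    rw [e1, map_smul, h.comm, mul_assoc, lastH_mul_lastE, hH, ← mul_assoc, hB, lastH_mul_yg,
      map_smul, h.apply_lastH hx, smul_eq_mul, smul_eq_mul]
    ring
  have h6 : tr (n + 3) (ι a * lastH d u (n + 1) * ι a * lastH d u (n + 1))
      = (paramE x + z) * (paramE x + (u - 1) * (paramE x + z)) + u ^ 2 * z * (paramE x + z) := by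
    rw [← h4, ← h5, ← map_add]
    congr 1
    conv_lhs => enter [1, 1, 2]; rw [lastH]
    rw [mul_add, add_mul, add_mul]
  simp only [mul_add, add_mul, mul_smul_comm, smul_mul_assoc, map_add, map_smul, smul_eq_mul, h1,
    h2, h3, h6]
  ring

end Values

/-! ### The parameters for which the traces of short braids agree -/

section Parameters

/-- The trace of the figure-eight braid as a polynomial in the parameters and their inverses. -/
def figureEightTrace (u z E : K) : K :=
  z * (z + (u - 1) * (u * (E + z))) + 2 * (u⁻¹ - 1) * (z * (u ^ 2 * (E + z)))
    + (u⁻¹ - 1) ^ 2 * ((E + z) * (E + (u - 1) * (E + z)) + u ^ 2 * z * (E + z))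

theorem figureEightTrace_sub_neg [CharZero K] {u z E : K} (hu : u ≠ 0)
    (h : 2 * z = (u + 1) + (u - 1) * E) :
    2 * u ^ 2 * (figureEightTrace u z E - figureEightTrace (-u) (-z) 1)
      = (E ^ 2 - 1) * (u ^ 2 - 1) ^ 2 := by
  obtain rfl : z = ((u + 1) + (u - 1) * E) / 2 := by rw [← h]; ring
  unfold figureEightTrace
  field_simp
  ring

theorem figureEightTrace_sub_neg_inv [CharZero K] {u z E : K} (hu : u ≠ 0)
    (h : 2 * z = (u + 1) + (u - 1) * E) :
    2 * u ^ 2 * (figureEightTrace u z E - figureEightTrace (-u⁻¹) (-u⁻¹ * z) 1)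
      = (E ^ 2 - 1) * (u ^ 2 - 1) ^ 2 := by
  obtain rfl : z = ((u + 1) + (u - 1) * E) / 2 := by rw [← h]; ring
  unfold figureEightTrace
  field_simp
  ring

theorem param_cases_u_eq_one [CharZero K] {q z ρ : K} (hq : q ≠ 0)
    (h1 : (ρ - q) * (ρ + 1) * (1 + z) = 0) (h2 : (ρ + q) * (ρ - 1) * (1 - z) = 0) :
    (q = 1 ∧ ρ * z = z) ∨ (q = 1 ∧ ρ * z = -z) ∨ (ρ * z = q ∧ z = 1) ∨ (ρ * z = q ∧ z = -1) ∨
      (ρ * z = -1 ∧ z = 1) ∨ (ρ * z = -1 ∧ z = -1) := by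
  grind

theorem param_cases_E_eq_one [CharZero K] {q z u ρ : K} (hu : u ≠ 0) (hu1 : u ≠ 1)
    (hρ : ρ ≠ 0) (k1 : u * ρ * (ρ * z + 1 - q) = q * (z + (1 - u) * 1))
    (h1 : (u - 1) * (z + 1) * (ρ * u - q) * (ρ * u + 1) = 0)
    (h2 : (ρ + q) * (ρ - 1) * (u + 1 + (u - 1) * 1 - 2 * z) = 0) :
    (ρ * z = q ∧ z = -1) ∨ (ρ * z = q ∧ z = u) ∨ (ρ * z = -1 ∧ z = -1) ∨ (ρ * z = -1 ∧ z = u) ∨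
      (q = u ∧ ρ * z = z) ∨ (q = 1 / u ∧ ρ * z = -z / u) := by
  have h1' : z = -1 ∨ ρ * u = q ∨ ρ * u = -1 := by grind
  have h2' : ρ = -q ∨ ρ = 1 ∨ z = u := by
    rcases mul_eq_zero.1 h2 with h | h
    · rcases mul_eq_zero.1 h with h | h
      · exact Or.inl (eq_neg_of_add_eq_zero_left h)
      · exact Or.inr (Or.inl (sub_eq_zero.1 h))
    · refine Or.inr (Or.inr ?_)
      refine mul_left_cancel₀ (two_ne_zero (α := K)) ?_
      linear_combination -h
  rcases h1' with rfl | h1 | h1 <;> rcases h2' with rfl | rfl | rfl <;> grind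

theorem param_cases_generic [CharZero K] {q z u ρ E : K} (hq : q ≠ 0) (hu : u ≠ 0) (hu1 : u ≠ 1)
    (hE : E ≠ -1) (k1 : u * ρ * (ρ * z + 1 - q) = q * (z + (1 - u) * E))
    (k2 : (q - 1) * (ρ * z) + q = ρ ^ 2 * (1 + (u - 1) * (E + z)))
    (h1 : z = -E ∨ ρ * u = q ∨ ρ * u = -1)
    (h2 : (ρ + q) * (ρ - 1) * ((u + 1) + (u - 1) * E - 2 * z) = 0) (h3 : ρ = q ∨ ρ = -1) :
    (q = 1 ∧ ρ * z = E ∧ z = -E) ∨ (q = 1 ∧ ρ * z = -E ∧ z = -E) ∨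
      (2 * z = (u + 1) + (u - 1) * E ∧ u ^ 2 ≠ 1 ∧
        (ρ = -1 ∧ q = -u ∨ ρ = -u⁻¹ ∧ q = -u⁻¹)) := by
  have h2' : ρ = -q ∨ ρ = 1 ∨ 2 * z = (u + 1) + (u - 1) * E := by
    rcases mul_eq_zero.1 h2 with h | h
    · rcases mul_eq_zero.1 h with h | h
      · exact Or.inl (eq_neg_of_add_eq_zero_left h)
      · exact Or.inr (Or.inl (sub_eq_zero.1 h))
    · refine Or.inr (Or.inr ?_)
      linear_combination -h
  rcases h3 with rfl | rfl <;> rcases h1 with rfl | h1 | h1 <;> rcases h2' with h2 | h2 | h2 <;>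
    grind

/-- The equations on the parameters that come from the braids `σ_1`, `σ_1²`, `σ_1³` and
`σ_1 σ_2⁻¹ σ_1 σ_2⁻¹`, where `ρ = ζ / z` is the ratio of the square roots. -/
theorem inTable_of_equations [CharZero K] {q ζ u z E ρ : K} (hq : q ≠ 0) (hu : u ≠ 0)
    (hρ : ρ ≠ 0) (hζ : ζ = ρ * z) (hE : E ≠ -1)
    (k1 : u * ρ * (ρ * z + 1 - q) = q * (z + (1 - u) * E))
    (k2 : (q - 1) * (ρ * z) + q = ρ ^ 2 * (1 + (u - 1) * (E + z)))
    (k3 : ρ * z + (q - 1) * (q * (1 + ρ * z)) = ρ ^ 3 * (z + (u - 1) * (u * (E + z))))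
    (k4 : figureEightTrace q (ρ * z) 1 = figureEightTrace u z E) : InTable q ζ u z E := by
  have two : (2 : K) ≠ 0 := two_ne_zero
  -- The algebra generated by `g` has the eigenvalues `u`, `1`, `-1`; each of these three equations
  -- is the value of the trace at `(ρ g - q) (ρ g + 1)` times a multiple of a spectral projection.
  have hI : (ρ - q) * (ρ + 1) * (1 - u) * (1 - E) = 0 := by
    refine (mul_eq_zero.1 (?_ : ρ * _ = 0)).resolve_left hρ
    linear_combination (q - 1) * k2 - k3 - ρ * (1 - u) * k2 - ρ * k1
  have hII : (u - 1) * (z + E) * (ρ * u - q) * (ρ * u + 1) = 0 := by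
    refine (mul_eq_zero.1 (?_ : ρ * _ = 0)).resolve_left hρ
    linear_combination u * ((q - 1) * k2 - k3) - ρ * k1
  have hIII : (ρ + q) * (ρ - 1) * ((u + 1) + (u - 1) * E - 2 * z) = 0 := by
    refine (mul_eq_zero.1 (?_ : ρ * _ = 0)).resolve_left hρ
    linear_combination -((q - 1) * k2 - k3) - ρ * (1 + u) * k2 - ρ * k1
  subst hζ
  unfold InTable
  by_cases hu1 : u = 1
  · subst hu1
    rcases param_cases_u_eq_one (q := q) (z := z) (ρ := ρ) hq
      (by linear_combination k1 - k2) (by linear_combination -k1 - k2)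
      with h | h | h | h | h | h
    · exact Or.inl ⟨h.1, h.2, rfl⟩
    · exact Or.inr <| Or.inl ⟨h.1, h.2, rfl⟩
    · exact Or.inr <| Or.inr <| Or.inl ⟨h.1, rfl, h.2⟩
    · exact Or.inr <| Or.inr <| Or.inr <| Or.inl ⟨h.1, rfl, h.2⟩
    · exact Or.inr <| Or.inr <| Or.inr <| Or.inr <| Or.inl ⟨h.1, rfl, h.2⟩
    · exact Or.inr <| Or.inr <| Or.inr <| Or.inr <| Or.inr <| Or.inl ⟨h.1, rfl, h.2⟩
  by_cases hE1 : E = 1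
  · subst hE1
    rcases param_cases_E_eq_one hu hu1 hρ k1 hII hIII with h | h | h | h | h | h
    · exact Or.inr <| Or.inr <| Or.inr <| Or.inr <| Or.inr <| Or.inr <| Or.inr <| Or.inr <|
        Or.inl ⟨h.1, h.2, rfl⟩
    · exact Or.inr <| Or.inr <| Or.inr <| Or.inr <| Or.inr <| Or.inr <| Or.inr <| Or.inr <|
        Or.inr <| Or.inl ⟨h.1, h.2, rfl⟩
    · exact Or.inr <| Or.inr <| Or.inr <| Or.inr <| Or.inr <| Or.inr <| Or.inr <| Or.inr <|
        Or.inr <| Or.inr <| Or.inl ⟨h.1, h.2, rfl⟩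
    · exact Or.inr <| Or.inr <| Or.inr <| Or.inr <| Or.inr <| Or.inr <| Or.inr <| Or.inr <|
        Or.inr <| Or.inr <| Or.inr <| Or.inl ⟨h.1, h.2, rfl⟩
    · exact Or.inr <| Or.inr <| Or.inr <| Or.inr <| Or.inr <| Or.inr <| Or.inr <| Or.inr <|
        Or.inr <| Or.inr <| Or.inr <| Or.inr <| Or.inl ⟨h.1, h.2, rfl⟩
    · exact Or.inr <| Or.inr <| Or.inr <| Or.inr <| Or.inr <| Or.inr <| Or.inr <| Or.inr <|
        Or.inr <| Or.inr <| Or.inr <| Or.inr <| Or.inr <| ⟨h.1, h.2, rfl⟩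
  have hρq : ρ = q ∨ ρ = -1 := by
    have h1 : 1 - u ≠ 0 := sub_ne_zero.2 (Ne.symm hu1)
    have h2 : 1 - E ≠ 0 := sub_ne_zero.2 (Ne.symm hE1)
    rcases mul_eq_zero.1 ((mul_eq_zero.1 ((mul_eq_zero.1 hI).resolve_right h2)).resolve_right h1)
      with h | h
    · exact Or.inl (sub_eq_zero.1 h)
    · exact Or.inr (eq_neg_of_add_eq_zero_left h)
  have hE' : E ^ 2 - 1 ≠ 0 := by
    intro h
    rcases mul_eq_zero.1 (show (E - 1) * (E + 1) = 0 by linear_combination h) with h | h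
    · exact hE1 (sub_eq_zero.1 h)
    · exact hE (eq_neg_of_add_eq_zero_left h)
  have hcases : z = -E ∨ ρ * u = q ∨ ρ * u = -1 := by
    have h1 : u - 1 ≠ 0 := sub_ne_zero.2 hu1
    rcases mul_eq_zero.1 hII with h | h
    · rcases mul_eq_zero.1 h with h | h
      · exact Or.inl (eq_neg_of_add_eq_zero_left ((mul_eq_zero.1 h).resolve_left h1))
      · exact Or.inr (Or.inl (sub_eq_zero.1 h))
    · exact Or.inr (Or.inr (eq_neg_of_add_eq_zero_left h))
  rcases param_cases_generic hq hu hu1 hE k1 k2 hcases hIII hρq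
    with h | h | ⟨hz, hu2, ⟨rfl, rfl⟩ | ⟨rfl, rfl⟩⟩
  · exact Or.inr <| Or.inr <| Or.inr <| Or.inr <| Or.inr <| Or.inr <| Or.inl h
  · exact Or.inr <| Or.inr <| Or.inr <| Or.inr <| Or.inr <| Or.inr <| Or.inr <| Or.inl h
  -- The figure-eight braid excludes the two remaining families of parameters.
  · have h := figureEightTrace_sub_neg hu hz
    rw [← k4, neg_one_mul, sub_self, mul_zero] at h
    exact absurd h.symm (mul_ne_zero hE' (pow_ne_zero 2 (sub_ne_zero.2 hu2)))
  · have h := figureEightTrace_sub_neg_inv hu hz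
    rw [← k4, sub_self, mul_zero] at h
    exact absurd h.symm (mul_ne_zero hE' (pow_ne_zero 2 (sub_ne_zero.2 hu2)))

end Parameters

/-! ### The invariants of some short braids -/

section Braids

variable {d : ℕ} {u : K}

theorem val_yokoRep_of [CharZero K] (hu : u ≠ 0) {n : ℕ} (i : Fin (n - 1)) :
    (yokoRep d hu n (PresentedGroup.of i) : YokoAlg d u n) = yokoG d u i := by
  rw [yokoRep, braidLift_of]
  rfl

theorem yokoE_crossLast (n : ℕ) : yokoE d u (crossLast n) = lastE d u n := by
  rw [yokoE, lastE, yokoIncl_yt (by omega), yt_of_lt (show n < n + 2 by omega),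
    yt_of_lt (show n + 1 < n + 2 by omega)]
  rfl

variable [CharZero K]

theorem val_yokoRep_of_inv (hu : u ≠ 0) (n : ℕ) :
    (yokoRep d hu (n + 2) (PresentedGroup.of (crossLast n))⁻¹ : YokoAlg d u (n + 2))
      = yg d u (n + 2) n + (u⁻¹ - 1) • lastH d u n := by
  rw [yokoRep, map_inv, braidLift_of, lastH, smul_add, ← add_assoc, ← yokoG_crossLast,
    ← yokoE_crossLast]
  rfl

variable [NeZero d] {x : ZMod d → K}

theorem deltaInv_one (hx : IsESolution x) (hu : u ≠ 0) (z r : K) (n : ℕ) :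
    deltaInv x hu z r (1 : BraidGroup n) = DY z r ^ (n - 1) := by
  rw [deltaInv, map_one, Units.val_one, (isJuyumayaTrace_juyumayaTrace hx.1).one]
  simp [expSum]

theorem deltaInv_of (hx : IsESolution x) (hu : u ≠ 0) (z r : K) :
    deltaInv x hu z r (PresentedGroup.of (crossLast 0) : BraidGroup 2) = DY z r * r * z := by
  rw [deltaInv, expSum_of, val_yokoRep_of, yokoG_crossLast,
    (isJuyumayaTrace_juyumayaTrace hx.1).apply_yg hx]
  simp

theorem deltaInv_of_sq (hx : IsESolution x) (hu : u ≠ 0) (z r : K) :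
    deltaInv x hu z r (PresentedGroup.of (crossLast 0) * PresentedGroup.of (crossLast 0)
      : BraidGroup 2) = DY z r * r ^ 2 * (1 + (u - 1) * (paramE x + z)) := by
  rw [deltaInv, expSum_mul, expSum_of, map_mul, Units.val_mul, val_yokoRep_of, yokoG_crossLast,
    (isJuyumayaTrace_juyumayaTrace hx.1).apply_yg_sq hx]
  norm_num

theorem deltaInv_of_cube (hx : IsESolution x) (hu : u ≠ 0) (z r : K) :
    deltaInv x hu z r (PresentedGroup.of (crossLast 0) * PresentedGroup.of (crossLast 0)
      * PresentedGroup.of (crossLast 0) : BraidGroup 2)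
      = DY z r * r ^ 3 * (z + (u - 1) * (u * (paramE x + z))) := by
  rw [deltaInv, expSum_mul, expSum_mul, expSum_of, map_mul, map_mul, Units.val_mul, Units.val_mul,
    val_yokoRep_of, yokoG_crossLast, (isJuyumayaTrace_juyumayaTrace hx.1).apply_yg_cube hx]
  norm_num

/-- The figure-eight braid `σ_1 σ_2⁻¹ σ_1 σ_2⁻¹`. -/
def figureEight : BraidGroup 3 :=
  PresentedGroup.of (crossSucc (crossLast 0)) * (PresentedGroup.of (crossLast 1))⁻¹
    * PresentedGroup.of (crossSucc (crossLast 0)) * (PresentedGroup.of (crossLast 1))⁻¹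

theorem deltaInv_figureEight (hx : IsESolution x) (hu : u ≠ 0) (z r : K) :
    deltaInv x hu z r figureEight = DY z r ^ 2 * figureEightTrace u z (paramE x) := by
  have h1 : yokoG d u (crossSucc (crossLast 0)) = yokoIncl d u 2 (yg d u 2 0) := by
    rw [← yokoIncl_yokoG, yokoG_crossLast]
  have h2 : expSum figureEight = 0 := by
    have h : ∀ α : BraidGroup 3, expSum α⁻¹ = -expSum α := fun α => by simp [expSum]
    rw [figureEight, expSum_mul, expSum_mul, expSum_mul, h, expSum_of, expSum_of]
    rfl
  rw [deltaInv, h2, figureEight, map_mul, map_mul, map_mul, Units.val_mul, Units.val_mul,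
    Units.val_mul, val_yokoRep_of_inv hu 1, val_yokoRep_of, h1,
    (isJuyumayaTrace_juyumayaTrace hx.1).apply_figureEight hx 0, figureEightTrace, zpow_zero,
    mul_one]

end Braids

/-! ### Comparison of the two invariants -/

section Comparison

variable [CharZero K] {d : ℕ} [NeZero d] {x : ZMod d → K} {q ζ u z rH rY : K}

theorem homflypt_one (hq : q ≠ 0) (n : ℕ) :
    homflypt hq ζ rH (1 : BraidGroup n) = DH ζ rH ^ (n - 1) :=
  (homflypt_eq_deltaInv hq ζ rH _).trans (deltaInv_one isESolution_one hq ζ rH n)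

theorem homflypt_of (hq : q ≠ 0) :
    homflypt hq ζ rH (PresentedGroup.of (crossLast 0) : BraidGroup 2) = DH ζ rH * rH * ζ :=
  (homflypt_eq_deltaInv hq ζ rH _).trans (deltaInv_of isESolution_one hq ζ rH)

/-- A factor `c_n` of proportionality is `1`: the case `n = 2` of the trivial braid and of `σ_1`
shows that `c_2 = 1` and `D_H = D_Y`, and then the trivial braid shows that `c_n = 1`. -/
theorem eq_one_of_proportional (hx : IsESolution x) (hq : q ≠ 0) (hu : u ≠ 0) (hζ : ζ ≠ 0)
    (hz : z ≠ 0) (hrH : rH ≠ 0) (hrY : rY ≠ 0) {c : ℕ → K}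
    (h : ∀ n, 1 ≤ n → ∀ α : BraidGroup n, homflypt hq ζ rH α = c n * deltaInv x hu z rY α) :
    DH ζ rH = DY z rY ∧ ∀ n, 1 ≤ n → c n = 1 := by
  have hσ := h 2 one_le_two (PresentedGroup.of (crossLast 0))
  have h1 : DH ζ rH * rH * ζ = 1 := by rw [DH]; field_simp
  have h2 : DY z rY * rY * z = 1 := by rw [DY]; field_simp
  rw [homflypt_of, deltaInv_of hx, h1, h2, mul_one] at hσ
  have hD : DH ζ rH = DY z rY := by
    have := h 2 one_le_two 1
    rw [homflypt_one, deltaInv_one hx, ← hσ] at this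
    simpa using this
  refine ⟨hD, fun n hn => ?_⟩
  have := h n hn 1
  rw [homflypt_one, deltaInv_one hx, hD] at this
  have h0 : DY z rY ^ (n - 1) ≠ 0 := pow_ne_zero _ fun h0 => by
    rw [h0, zero_mul, zero_mul] at h2
    exact zero_ne_one h2
  exact (mul_right_cancel₀ h0 ((one_mul _).trans this)).symm

theorem inTable_of_homflypt_eq_deltaInv (hx : IsESolution x) (hq : q ≠ 0) (hu : u ≠ 0)
    (hζ : ζ ≠ 0) (hz : z ≠ 0) (hlH : lambdaH q ζ ≠ 0) (hlY : lambdaY u z (paramE x) ≠ 0)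
    (hrH : rH ^ 2 = lambdaH q ζ) (hrY : rY ^ 2 = lambdaY u z (paramE x))
    (h : ∀ n, 1 ≤ n → ∀ α : BraidGroup n, homflypt hq ζ rH α = deltaInv x hu z rY α) :
    InTable q ζ u z (paramE x) := by
  have hrH0 : rH ≠ 0 := fun h0 => hlH (by rw [← hrH, h0, zero_pow two_ne_zero])
  have hrY0 : rY ≠ 0 := fun h0 => hlY (by rw [← hrY, h0, zero_pow two_ne_zero])
  have hD := (eq_one_of_proportional hx hq hu hζ hz hrH0 hrY0 (c := fun _ => 1)
    (by simpa using h)).1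
  have hD0 : DY z rY ≠ 0 := one_div_ne_zero (mul_ne_zero hz hrY0)
  have hrr : rY = ζ / z * rH := by
    rw [DH, DY, one_div, one_div, inv_inj] at hD
    field_simp
    rw [mul_comm, hD]
  have hρz : ζ / z * z = ζ := div_mul_cancel₀ _ hz
  have hDH : DY ζ rH = DY z rY := hD
  refine inTable_of_equations (ρ := ζ / z) hq hu (div_ne_zero hζ hz) hρz.symm
    hx.paramE_ne_neg_one ?_ ?_ ?_ ?_
  · rw [hrr, mul_pow, hrH, lambdaH, lambdaY] at hrY
    rw [hρz]
    field_simp at hrY ⊢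
    linear_combination hrY
  · have := h 2 one_le_two (PresentedGroup.of (crossLast 0) * PresentedGroup.of (crossLast 0))
    rw [homflypt_eq_deltaInv, deltaInv_of_sq isESolution_one, deltaInv_of_sq hx, hDH, paramE_one,
      mul_assoc, mul_assoc] at this
    have := mul_left_cancel₀ hD0 this
    rw [hrr, mul_pow] at this
    rw [hρz]
    refine mul_left_cancel₀ (pow_ne_zero 2 hrH0) ?_
    linear_combination this
  · have := h 2 one_le_two (PresentedGroup.of (crossLast 0) * PresentedGroup.of (crossLast 0)
      * PresentedGroup.of (crossLast 0))
    rw [homflypt_eq_deltaInv, deltaInv_of_cube isESolution_one, deltaInv_of_cube hx, hDH,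
      paramE_one, mul_assoc, mul_assoc] at this
    have := mul_left_cancel₀ hD0 this
    rw [hrr, mul_pow] at this
    rw [hρz]
    refine mul_left_cancel₀ (pow_ne_zero 3 hrH0) ?_
    linear_combination this
  · have := h 3 (by norm_num) figureEight
    rw [homflypt_eq_deltaInv, deltaInv_figureEight isESolution_one, deltaInv_figureEight hx, hDH,
      paramE_one] at this
    rw [hρz]
    exact mul_left_cancel₀ (pow_ne_zero 2 hD0) this

theorem exists_homflypt_eq_deltaInv (hx : IsESolution x) (hq : q ≠ 0) (hu : u ≠ 0)
    (hζ : ζ ≠ 0) (hz : z ≠ 0) (hrH : rH ^ 2 = lambdaH q ζ)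
    (h : InTable q ζ u z (paramE x)) :
    ∃ rY : K, rY ^ 2 = lambdaY u z (paramE x) ∧
      ∀ n, 1 ≤ n → ∀ α : BraidGroup n, homflypt hq ζ rH α = deltaInv x hu z rY α := by
  have hJ := isJuyumayaTrace_juyumayaTrace (d := d) (u := u) (z := z) hx.1
  have hu1 : u = 1 → ∀ r n (α : BraidGroup n),
      deltaInv x hu z r α = homflypt one_ne_zero z r α := fun hu1 r n α =>
    deltaInv_eq_homflypt hx.1 (hJ.quad_of_u_eq_one hx.1 hu1) hu one_ne_zero r α
  have hzE : z = -paramE x → ∀ r n (α : BraidGroup n),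
      deltaInv x hu z r α = homflypt one_ne_zero z r α := fun hzE r n α =>
    deltaInv_eq_homflypt hx.1 (hJ.quad_of_z_eq_neg hx hzE) hu one_ne_zero r α
  have hE1 : paramE x = 1 → ∀ r n (α : BraidGroup n),
      deltaInv x hu z r α = homflypt hu z r α := fun hE1 r n α =>
    deltaInv_eq_homflypt hx.1 (hJ.quad_of_paramE_eq_one hx hE1) hu hu r α
  -- `D_H = D_Y` forces this choice of the square root of `λ_Y`.
  refine ⟨ζ / z * rH, ?_, fun n _ α => ?_⟩
  · rw [mul_pow, hrH, lambdaH, lambdaY]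
    clear hJ hu1 hzE hE1 hrH
    generalize paramE x = E at h ⊢
    rcases h with h | h | h | h | h | h | h | h | h | h | h | h | h | h <;>
      obtain ⟨h1, h2, h3⟩ := h <;> simp only [h1, h2, h3] at hq hζ hu hz ⊢ <;>
      field_simp <;> ring_nf
  · have hchar : ∀ {p : K} (hp : p ≠ 0), ζ ^ 2 = (q - 1) * ζ + q → z ^ 2 = (p - 1) * z + p →
        homflypt hq ζ rH α = homflypt hp z (ζ / z * rH) α := fun hp h h' => by
      rw [homflypt_of_sq_eq hq hζ h, homflypt_of_sq_eq hp hz h', ← mul_assoc, mul_div_cancel₀ _ hz]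
    rcases h with h | h | h | h | h | h | h | h | h | h | h | h | h | h <;>
      obtain ⟨h1, h2, h3⟩ := h
    · subst h1
      rw [hu1 h3, h2, div_self hz, one_mul]
    · subst h1
      rw [hu1 h3]
      exact homflypt_symm _ _ (one_mul 1) (by rw [h2]; ring) (by rw [h2]; field_simp) α
    · rw [hu1 h2]
      exact hchar _ (by rw [h1]; ring) (by rw [h3]; ring)
    · rw [hu1 h2]
      exact hchar _ (by rw [h1]; ring) (by rw [h3]; ring)
    · rw [hu1 h2]
      exact hchar _ (by rw [h1]; ring) (by rw [h3]; ring)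
    · rw [hu1 h2]
      exact hchar _ (by rw [h1]; ring) (by rw [h3]; ring)
    · subst h1
      rw [hzE h3]
      have h2' : ζ = -z := by rw [h2, h3, neg_neg]
      exact homflypt_symm _ _ (one_mul 1) (by rw [h2']; ring) (by rw [h2']; field_simp) α
    · subst h1
      rw [hzE h3, h2, ← h3, div_self hz, one_mul]
    · rw [hE1 h3]
      exact hchar _ (by rw [h1]; ring) (by rw [h2]; ring)
    · rw [hE1 h3]
      exact hchar _ (by rw [h1]; ring) (by rw [h2]; ring)
    · rw [hE1 h3]
      exact hchar _ (by rw [h1]; ring) (by rw [h2]; ring)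
    · rw [hE1 h3]
      exact hchar _ (by rw [h1]; ring) (by rw [h2]; ring)
    · subst h1
      rw [hE1 h3, h2, div_self hz, one_mul]
    · rw [hE1 h3]
      exact homflypt_symm _ _ (by rw [h1]; field_simp) (by rw [h1, h2]; field_simp)
        (by rw [h1, h2]; field_simp) α

end Comparison

end InvariantComparison

theorem mainTheorem2 {K : Type*} [Field K] [CharZero K] [Algebra ℂ K]
    (d : ℕ) [NeZero d] (x : ZMod d → K) (hx : IsESolution x)
    (q ζ u z : K) (hq : q ≠ 0) (hζ : ζ ≠ 0) (hu : u ≠ 0) (hz : z ≠ 0)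
    (hlH : lambdaH q ζ ≠ 0) (hlY : lambdaY u z (paramE x) ≠ 0)
    (rH : K) (hrH : rH ^ 2 = lambdaH q ζ) :
    (∀ rY : K, rY ^ 2 = lambdaY u z (paramE x) →
      ((∃ c : ℕ → K,
          (∀ n, 1 ≤ n → c n ∈ IntermediateField.adjoin ℂ {q, ζ, u, z, paramE x}) ∧
          ∀ n, 1 ≤ n → ∀ α : BraidGroup n, homflypt hq ζ rH α = c n * deltaInv x hu z rY α) ↔
        ∀ n, 1 ≤ n → ∀ α : BraidGroup n, homflypt hq ζ rH α = deltaInv x hu z rY α) ∧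
      (∀ c : ℕ → K,
        (∀ n, 1 ≤ n → c n ∈ IntermediateField.adjoin ℂ {q, ζ, u, z, paramE x}) →
        (∀ n, 1 ≤ n → ∀ α : BraidGroup n,
          homflypt hq ζ rH α = c n * deltaInv x hu z rY α) →
        DH ζ rH = DY z rY ∧ ∀ n, 1 ≤ n → c n = 1)) ∧
    ((∃ rY : K, rY ^ 2 = lambdaY u z (paramE x) ∧
        ∀ n, 1 ≤ n → ∀ α : BraidGroup n, homflypt hq ζ rH α = deltaInv x hu z rY α) ↔
      InTable q ζ u z (paramE x)) := by

  have hrH0 : rH ≠ 0 := fun h0 => hlH (by rw [← hrH, h0, zero_pow two_ne_zero])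
  refine ⟨fun rY hrY => ?_, fun ⟨rY, hrY, h⟩ => ?_, fun h => ?_⟩
  · have hrY0 : rY ≠ 0 := fun h0 => hlY (by rw [← hrY, h0, zero_pow two_ne_zero])
    refine ⟨⟨fun ⟨c, _, h⟩ n hn α => ?_, fun h => ⟨fun _ => 1, fun _ _ => one_mem _, ?_⟩⟩,
      fun c _ h => eq_one_of_proportional hx hq hu hζ hz hrH0 hrY0 h⟩
    · rw [h n hn, (eq_one_of_proportional hx hq hu hζ hz hrH0 hrY0 h).2 n hn, one_mul]
    · simpa using h
  · exact inTable_of_homflypt_eq_deltaInv hx hq hu hζ hz hlH hlY hrH hrY h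
  · exact exists_homflypt_eq_deltaInv hx hq hu hζ hz hrH h
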